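/- Let $n\ge 0$ and identify $T^*S^n$ with $\{(u,v)\in\mathbb R^{n+1}\oplus\mathbb R^{n+1} : |u|=1,\ \langle u,v\rangle=0\}$, with the symplectic form $\omega$ obtained by restricting $\omega_{std}=\sum_k du_k\wedge dv_k$. Let $H(u,v)=|v|$; away from the zero section $H$ is smooth and its Hamiltonian flow is a circle action of period $2\pi$. Let $\omega_{FS}$ be the Fubini–Study form on $\mathbb{CP}^{n+1}$, normalized by $\pi^*\omega_{FS}=\omega_{std}|_{S^{2n+3}}$ for the projection $\pi:S^{2n+3}\to\mathbb{CP}^{n+1}$ of the unit sphere of $\mathbb C^{n+2}$, let $Q^n=\{z_0^2+\dots+z_{n+1}^2=0\}\subset\mathbb{CP}^{n+1}$ and $Q^{n-1}=Q^n\cap\{z_{n+1}=0\}$. Write $S^n\subset T^*S^n$ for the zero section. The symplectic cut of $T^*S^n$ along $H^{-1}(1)$ is a $2n$-dimensional symplectic manifold $(X,\omega_X)$ with a surjective map $\psi:\{H\le 1\}\to X$ such that: $\psi$ restricts to a symplectomorphism from $\{H<1\}$ onto an open subset of $X$ that is disjoint from $\psi(H^{-1}(1))$; the image $\psi(\{0<H\le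 1\})$ is open in $X$; and there is a map $\Psi$ from $Z=\{(x,w)\in (T^*S^n\setminus S^n)\times\mathbb C : H(x)+\tfrac12|w|^2=1\}$ to $X$ that exhibits $\psi(\{0<H\le 1\})$ with the form $\omega_X$ as the symplectic reduction of $(T^*S^n\setminus S^n)\times\mathbb C$, with the form $\omega\oplus\omega_{\mathbb C}$, $\omega_{\mathbb C}=da\wedge db$ on $\mathbb C=\{a+ib\}$, at the level $1$ of the Hamiltonian $H(x)+\frac12|w|^2$, with $\Psi(x,\sqrt{2(1-H(x))})=\psi(x)$ whenever $0<H(x)\le 1$. (Here a map on a level set of a Hamiltonian exhibits a submanifold, with a form $\eta$, as the symplectic reduction if it is a smooth submersion of the level set onto the submanifold, its fibres are the orbits of the Hamiltonian flow, and it pulls $\eta$ back to the restriction of the symplectic form.) Then such a cut exists, and for every such $(X,\omega_X,\psi)$ there is a symplectomorphism $F:(X,\omega_X)\to(Q^n,2\omega_{FS}|_{Q^n})$ such that $F\circ\psi$ exhibits $(Q^{n-1},2\omega_{FS}|_{Q^{n-1}})$ as the symplectic reduction of the unit cosphere bundle $H^{-1}(1)$ by the Hamiltonian flow of $H$. -/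

import Mathlib

open scoped Manifold ContDiff Topology LinearAlgebra.Projectivization InnerProductSpace

noncomputable section

/-! ### Differential forms of degree two and symplectic forms on manifolds -/

section Forms

variable {E X : Type*} [NormedAddCommGroup E] [NormedSpace ℝ E]
  [TopologicalSpace X] [ChartedSpace E X]

/-- A (not necessarily continuous) field of alternating two-forms on the tangent spaces of a
manifold `X` without boundary, modelled on `E`. -/
abbrev TwoForm (E X : Type*) [NormedAddCommGroup E] [NormedSpace ℝ E]
    [TopologicalSpace X] [ChartedSpace E X] : Type _ :=
  ∀ x : X, TangentSpace 𝓘(ℝ, E) x [⋀^Fin 2]→L[ℝ] ℝ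

/-- The expression of a two-form in the chart `e`: its pullback by `e.symm`. -/
def TwoForm.inChart (η : TwoForm E X) (e : OpenPartialHomeomorph X E) (y : E) :
    E [⋀^Fin 2]→L[ℝ] ℝ :=
  (η (e.symm y)).compContinuousLinearMap (mfderiv 𝓘(ℝ, E) 𝓘(ℝ, E) e.symm y)

/-- Symplectic forms: smooth, closed, nondegenerate two-forms. -/
structure IsSymplecticForm (η : TwoForm E X) : Prop where
  smooth : ∀ e ∈ atlas E X, ContDiffOn ℝ ∞ (η.inChart e) e.target
  closed : ∀ e ∈ atlas E X, ∀ y ∈ e.target, extDeriv (η.inChart e) y = 0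
  nondegenerate : ∀ (x : X) (a : TangentSpace 𝓘(ℝ, E) x), (∀ b, η x ![a, b] = 0) → a = 0

end Forms

/-! ### Hamiltonian dynamics, symplectic reduction and symplectic cuts

Here `S` is an embedded submanifold of a normed space `V`, and `Ω` is a bilinear form on `V`, of
which only the restriction to the tangent spaces of `S` matters. The tangent space of `S` at `x` is
`tangentConeAt ℝ S x`, a map on `S` is smooth if it satisfies `ContMDiffOn` on the set `S`, and its
differential is the restriction of `mfderivWithin` to the tangent space (where it is independent of
the choice that `mfderivWithin` involves). -/

section Cut

variable {V : Type*} [NormedAddCommGroup V] [NormedSpace ℝ V]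
  {E X : Type*} [NormedAddCommGroup E] [NormedSpace ℝ E] [TopologicalSpace X] [ChartedSpace E X]

/-- The map `f`, restricted to `S`, pulls the two-form `η` back to `Ω`. -/
def PullsBackOn (Ω : V → V → ℝ) (S : Set V) (f : V → X) (η : TwoForm E X) : Prop :=
  ∀ x ∈ S, ∀ a ∈ tangentConeAt ℝ S x, ∀ b ∈ tangentConeAt ℝ S x,
    η (f x) ![mfderivWithin 𝓘(ℝ, V) 𝓘(ℝ, E) f S x a, mfderivWithin 𝓘(ℝ, V) 𝓘(ℝ, E) f S x b] =
      Ω a b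

/-- `γ` is a trajectory, in `S` and for all times, of the Hamiltonian vector field `ξ` of `H`,
which is given by `Ω(ξ, ·) = dH` on the tangent spaces of `S`. -/
def IsHamiltonianTrajectory (Ω : V → V → ℝ) (S : Set V) (H : V → ℝ) (γ : ℝ → V) : Prop :=
  ∀ t, γ t ∈ S ∧ ∃ ξ, HasDerivAt γ ξ t ∧
    ∀ b ∈ tangentConeAt ℝ S (γ t), Ω ξ b = fderivWithin ℝ H S (γ t) b

/-- `x` and `y` lie on the same orbit of the Hamiltonian flow of `H` on `S`. -/
def SameOrbit (Ω : V → V → ℝ) (S : Set V) (H : V → ℝ) (x y : V) : Prop :=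
  ∃ γ, IsHamiltonianTrajectory Ω S H γ ∧ γ 0 = x ∧ ∃ t, γ t = y

/-- `H` generates an action of the circle `ℝ / 2πℤ` on `S`. -/
def GeneratesCircleAction (Ω : V → V → ℝ) (S : Set V) (H : V → ℝ) : Prop :=
  ∀ x ∈ S, ∃ γ, IsHamiltonianTrajectory Ω S H γ ∧ γ 0 = x ∧
    Function.Periodic γ (2 * Real.pi)

/-- The map `π` exhibits the submanifold `R` of `X`, with the restriction of `η`, as the symplectic
reduction of `(S, Ω)` at the level `s` of the Hamiltonian `K`: restricted to the level set, `π` is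
a smooth map onto `R`, its fibres are the orbits of the Hamiltonian flow of `K`, it is a submersion
onto `R` (it has smooth local sections through all points of the level set), and it pulls
`η` back to `Ω`. -/
structure IsSymplecticReduction (Ω : V → V → ℝ) (S : Set V) (K : V → ℝ) (s : ℝ)
    (π : V → X) (R : Set X) (η : TwoForm E X) : Prop where
  smooth : ContMDiffOn 𝓘(ℝ, V) 𝓘(ℝ, E) ∞ π {x ∈ S | K x = s}
  image_eq : π '' {x ∈ S | K x = s} = R
  fibres : ∀ x ∈ S, K x = s → ∀ y ∈ S, K y = s → (π x = π y ↔ SameOrbit Ω S K x y)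
  sections : ∀ x ∈ S, K x = s → ∃ O ∈ 𝓝 (π x), ∃ σ : X → V,
    ContMDiffOn 𝓘(ℝ, E) 𝓘(ℝ, V) ∞ σ (R ∩ O) ∧ σ (π x) = x ∧
      ∀ y ∈ R ∩ O, σ y ∈ S ∧ K (σ y) = s ∧ π (σ y) = y
  pullsBack : PullsBackOn Ω {x ∈ S | K x = s} π η

/-- Restricted to `S`, the map `f` is a symplectic diffeomorphism from `(S, Ω)` onto an open
subset of `(X, η)`. -/
structure IsSymplecticOpenEmbeddingOn (Ω : V → V → ℝ) (S : Set V) (f : V → X)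
    (η : TwoForm E X) : Prop where
  smooth : ContMDiffOn 𝓘(ℝ, V) 𝓘(ℝ, E) ∞ f S
  isOpen_image : IsOpen (f '' S)
  inverse : ∃ g : X → V, ContMDiffOn 𝓘(ℝ, E) 𝓘(ℝ, V) ∞ g (f '' S) ∧ ∀ x ∈ S, g (f x) = x
  pullsBack : PullsBackOn Ω S f η

/-- The form `Ω ⊕ ω_ℂ` on `V × ℂ`, where `ω_ℂ` is the standard symplectic form `da ∧ db` on
`ℂ = {a + i b}`. -/
def formProdComplex (Ω : V → V → ℝ) (x y : V × ℂ) : ℝ :=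
  Ω x.1 y.1 + (x.2.re * y.2.im - x.2.im * y.2.re)

/-- The Hamiltonian `H(x) + |w|² / 2` on `V × ℂ`. -/
def cutHamiltonian (H : V → ℝ) (x : V × ℂ) : ℝ :=
  H x.1 + ‖x.2‖ ^ 2 / 2

/-- The symplectic manifold `(X, ωX)`, together with the map `ψ` from the sublevel set `{H ≤ s}` of
`S` to `X`, is the symplectic cut of `(S, Ω)` along the level set `{H = s}`. The function `H` is
required to be smooth, and to generate a circle action, only on an open part `S ∩ U` of `S` that
contains the level set.

The open sublevel set `{H < s}` is left intact (`interior`), and `{x ∈ S ∩ U | H x ≤ s}` is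
replaced by the reduction of `(S ∩ U) × ℂ` at the level `s` of `H(x) + |w|² / 2`, in such a way
that `ψ x` is the class of `(x, √(2 (s - H x)))` (`boundary`). Thus `ψ` collapses the orbits of the
circle action on `{H = s}`, and `ψ '' {H = s}` is the reduced level set inside the cut. -/
structure IsSymplecticCut (Ω : V → V → ℝ) (S U : Set V) (H : V → ℝ) (s : ℝ)
    (ωX : TwoForm E X) (ψ : V → X) : Prop where
  isOpen_domain : IsOpen U
  smooth_hamiltonian : ContDiffOn ℝ ∞ H (S ∩ U)
  level_subset : ∀ x ∈ S, H x = s → x ∈ U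
  circleAction : GeneratesCircleAction Ω (S ∩ U) H
  isSymplecticForm : IsSymplecticForm ωX
  surjective : ψ '' {x ∈ S | H x ≤ s} = Set.univ
  disjoint : Disjoint (ψ '' {x ∈ S | H x < s}) (ψ '' {x ∈ S | H x = s})
  interior : IsSymplecticOpenEmbeddingOn Ω {x ∈ S | H x < s} ψ ωX
  isOpen_boundary : IsOpen (ψ '' {x ∈ S ∩ U | H x ≤ s})
  boundary : ∃ Ψ : V × ℂ → X,
    IsSymplecticReduction (formProdComplex Ω) ((S ∩ U) ×ˢ Set.univ) (cutHamiltonian H) s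
      Ψ (ψ '' {x ∈ S ∩ U | H x ≤ s}) ωX ∧
    ∀ x ∈ S ∩ U, H x ≤ s → Ψ (x, (Real.sqrt (2 * (s - H x)) : ℂ)) = ψ x

end Cut

/-! ### The cotangent bundle of the sphere -/

/-- The cotangent bundle of `S^n`, as the set of `(u, v)` in `ℝ^{n+1} ⊕ ℝ^{n+1}` with
`|u| = 1` and `⟨u, v⟩ = 0`. -/
def cotangentSphere (n : ℕ) :
    Set (EuclideanSpace ℝ (Fin (n + 1)) × EuclideanSpace ℝ (Fin (n + 1))) :=
  {x | ‖x.1‖ = 1 ∧ ⟪x.1, x.2⟫_ℝ = 0}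

/-- The standard symplectic form `∑ du_k ∧ dv_k` on `ℝ^m ⊕ ℝ^m`. -/
def stdForm (m : ℕ) (x y : EuclideanSpace ℝ (Fin m) × EuclideanSpace ℝ (Fin m)) : ℝ :=
  ⟪x.1, y.2⟫_ℝ - ⟪x.2, y.1⟫_ℝ

/-! ### Complex projective space -/

/-- Complex projective space `ℂP^N`. -/
def CP (N : ℕ) : Type := ℙ ℂ (EuclideanSpace ℂ (Fin (N + 1)))

namespace CP

variable {N : ℕ}

/-- The point `[v]` of `ℂP^N`. -/
def mk (v : EuclideanSpace ℂ (Fin (N + 1))) (hv : v ≠ 0) : CP N := Projectivization.mk ℂ v hv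

/-- A vector of homogeneous coordinates of a point. -/
def rep (x : CP N) : EuclideanSpace ℂ (Fin (N + 1)) := Projectivization.rep x

theorem rep_ne_zero (x : CP N) : x.rep ≠ 0 := Projectivization.rep_nonzero x

theorem mk_rep (x : CP N) : mk x.rep x.rep_ne_zero = x := Projectivization.mk_rep x

theorem exists_rep_mk (v : EuclideanSpace ℂ (Fin (N + 1))) (hv : v ≠ 0) :
    ∃ c : ℂ, c ≠ 0 ∧ (mk v hv).rep = c • v := by
  obtain ⟨a, ha⟩ := Projectivization.exists_smul_eq_mk_rep ℂ v hv
  exact ⟨a, a.ne_zero, ha.symm⟩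

theorem mk_smul (v : EuclideanSpace ℂ (Fin (N + 1))) (hv : v ≠ 0) (c : ℂ) (hc : c • v ≠ 0) :
    mk (c • v) hc = mk v hv :=
  (Projectivization.mk_eq_mk_iff' ℂ _ _ hc hv).2 ⟨c, rfl⟩

/-- The quotient topology. -/
instance : TopologicalSpace (CP N) :=
  TopologicalSpace.coinduced
    (fun v : {v : EuclideanSpace ℂ (Fin (N + 1)) // v ≠ 0} => mk v.1 v.2) inferInstance

theorem isQuotientMap_mk : Topology.IsQuotientMap
    (fun v : {v : EuclideanSpace ℂ (Fin (N + 1)) // v ≠ 0} => mk v.1 v.2) :=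
  ⟨⟨rfl⟩, fun x => ⟨⟨x.rep, x.rep_ne_zero⟩, mk_rep x⟩⟩

/-- The vector `(ζ_0, …, 1, …, ζ_{N-1})` with `1` in position `j`. -/
def affineLift (j : Fin (N + 1)) (ζ : EuclideanSpace ℂ (Fin N)) :
    EuclideanSpace ℂ (Fin (N + 1)) :=
  WithLp.toLp 2 (j.insertNth (1 : ℂ) (WithLp.ofLp ζ) : Fin (N + 1) → ℂ)

theorem affineLift_ne_zero (j : Fin (N + 1)) (ζ : EuclideanSpace ℂ (Fin N)) :
    affineLift j ζ ≠ 0 := by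
  intro h
  have := congrArg (fun v : EuclideanSpace ℂ (Fin (N + 1)) => v j) h
  simp [affineLift] at this

/-- The differential of `affineLift j`: insertion of `0` in position `j`. -/
def affineInclusion (j : Fin (N + 1)) :
    EuclideanSpace ℂ (Fin N) →L[ℝ] EuclideanSpace ℂ (Fin (N + 1)) :=
  LinearMap.toContinuousLinearMap
    { toFun := fun a => WithLp.toLp 2 (j.insertNth (0 : ℂ) (WithLp.ofLp a) : Fin (N + 1) → ℂ)
      map_add' := fun a b => by
        ext k
        refine Fin.succAboveCases j ?_ (fun i => ?_) k <;> simp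
      map_smul' := fun c a => by
        ext k
        refine Fin.succAboveCases j ?_ (fun i => ?_) k <;> simp }

/-- The affine coordinates `z_k / z_j`, `k ≠ j`, of a point `[z]`. -/
def affineCoord (j : Fin (N + 1)) (x : CP N) : EuclideanSpace ℂ (Fin N) :=
  WithLp.toLp 2 fun k => x.rep (j.succAbove k) / x.rep j

theorem affineCoord_mk (j : Fin (N + 1)) (v : EuclideanSpace ℂ (Fin (N + 1))) (hv : v ≠ 0) :
    affineCoord j (mk v hv) = WithLp.toLp 2 fun k => v (j.succAbove k) / v j := by
  obtain ⟨c, hc, h⟩ := exists_rep_mk v hv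
  ext k
  simp [affineCoord, h, mul_div_mul_left _ _ hc]

theorem rep_mk_apply_ne_zero (j : Fin (N + 1)) (v : EuclideanSpace ℂ (Fin (N + 1)))
    (hv : v ≠ 0) : (mk v hv).rep j ≠ 0 ↔ v j ≠ 0 := by
  obtain ⟨c, hc, h⟩ := exists_rep_mk v hv
  simp [h, hc]

theorem isOpen_affine (j : Fin (N + 1)) : IsOpen {x : CP N | x.rep j ≠ 0} := by
  rw [← isQuotientMap_mk.isOpen_preimage]
  have : (fun v : {v : EuclideanSpace ℂ (Fin (N + 1)) // v ≠ 0} => mk v.1 v.2) ⁻¹'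
      {x : CP N | x.rep j ≠ 0} = {v | v.1 j ≠ 0} := by
    ext v
    exact rep_mk_apply_ne_zero j v.1 v.2
  rw [this]
  exact isOpen_ne_fun (by fun_prop) continuous_const

theorem continuous_affineLift (j : Fin (N + 1)) : Continuous (affineLift (N := N) j) := by
  refine (PiLp.continuous_toLp 2 _).comp (continuous_pi fun k => ?_)
  refine Fin.succAboveCases j ?_ (fun i => ?_) k
  · simpa using continuous_const
  · simp only [Fin.insertNth_apply_succAbove]
    fun_prop

theorem affineLift_affineCoord (j : Fin (N + 1)) (x : CP N) (hx : x.rep j ≠ 0) :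
    affineLift j (affineCoord j x) = (x.rep j)⁻¹ • x.rep := by
  ext k
  refine Fin.succAboveCases j ?_ (fun i => ?_) k
  · simp [affineLift, hx]
  · simp [affineLift, affineCoord, div_eq_inv_mul]

/-- The affine chart `[z] ↦ (z_k / z_j)_{k ≠ j}` on `{z_j ≠ 0}`. -/
def affineChart (j : Fin (N + 1)) : OpenPartialHomeomorph (CP N) (EuclideanSpace ℂ (Fin N)) where
  toFun := affineCoord j
  invFun ζ := mk (affineLift j ζ) (affineLift_ne_zero j ζ)
  source := {x | x.rep j ≠ 0}
  target := Set.univ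
  map_source' _ _ := Set.mem_univ _
  map_target' ζ _ := by
    refine (rep_mk_apply_ne_zero j _ _).2 ?_
    simp [affineLift]
  left_inv' x hx := by
    have h := affineLift_affineCoord j x hx
    have h2 : (x.rep j)⁻¹ • x.rep ≠ 0 := h ▸ affineLift_ne_zero j _
    calc mk (affineLift j (affineCoord j x)) (affineLift_ne_zero j _)
        = mk ((x.rep j)⁻¹ • x.rep) h2 := by congr 1
      _ = x := by rw [mk_smul _ x.rep_ne_zero, mk_rep]
  right_inv' ζ _ := by
    rw [affineCoord_mk]
    ext k
    simp [affineLift]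
  open_source := isOpen_affine j
  open_target := isOpen_univ
  continuousOn_toFun := by
    rw [isQuotientMap_mk.continuousOn_isOpen_iff (isOpen_affine j)]
    have : (affineCoord j ∘ fun v : {v : EuclideanSpace ℂ (Fin (N + 1)) // v ≠ 0} =>
        mk v.1 v.2) = fun v => WithLp.toLp 2 fun k => v.1 (j.succAbove k) / v.1 j := by
      funext v
      exact affineCoord_mk j v.1 v.2
    rw [this]
    refine (PiLp.continuous_toLp 2 _).comp_continuousOn (continuousOn_pi.2 fun k => ?_)
    refine ContinuousOn.div (by fun_prop) (by fun_prop) fun v hv => ?_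
    exact (rep_mk_apply_ne_zero j v.1 v.2).1 hv
  continuousOn_invFun := by
    refine Continuous.continuousOn ?_
    exact isQuotientMap_mk.continuous.comp
      ((continuous_affineLift j).subtype_mk (affineLift_ne_zero j))

theorem exists_rep_apply_ne_zero (x : CP N) : ∃ j, x.rep j ≠ 0 := by
  by_contra! h
  exact x.rep_ne_zero (by ext j; simpa using h j)

/-- An index `j` with `z_j ≠ 0`. -/
def chartIndex (x : CP N) : Fin (N + 1) := (exists_rep_apply_ne_zero x).choose

/-- The atlas of affine charts. -/
instance : ChartedSpace (EuclideanSpace ℂ (Fin N)) (CP N) where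
  atlas := Set.range affineChart
  chartAt x := affineChart x.chartIndex
  mem_chart_source x := (exists_rep_apply_ne_zero x).choose_spec
  chart_mem_atlas x := ⟨x.chartIndex, rfl⟩

instance : IsManifold 𝓘(ℝ, EuclideanSpace ℂ (Fin N)) ∞ (CP N) := by
  refine isManifold_of_contDiffOn _ _ _ ?_
  rintro _ _ ⟨i, rfl⟩ ⟨j, rfl⟩
  simp only [modelWithCornersSelf_coe, modelWithCornersSelf_coe_symm, Set.range_id,
    Set.inter_univ, Function.comp_id, Function.id_comp, Set.preimage_id_eq, id_eq]
  have h : ∀ ζ, ((affineChart i).symm ≫ₕ affineChart j) ζ =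
      WithLp.toLp 2 fun k => affineLift i ζ (j.succAbove k) / affineLift i ζ j := fun ζ =>
    affineCoord_mk j _ (affineLift_ne_zero i ζ)
  have hl : ∀ k, ContDiff ℝ ∞ fun ζ : EuclideanSpace ℂ (Fin N) => affineLift i ζ k := by
    intro k
    refine Fin.succAboveCases i ?_ (fun l => ?_) k
    · simpa [affineLift] using contDiff_const
    · simp only [affineLift, Fin.insertNth_apply_succAbove]
      fun_prop
  refine ContDiffOn.congr ?_ fun ζ _ => h ζ
  refine contDiffOn_piLp' (p := 2) fun k => ?_
  simp only [div_eq_mul_inv]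
  refine (hl _).contDiffOn.mul (ContDiffOn.inv (hl _).contDiffOn fun ζ hζ => ?_)
  exact (rep_mk_apply_ne_zero j _ (affineLift_ne_zero i ζ)).1 hζ.2

/-- The standard symplectic form `∑ dx_k ∧ dy_k` on `ℂ^m`, that is `(a, b) ↦ Im ∑ ā_k b_k`. -/
def stdComplexForm (m : ℕ) : EuclideanSpace ℂ (Fin m) [⋀^Fin 2]→L[ℝ] ℝ where
  toFun v := (⟪v 0, v 1⟫_ℂ).im
  map_update_add' v i x y := by
    fin_cases i
    · simp
    · simp
  map_update_smul' v i c x := by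
    fin_cases i
    · simp
    · simp
  cont := by fun_prop
  map_eq_zero_of_eq' v i j h hij := by
    have h01 : v 0 = v 1 := by
      fin_cases i <;> fin_cases j <;> simp_all
    rw [h01]
    exact inner_self_im (𝕜 := ℂ) (v 1)

/-- The orthogonal projection of `ℂ^m` along `z` onto the Hermitian complement of `z`. -/
def horizontal {m : ℕ} (z : EuclideanSpace ℂ (Fin m)) :
    EuclideanSpace ℂ (Fin m) →L[ℝ] EuclideanSpace ℂ (Fin m) :=
  ((ℂ ∙ z)ᗮ.starProjection).restrictScalars ℝ

/-- The Fubini–Study form, normalized by `π^* ω_FS = ω_std` on the unit sphere, where `π` is the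
projection of the unit sphere to `ℂP^N`. Tangent vectors of `ℂP^N` at `x` are given by their
coordinates in the affine chart at `x`; they are lifted to tangent vectors at the point
`z = affineLift j ζ` over `x`, these are projected to the horizontal space `z^⊥`, and
dividing by `|z|²` is the same as moving `z` to the unit sphere by scaling. -/
def fubiniStudy (N : ℕ) : TwoForm (EuclideanSpace ℂ (Fin N)) (CP N) := fun x =>
  let j := x.chartIndex
  let z := affineLift j (affineCoord j x)
  ((‖z‖ ^ 2)⁻¹ • (stdComplexForm (N + 1)).compContinuousLinearMap
    (horizontal z ∘L affineInclusion j) : EuclideanSpace ℂ (Fin N) [⋀^Fin 2]→L[ℝ] ℝ)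

/-- The quadric `Q^n = {z_0² + ⋯ + z_{n+1}² = 0}` in `ℂP^{n+1}`. -/
def quadric (n : ℕ) : Set (CP (n + 1)) := {x | ∑ k, x.rep k ^ 2 = 0}

/-- The quadric `Q^{n-1}`, as the intersection of `Q^n` with the hyperplane `{z_{n+1} = 0}` of
`ℂP^{n+1}`. -/
def hyperplaneQuadric (n : ℕ) : Set (CP (n + 1)) :=
  {x ∈ quadric n | x.rep (Fin.last (n + 1)) = 0}

end CP

/-! ### Symplectomorphisms onto submanifolds -/

/-- `F` is a symplectomorphism from `(X, ωX)` onto the submanifold `Q` of `Y` with the restriction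
of `η`: a smooth embedding with image `Q` that pulls `η` back to `ωX`. -/
structure IsSymplectomorphismOnto {E X E' Y : Type*} [NormedAddCommGroup E] [NormedSpace ℝ E]
    [TopologicalSpace X] [ChartedSpace E X] [NormedAddCommGroup E'] [NormedSpace ℝ E']
    [TopologicalSpace Y] [ChartedSpace E' Y]
    (ωX : TwoForm E X) (F : X → Y) (Q : Set Y) (η : TwoForm E' Y) : Prop where
  isSmoothEmbedding : Manifold.IsSmoothEmbedding 𝓘(ℝ, E) 𝓘(ℝ, E') ∞ F
  range_eq : Set.range F = Q
  pullsBack : ∀ (x : X) (a b : TangentSpace 𝓘(ℝ, E) x),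
    η (F x) ![mfderiv 𝓘(ℝ, E) 𝓘(ℝ, E') F x a, mfderiv 𝓘(ℝ, E) 𝓘(ℝ, E') F x b] = ωX x ![a, b]

/-- `(X, ωX)` with `ψ` is the symplectic cut of `T^*S^n` along `{H = 1}`, for
`H (u, v) = |v|`, which is smooth away from the zero section. -/
def IsUnitCut {X : Type*} (n : ℕ) [TopologicalSpace X]
    [ChartedSpace (EuclideanSpace ℝ (Fin (2 * n))) X]
    (ωX : TwoForm (EuclideanSpace ℝ (Fin (2 * n))) X)
    (ψ : EuclideanSpace ℝ (Fin (n + 1)) × EuclideanSpace ℝ (Fin (n + 1)) → X) : Prop :=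
  IsSymplecticCut (stdForm (n + 1)) (cotangentSphere n) {x | x.2 ≠ 0} (fun x => ‖x.2‖) 1 ωX ψ

end

open scoped Manifold ContDiff Topology LinearAlgebra.Projectivization InnerProductSpace

noncomputable section

/-! ### Tangent cones and differentials -/

section TangentCone

variable {V W : Type*} [NormedAddCommGroup V] [NormedSpace ℝ V] [NormedAddCommGroup W]
  [NormedSpace ℝ W]
  {E X E' Y : Type*} [NormedAddCommGroup E] [NormedSpace ℝ E] [TopologicalSpace X]
  [ChartedSpace E X] [NormedAddCommGroup E'] [NormedSpace ℝ E'] [TopologicalSpace Y]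
  [ChartedSpace E' Y]

/-! The model is explicit. The lift L(u, v) = (u + iv, i√(1 - |v|²)) (`discLift`) sends the closed
unit disc bundle to isotropic vectors of norm √2, and on the sphere of radius √2 the standard form
is the pullback of 2ω_FS (`CP.two_fubiniStudy_mfderivWithin`). The last coordinate of L stays in the
line iℝ, so L pulls the standard form back to ∑ du_k ∧ dv_k. Thus [L] embeds the open disc bundle
symplectically, with image the complement of the hyperplane section in the quadric.

At |v| = 1 the square root in L is singular, and the extra variable w of the cut repairs this. Put e
= u + is with s = v/|v|, r² = (1 + |v|)/2 and c = w/2. The level set becomes r² + |c|² = 1, and the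
lift M = (r²e + c²ē, 2irc) (`reductionLift`) is smooth for v ≠ 0, has norm √2, pulls the standard
form back to ω ⊕ ω_ℂ (`exists_hasFDerivAt_reductionLift`), and equals L at w = √(2(1 - |v|))
(`reductionLift_sqrt`). The circle action multiplies e, w and M by e^{-it}
(`reductionLift_normFlow`), so [M] is constant on orbits. Conversely |v|, e and w can be solved for
from M by functions that are homogeneous under complex scaling. Hence the fibres of [M] are exactly
the orbits (`proj_reductionLift_eq_iff`), and [M] has smooth local sections
(`exists_section_reductionLift`). At w = 0 the same facts give the reduction of the unit cosphere
bundle to the hyperplane section (`isSymplecticReduction_hyperplaneQuadric`).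

For an arbitrary cut, ψ and [L] make the same identifications on the closed disc bundle
(`IsUnitCut.eq_iff`), so F(ψ x) = [L x] is a well-defined bijection onto the quadric. It is smooth
and symplectic because locally it is [L] after the inverse of ψ, or [M] after a section of Ψ.
Nondegeneracy of ω_X makes its differentials injective, and X is compact as the image of the closed
disc bundle, so F is an embedding.

For existence, the quadric with the map [L] is itself a cut (`Quadric.isUnitCut`). The restricted
form is closed because its lift has the primitive Im⟨z, dz⟩/|z|², and nondegenerate because the
quadric has holomorphic parametrizations and the form is positive on complex lines. -/

theorem HasFDerivWithinAt.eq_zero_of_mem_tangentConeAt {f : V → W} {f' : V →L[ℝ] W} {S : Set V}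
    {x a : V} {c : W} (h : HasFDerivWithinAt f f' S x) (hS : ∀ y ∈ S, f y = c) (hx : x ∈ S)
    (ha : a ∈ tangentConeAt ℝ S x) : f' a = 0 := by
  have h0 : HasFDerivWithinAt f (0 : V →L[ℝ] W) S x :=
    (hasFDerivWithinAt_const c x S).congr hS (hS x hx)
  simpa using h.unique_on h0 ha

theorem HasFDerivAt.mem_tangentConeAt {f : W → V} {f' : W →L[ℝ] V} {y : W} {S : Set V}
    (h : HasFDerivAt f f' y) (hS : ∀ᶠ z in 𝓝 y, f z ∈ S) (a : W) :
    f' a ∈ tangentConeAt ℝ S (f y) := by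
  have ha : a ∈ tangentConeAt ℝ (f ⁻¹' S) y := by
    rw [tangentConeAt_of_mem_nhds (s := f ⁻¹' S) hS]; trivial
  have h1 := (h.hasFDerivWithinAt (s := f ⁻¹' S)).mapsTo_tangent_cone ha
  exact tangentConeAt_mono (𝕜 := ℝ) (x := f y) (Set.image_preimage_subset f S) h1

theorem HasDerivAt.mem_tangentConeAt {γ : ℝ → V} {ξ : V} {t : ℝ} {S : Set V}
    (h : HasDerivAt γ ξ t) (hS : ∀ᶠ τ in 𝓝 t, γ τ ∈ S) : ξ ∈ tangentConeAt ℝ S (γ t) := by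
  simpa using h.hasFDerivAt.mem_tangentConeAt hS 1

theorem hasMFDerivWithinAt_iff_chartAt_comp {f : V → X} {S : Set V} {x : V} {f' : V →L[ℝ] E} :
    HasMFDerivWithinAt 𝓘(ℝ, V) 𝓘(ℝ, E) f S x f' ↔
      ContinuousWithinAt f S x ∧ HasFDerivWithinAt (fun y => chartAt E (f x) (f y)) f' S x := by
  unfold HasMFDerivWithinAt
  refine and_congr Iff.rfl ?_
  have : ((extChartAt 𝓘(ℝ, V) x).symm ⁻¹' S ∩ Set.range 𝓘(ℝ, V)) = S := by
    simp
    rfl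
  rw [this]
  rfl

theorem HasMFDerivAt.hasFDerivAt_comp_chartAt_symm {g : X → V} {y : X} {g' : E →L[ℝ] V}
    (h : HasMFDerivAt 𝓘(ℝ, E) 𝓘(ℝ, V) g y g') :
    HasFDerivAt (fun z => g ((chartAt E y).symm z)) g' (chartAt E y y) := by
  have h2 := h.2
  have : Set.range 𝓘(ℝ, E) = Set.univ := by simp
  rw [this] at h2
  exact hasFDerivWithinAt_univ.1 h2

/-- Level sets have empty interior, so a derivative within them is not unique as a linear map. Its
values on the tangent cone are unique, and only these values enter the definitions. -/
theorem HasMFDerivWithinAt.eq_of_mem_tangentConeAt {f : V → X} {S : Set V} {x a : V}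
    {f' f'' : TangentSpace 𝓘(ℝ, V) x →L[ℝ] TangentSpace 𝓘(ℝ, E) (f x)}
    (h' : HasMFDerivWithinAt 𝓘(ℝ, V) 𝓘(ℝ, E) f S x f')
    (h'' : HasMFDerivWithinAt 𝓘(ℝ, V) 𝓘(ℝ, E) f S x f'') (ha : a ∈ tangentConeAt ℝ S x) :
    f' a = f'' a :=
  (hasMFDerivWithinAt_iff_chartAt_comp.1 h').2.unique_on
    (hasMFDerivWithinAt_iff_chartAt_comp.1 h'').2 ha

/-- The chain rule, on tangent vectors, for maps on a subset of a vector space. -/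
theorem mfderivWithin_comp_of_mem_tangentConeAt {f : V → X} {F : X → Y} {G : V → Y} {S : Set V}
    {x a : V} (hf : MDifferentiableWithinAt 𝓘(ℝ, V) 𝓘(ℝ, E) f S x)
    (hF : MDifferentiableAt 𝓘(ℝ, E) 𝓘(ℝ, E') F (f x)) (hx : x ∈ S) (hG : ∀ y ∈ S, G y = F (f y))
    (ha : a ∈ tangentConeAt ℝ S x) :
    mfderivWithin 𝓘(ℝ, V) 𝓘(ℝ, E') G S x a =
      mfderiv 𝓘(ℝ, E) 𝓘(ℝ, E') F (f x) (mfderivWithin 𝓘(ℝ, V) 𝓘(ℝ, E) f S x a) := by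
  have h1 := (hF.hasMFDerivAt.comp_hasMFDerivWithinAt x hf.hasMFDerivWithinAt).congr_of_eventuallyEq
    (f₁ := G) (Filter.eventuallyEq_of_mem self_mem_nhdsWithin hG) (hG x hx)
  have h2 := h1.mdifferentiableWithinAt.hasMFDerivWithinAt
  exact h2.eq_of_mem_tangentConeAt h1 ha

theorem MDifferentiableAt.mfderiv_mem_tangentConeAt {g : X → V} {y : X} {S : Set V}
    (hg : MDifferentiableAt 𝓘(ℝ, E) 𝓘(ℝ, V) g y) (hS : ∀ᶠ z in 𝓝 y, g z ∈ S)
    (a : TangentSpace 𝓘(ℝ, E) y) :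
    (mfderiv 𝓘(ℝ, E) 𝓘(ℝ, V) g y a : V) ∈ tangentConeAt ℝ S (g y) := by
  have h1 := HasMFDerivAt.hasFDerivAt_comp_chartAt_symm hg.hasMFDerivAt
  have hc := ((chartAt E y).continuousAt_symm (mem_chart_target E y)).tendsto
  rw [(chartAt E y).left_inv (mem_chart_source E y)] at hc
  have h3 := h1.mem_tangentConeAt (S := S) (hc.eventually hS) a
  rwa [(chartAt E y).left_inv (mem_chart_source E y)] at h3

/-- A local section of a map makes its differential surjective. -/
theorem exists_mem_tangentConeAt_mfderivWithin_eq {f : V → X} {S : Set V} {x : V} (hx : x ∈ S)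
    (hf : MDifferentiableWithinAt 𝓘(ℝ, V) 𝓘(ℝ, E) f S x) {g : X → V}
    (hg : MDifferentiableAt 𝓘(ℝ, E) 𝓘(ℝ, V) g (f x)) (hgx : g (f x) = x)
    (hgS : ∀ᶠ z in 𝓝 (f x), g z ∈ S ∧ f (g z) = z) (b : TangentSpace 𝓘(ℝ, E) (f x)) :
    ∃ a ∈ tangentConeAt ℝ S x, mfderivWithin 𝓘(ℝ, V) 𝓘(ℝ, E) f S x a = b := by
  refine ⟨mfderiv 𝓘(ℝ, E) 𝓘(ℝ, V) g (f x) b, ?_, ?_⟩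
  · have := hg.mfderiv_mem_tangentConeAt (hgS.mono fun z hz => hz.1) b
    rwa [hgx] at this
  · have hf' : HasMFDerivWithinAt 𝓘(ℝ, V) 𝓘(ℝ, E) f S (g (f x))
        (mfderivWithin 𝓘(ℝ, V) 𝓘(ℝ, E) f S (g (f x))) := by
      rw [hgx]; exact hf.hasMFDerivWithinAt
    have h1 := hf'.comp (f x) (hg.hasMFDerivAt.hasMFDerivWithinAt (s := g ⁻¹' S)) subset_rfl
    have h2 := h1.hasMFDerivAt (hgS.mono fun z hz => hz.1)
    have h3 := h2.congr_of_eventuallyEq (f₁ := id) (hgS.mono fun z hz => hz.2.symm)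
    have h4 : mfderivWithin 𝓘(ℝ, V) 𝓘(ℝ, E) f S (g (f x))
        (mfderiv 𝓘(ℝ, E) 𝓘(ℝ, V) g (f x) b) = b :=
      congrArg (fun l : E →L[ℝ] E => l b) (hasMFDerivAt_unique h3 (hasMFDerivAt_id (f x)))
    -- The type of the differential depends on the base point, so `hgx` cannot be rewritten in `h4`
    -- directly. Generalizing the base point allows substitution.
    have h5 : ∀ x', x' = x → mfderivWithin 𝓘(ℝ, V) 𝓘(ℝ, E) f S x'
        (mfderiv 𝓘(ℝ, E) 𝓘(ℝ, V) g (f x) b) = b → mfderivWithin 𝓘(ℝ, V) 𝓘(ℝ, E) f S x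
        (mfderiv 𝓘(ℝ, E) 𝓘(ℝ, V) g (f x) b) = b := by
      rintro x' rfl h
      exact h
    exact h5 _ hgx h4

end TangentCone

/-! ### Immersions -/

section Immersion

/-- The dimension count identifies F with a complement of the range of D. This supplies the normal
directions used to straighten an immersion. -/
theorem LinearMap.exists_prod_equiv_extending {E F E' : Type*}
    [NormedAddCommGroup E] [NormedSpace ℝ E] [FiniteDimensional ℝ E]
    [NormedAddCommGroup F] [NormedSpace ℝ F] [FiniteDimensional ℝ F]
    [NormedAddCommGroup E'] [NormedSpace ℝ E'] [FiniteDimensional ℝ E'] (D : E →L[ℝ] E')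
    (hD : Function.Injective D)
    (hdim : Module.finrank ℝ E + Module.finrank ℝ F = Module.finrank ℝ E') :
    ∃ (B : F →L[ℝ] E') (A : (E × F) ≃L[ℝ] E'), ∀ p q, A (p, q) = D p + B q := by
  obtain ⟨C, hC⟩ := Submodule.exists_isCompl (LinearMap.range (D : E →ₗ[ℝ] E'))
  have h1 := Submodule.finrank_add_eq_of_isCompl hC
  have h2 := LinearMap.finrank_range_of_inj (f := (D : E →ₗ[ℝ] E')) hD
  have h3 : Module.finrank ℝ F = Module.finrank ℝ C := by omega
  let B : F →ₗ[ℝ] E' := C.subtype ∘ₗ (LinearEquiv.ofFinrankEq F C h3).toLinearMap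
  have hB : Function.Injective B :=
    (Submodule.injective_subtype C).comp (LinearEquiv.ofFinrankEq F C h3).injective
  have hinj : Function.Injective (LinearMap.coprod (D : E →ₗ[ℝ] E') B) := by
    rw [← LinearMap.ker_eq_bot, LinearMap.ker_eq_bot']
    rintro ⟨p, q⟩ h
    have h4 : D p + B q = 0 := h
    have hBC : B q ∈ C := ((LinearEquiv.ofFinrankEq F C h3) q).2
    have h5 : D p = 0 := by
      refine Submodule.disjoint_def.1 hC.disjoint _ ⟨p, rfl⟩ ?_
      rw [eq_neg_of_add_eq_zero_left h4]
      exact C.neg_mem hBC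
    have h6 : B q = 0 := by rwa [h5, zero_add] at h4
    exact Prod.ext (hD (by simpa using h5)) (hB (by simpa using h6))
  refine ⟨LinearMap.toContinuousLinearMap B,
    (LinearEquiv.ofInjectiveOfFinrankEq _ hinj (by simpa using hdim)).toContinuousLinearEquiv,
    fun p q => rfl⟩

/-- The inverse function theorem, with smoothness of the inverse on a whole neighbourhood. -/
theorem ContDiffOn.exists_openPartialHomeomorph_contDiffOn_symm {E E' : Type*}
    [NormedAddCommGroup E] [NormedSpace ℝ E] [CompleteSpace E] [NormedAddCommGroup E']
    [NormedSpace ℝ E'] {G : E → E'} {O : Set E}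
    (hO : IsOpen O) (hG : ContDiffOn ℝ ∞ G O) {p : E} (hp : p ∈ O) {A : E ≃L[ℝ] E'}
    (hA : HasFDerivAt G (A : E →L[ℝ] E') p) :
    ∃ Φ : OpenPartialHomeomorph E E', p ∈ Φ.source ∧ Φ.source ⊆ O ∧ (∀ q, Φ q = G q) ∧
      ContDiffOn ℝ ∞ Φ.symm Φ.target := by
  have hn : (∞ : WithTop ℕ∞) ≠ 0 := by simp
  have hGp : ContDiffAt ℝ ∞ G p := hG.contDiffAt (hO.mem_nhds hp)
  let Φ₀ := hGp.toOpenPartialHomeomorph G hA hn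
  -- Invertibility of the derivative is an open condition. After restriction to this set, the
  -- inverse is smooth at every point of the target and not only at the image of p.
  have hopen : IsOpen (O ∩ fderiv ℝ G ⁻¹' Set.range ((↑) : (E ≃L[ℝ] E') → E →L[ℝ] E')) :=
    (hG.continuousOn_fderiv_of_isOpen hO (by simp)).isOpen_inter_preimage hO
      (ContinuousLinearEquiv.isOpen (𝕜 := ℝ))
  refine ⟨Φ₀.restrOpen _ hopen, ⟨hGp.mem_toOpenPartialHomeomorph_source hA hn, hp, A, hA.fderiv.symm⟩,
    fun q hq => hq.2.1, fun q => rfl, ?_⟩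
  intro q hq
  obtain ⟨hq1, hq2, A', hA'⟩ := (Φ₀.restrOpen _ hopen).map_target hq
  refine ContDiffAt.contDiffWithinAt ?_
  have hq0 : q ∈ Φ₀.target := hq.1
  have hsm : ContDiffAt ℝ ∞ G (Φ₀.symm q) := hG.contDiffAt (hO.mem_nhds hq2)
  refine Φ₀.contDiffAt_symm hq0 (f₀' := A') ?_ hsm
  rw [hA']
  exact (hsm.differentiableAt hn).hasFDerivAt

variable {E X E' Y F : Type*} [NormedAddCommGroup E] [NormedSpace ℝ E] [FiniteDimensional ℝ E]
  [NormedAddCommGroup F] [NormedSpace ℝ F] [FiniteDimensional ℝ F]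
  [TopologicalSpace X] [ChartedSpace E X] [NormedAddCommGroup E'] [NormedSpace ℝ E']
  [FiniteDimensional ℝ E'] [TopologicalSpace Y] [ChartedSpace E' Y]
  [IsManifold 𝓘(ℝ, E) ∞ X] [IsManifold 𝓘(ℝ, E') ∞ Y]

/-- A smooth map with injective differentials between finite-dimensional manifolds is an
immersion. -/
theorem isImmersionOfComplement_of_injective_mfderiv {f : X → Y}
    (hf : ContMDiff 𝓘(ℝ, E) 𝓘(ℝ, E') ∞ f)
    (hinj : ∀ x, Function.Injective (mfderiv 𝓘(ℝ, E) 𝓘(ℝ, E') f x))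
    (hdim : Module.finrank ℝ E + Module.finrank ℝ F = Module.finrank ℝ E') :
    Manifold.IsImmersionOfComplement F 𝓘(ℝ, E) 𝓘(ℝ, E') ∞ f := by
  intro x
  set e := chartAt E x with he
  set e' := chartAt E' (f x) with he'
  have hem : e ∈ IsManifold.maximalAtlas 𝓘(ℝ, E) ∞ X := IsManifold.chart_mem_maximalAtlas x
  have hem' : e' ∈ IsManifold.maximalAtlas 𝓘(ℝ, E') ∞ Y := IsManifold.chart_mem_maximalAtlas (f x)
  have hxe : x ∈ e.source := mem_chart_source E x
  have hxe' : f x ∈ e'.source := mem_chart_source E' (f x)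
  obtain ⟨D, hD⟩ : ∃ D : E →L[ℝ] E', HasMFDerivAt 𝓘(ℝ, E) 𝓘(ℝ, E') f x D ∧
      Function.Injective D :=
    ⟨mfderiv 𝓘(ℝ, E) 𝓘(ℝ, E') f x, (hf.mdifferentiable (by simp) x).hasMFDerivAt, hinj x⟩
  obtain ⟨B, A, hA⟩ := LinearMap.exists_prod_equiv_extending (F := F) D hD.2 hdim
  let f₀ : E → E' := fun p => e' (f (e.symm p))
  have hD0 : HasFDerivAt f₀ D (e x) := by
    have h2 := hD.1.2
    have : Set.range 𝓘(ℝ, E) = Set.univ := by simp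
    rw [this] at h2
    exact hasFDerivWithinAt_univ.1 h2
  let O : Set E := e.target ∩ e.symm ⁻¹' (f ⁻¹' e'.source)
  have hO : IsOpen O := e.isOpen_inter_preimage_symm (e'.open_source.preimage hf.continuous)
  have hxO : e x ∈ O := ⟨e.map_source hxe, by simpa [hxe] using hxe'⟩
  have hf0 : ContDiffOn ℝ ∞ f₀ O := by
    rw [← contMDiffOn_iff_contDiffOn]
    refine (contMDiffOn_of_mem_maximalAtlas hem').comp (hf.comp_contMDiffOn
      ((contMDiffOn_symm_of_mem_maximalAtlas hem).mono Set.inter_subset_left)) fun p hp => hp.2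
  -- Thickening the coordinate expression of f by the normal directions makes its derivative
  -- invertible, so that the inverse function theorem applies.
  let G : E × F → E' := fun q => f₀ q.1 + B q.2
  have hG : ContDiffOn ℝ ∞ G (O ×ˢ Set.univ) := by
    refine ContDiffOn.add (hf0.comp contDiff_fst.contDiffOn fun q hq => hq.1) ?_
    exact (B.contDiff.comp contDiff_snd).contDiffOn
  have hGA : HasFDerivAt G (A : E × F →L[ℝ] E') (e x, 0) := by
    have h1 : HasFDerivAt G (D ∘L ContinuousLinearMap.fst ℝ E F +
        B ∘L ContinuousLinearMap.snd ℝ E F) (e x, 0) :=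
      (HasFDerivAt.comp (g := f₀) (e x, (0 : F)) hD0 hasFDerivAt_fst).add
        (B.hasFDerivAt.comp _ hasFDerivAt_snd)
    convert h1
    ext q <;> simp [hA]
  obtain ⟨Φ, hΦ1, hΦ2, hΦ3, hΦ4⟩ := hG.exists_openPartialHomeomorph_contDiffOn_symm
    (hO.prod isOpen_univ) (Set.mk_mem_prod hxO trivial) hGA
  have hΦs : ContDiffOn ℝ ∞ Φ Φ.source :=
    (hG.mono hΦ2).congr fun q _ => hΦ3 q
  have hfx : e' (f x) = Φ (e x, 0) := by
    rw [hΦ3]; simp [G, f₀, hxe]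
  -- In this chart f becomes p ↦ A (p, 0), the normal form of an immersion. The source chart is
  -- shrunk below so that (p, 0) stays in the domain of Φ.
  let cod : OpenPartialHomeomorph Y E' := (e' ≫ₕ Φ.symm) ≫ₕ A.toHomeomorph.toOpenPartialHomeomorph
  let O₁ : Set E := (fun p : E => (p, (0 : F))) ⁻¹' Φ.source
  have hO₁ : IsOpen O₁ := Φ.open_source.preimage (by fun_prop)
  let dom : OpenPartialHomeomorph X E := e.restr (e.source ∩ e ⁻¹' O₁)
  have hopen : IsOpen (e.source ∩ e ⁻¹' O₁) := e.isOpen_inter_preimage hO₁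
  refine Manifold.IsImmersionAtOfComplement.mk_of_continuousAt hf.continuous.continuousAt A
    dom cod ?_ ?_ ?_ ?_ ?_
  · simp only [dom, OpenPartialHomeomorph.restr_source, hopen.interior_eq]
    exact ⟨hxe, hxe, hΦ1⟩
  · simp only [cod, mfld_simps]
    exact ⟨hxe', hfx ▸ Φ.map_source hΦ1⟩
  · exact restr_mem_maximalAtlas _ hem hopen
  · refine OpenPartialHomeomorph.mem_maximalAtlas_of_contMDiffOn _ ?_ ?_
    · have h1 : ContMDiffOn 𝓘(ℝ, E') 𝓘(ℝ, E') ∞ (fun y => A (Φ.symm (e' y)))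
          (e'.source ∩ e' ⁻¹' Φ.target) :=
        (A.contDiff.contMDiff (n := ∞)).comp_contMDiffOn ((contMDiffOn_iff_contDiffOn.2 hΦ4).comp
          ((contMDiffOn_of_mem_maximalAtlas hem').mono Set.inter_subset_left) fun y hy => hy.2)
      refine h1.mono ?_
      intro y hy
      simpa [cod] using hy
    · have h1 : ContMDiffOn 𝓘(ℝ, E') 𝓘(ℝ, E') ∞ (fun y => e'.symm (Φ (A.symm y)))
          (A.symm ⁻¹' (Φ.source ∩ Φ ⁻¹' e'.target)) :=
        (contMDiffOn_symm_of_mem_maximalAtlas hem').comp ((contMDiffOn_iff_contDiffOn.2 hΦs).comp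
          (A.symm.contDiff.contMDiff (n := ∞)).contMDiffOn fun y hy => hy.1) fun y hy => hy.2
      refine h1.mono ?_
      intro y hy
      simpa [cod] using hy
  · intro p hp
    have hp' : p ∈ e.target ∧ (p, (0 : F)) ∈ Φ.source := by
      simp only [dom, mfld_simps, hopen.interior_eq] at hp
      obtain ⟨h1, h2, h3⟩ := hp
      exact ⟨h1, by simpa [O₁, h1] using h3⟩
    have h3 : Φ (p, 0) = e' (f (e.symm p)) := by rw [hΦ3]; simp [G, f₀]
    simp only [cod, dom, mfld_simps, Function.comp]
    change A (Φ.symm (e' (f (e.symm p)))) = A (p, 0)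
    rw [← h3, Φ.left_inv hp'.2]

end Immersion

/-! ### The projection to projective space -/

namespace CP

variable {N : ℕ}

open Classical in
/-- The projection `ℂ^{N+1} → ℂP^N`, with an arbitrary value at `0`. -/
def proj (v : EuclideanSpace ℂ (Fin (N + 1))) : CP N :=
  if h : v ≠ 0 then mk v h else mk (affineLift 0 0) (affineLift_ne_zero 0 0)

theorem proj_of_ne_zero {v : EuclideanSpace ℂ (Fin (N + 1))} (hv : v ≠ 0) : proj v = mk v hv :=
  dif_pos hv

theorem proj_rep (x : CP N) : proj x.rep = x := by
  rw [proj_of_ne_zero x.rep_ne_zero, mk_rep]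

theorem proj_smul {v : EuclideanSpace ℂ (Fin (N + 1))} (hv : v ≠ 0) {c : ℂ} (hc : c ≠ 0) :
    proj (c • v) = proj v := by
  rw [proj_of_ne_zero hv, proj_of_ne_zero (smul_ne_zero hc hv), mk_smul]

theorem exists_rep_proj {v : EuclideanSpace ℂ (Fin (N + 1))} (hv : v ≠ 0) :
    ∃ c : ℂ, c ≠ 0 ∧ (proj v).rep = c • v := by
  rw [proj_of_ne_zero hv]
  exact exists_rep_mk v hv

theorem proj_eq_proj_iff {v w : EuclideanSpace ℂ (Fin (N + 1))} (hv : v ≠ 0) (hw : w ≠ 0) :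
    proj v = proj w ↔ ∃ c : ℂ, c ≠ 0 ∧ v = c • w := by
  constructor
  · intro h
    obtain ⟨c, hc, h1⟩ := exists_rep_proj hv
    obtain ⟨d, hd, h2⟩ := exists_rep_proj hw
    refine ⟨c⁻¹ * d, mul_ne_zero (inv_ne_zero hc) hd, ?_⟩
    rw [mul_smul, ← h2, ← h, h1, smul_smul, inv_mul_cancel₀ hc, one_smul]
  · rintro ⟨c, hc, rfl⟩
    exact proj_smul hw hc

theorem affineCoord_proj (j : Fin (N + 1)) {v : EuclideanSpace ℂ (Fin (N + 1))} (hv : v ≠ 0) :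
    affineCoord j (proj v) = WithLp.toLp 2 fun k => v (j.succAbove k) / v j := by
  rw [proj_of_ne_zero hv, affineCoord_mk]

theorem rep_proj_apply_ne_zero (j : Fin (N + 1)) {v : EuclideanSpace ℂ (Fin (N + 1))}
    (hv : v ≠ 0) : (proj v).rep j ≠ 0 ↔ v j ≠ 0 := by
  rw [proj_of_ne_zero hv, rep_mk_apply_ne_zero]

theorem affineChart_mem_maximalAtlas (j : Fin (N + 1)) :
    affineChart j ∈ IsManifold.maximalAtlas 𝓘(ℝ, EuclideanSpace ℂ (Fin N)) ∞ (CP N) :=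
  IsManifold.subset_maximalAtlas ⟨j, rfl⟩

theorem contDiff_affineLift (j : Fin (N + 1)) : ContDiff ℝ ∞ (affineLift (N := N) j) := by
  refine contDiff_piLp' (p := 2) fun k => ?_
  refine Fin.succAboveCases j ?_ (fun l => ?_) k
  · simpa [affineLift] using contDiff_const
  · simp only [affineLift, Fin.insertNth_apply_succAbove]
    fun_prop

theorem contMDiffAt_proj {v : EuclideanSpace ℂ (Fin (N + 1))} (hv : v ≠ 0) :
    ContMDiffAt 𝓘(ℝ, EuclideanSpace ℂ (Fin (N + 1))) 𝓘(ℝ, EuclideanSpace ℂ (Fin N)) ∞ proj v := by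
  obtain ⟨j, hj⟩ : ∃ j, v j ≠ 0 := by
    by_contra! h
    exact hv (by ext j; simpa using h j)
  have h1 : ContMDiff 𝓘(ℝ, EuclideanSpace ℂ (Fin N)) 𝓘(ℝ, EuclideanSpace ℂ (Fin N)) ∞
      (affineChart j).symm :=
    contMDiffOn_univ.1 (contMDiffOn_symm_of_mem_maximalAtlas (affineChart_mem_maximalAtlas j))
  have h2 : ContDiffAt ℝ ∞ (fun w : EuclideanSpace ℂ (Fin (N + 1)) =>
      (WithLp.toLp 2 fun k => w (j.succAbove k) / w j : EuclideanSpace ℂ (Fin N))) v := by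
    refine contDiffAt_piLp' (p := 2) fun k => ?_
    simp only [div_eq_mul_inv]
    exact ContDiffAt.mul (by fun_prop) (ContDiffAt.inv (by fun_prop) hj)
  have h3 := h1.contMDiffAt.comp v h2.contMDiffAt
  refine h3.congr_of_eventuallyEq ?_
  have hopen : IsOpen {w : EuclideanSpace ℂ (Fin (N + 1)) | w j ≠ 0} :=
    isOpen_ne_fun (by fun_prop) continuous_const
  filter_upwards [hopen.mem_nhds hj] with w hw
  have hw0 : w ≠ 0 := by rintro rfl; exact hw rfl
  have h4 := (affineChart j).left_inv (x := proj w) ((rep_proj_apply_ne_zero j hw0).2 hw)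
  rw [Function.comp, ← affineCoord_proj j hw0]
  exact h4.symm

variable {V : Type*} [NormedAddCommGroup V] [NormedSpace ℝ V]

theorem contMDiffOn_proj_comp {L : V → EuclideanSpace ℂ (Fin (N + 1))} {S : Set V}
    (hL : ContDiffOn ℝ ∞ L S) (h0 : ∀ x ∈ S, L x ≠ 0) :
    ContMDiffOn 𝓘(ℝ, V) 𝓘(ℝ, EuclideanSpace ℂ (Fin N)) ∞ (fun x => proj (L x)) S := fun x hx =>
  (contMDiffAt_proj (h0 x hx)).comp_contMDiffWithinAt x (hL x hx).contMDiffWithinAt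

/-- A function on `ℂ^{N+1} ∖ 0` that is invariant under scaling descends to `ℂP^N`. -/
theorem contMDiffAt_comp_rep {φ : EuclideanSpace ℂ (Fin (N + 1)) → V}
    (hinv : ∀ c : ℂ, c ≠ 0 → ∀ z, φ (c • z) = φ z) {x : CP N} (hφ : ContDiffAt ℝ ∞ φ x.rep) :
    ContMDiffAt 𝓘(ℝ, EuclideanSpace ℂ (Fin N)) 𝓘(ℝ, V) ∞ (fun y => φ y.rep) x := by
  obtain ⟨j, hj⟩ := exists_rep_apply_ne_zero x
  have h1 : ContMDiffAt 𝓘(ℝ, EuclideanSpace ℂ (Fin N)) 𝓘(ℝ, EuclideanSpace ℂ (Fin N)) ∞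
      (affineChart j) x := contMDiffAt_of_mem_maximalAtlas (affineChart_mem_maximalAtlas j) hj
  have h2 := (contDiff_affineLift j).contDiffAt.contMDiffAt.comp x h1
  have h3 : ContDiffAt ℝ ∞ φ (affineLift j (affineCoord j x)) := by
    rw [affineLift_affineCoord j x hj]
    -- Smoothness is known at the chosen representative, but the affine lift is a multiple of it.
    -- Invariance under scaling transports smoothness from one to the other.
    have h4 : φ = fun z => φ (x.rep j • z) := funext fun z => (hinv _ hj z).symm
    rw [h4]
    refine ContDiffAt.comp (g := φ) _ ?_ (by fun_prop)
    rwa [smul_smul, mul_inv_cancel₀ hj, one_smul]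
  refine (h3.contMDiffAt.comp x h2).congr_of_eventuallyEq ?_
  filter_upwards [(isOpen_affine j).mem_nhds hj] with y hy
  change φ y.rep = φ (affineLift j (affineCoord j y))
  rw [affineLift_affineCoord j y hy, hinv _ (inv_ne_zero hy)]

/-- The rank-one projector z z* / |z|² depends only on the line spanned by z, is continuous in it,
and determines it. This injects the projective space continuously into a space of matrices. -/
instance : T2Space (CP N) := by
  let φ : EuclideanSpace ℂ (Fin (N + 1)) → Fin (N + 1) → Fin (N + 1) → ℂ :=
    fun z i j => z i * (starRingEnd ℂ) (z j) / ((‖z‖ ^ 2 : ℝ) : ℂ)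
  have hinv : ∀ c : ℂ, c ≠ 0 → ∀ z, φ (c • z) = φ z := by
    intro c hc z
    funext i j
    simp only [φ, PiLp.smul_apply, smul_eq_mul, map_mul, norm_smul]
    have h1 : (((‖c‖ * ‖z‖) ^ 2 : ℝ) : ℂ) = (c * (starRingEnd ℂ) c) * ((‖z‖ ^ 2 : ℝ) : ℂ) := by
      rw [Complex.mul_conj, Complex.normSq_eq_norm_sq]
      push_cast; ring
    rw [h1]
    have h2 : c * (starRingEnd ℂ) c ≠ 0 := mul_ne_zero hc (by simpa using hc)
    rw [show c * z i * ((starRingEnd ℂ) c * (starRingEnd ℂ) (z j)) =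
      (c * (starRingEnd ℂ) c) * (z i * (starRingEnd ℂ) (z j)) by ring, mul_div_mul_left _ _ h2]
  refine T2Space.of_injective_continuous (f := fun x : CP N => φ x.rep) ?_ ?_
  · intro x y hxy
    obtain ⟨j, hj⟩ := exists_rep_apply_ne_zero x
    have hN : ∀ w : CP N, ((‖w.rep‖ ^ 2 : ℝ) : ℂ) ≠ 0 := fun w => by
      simp [w.rep_ne_zero]
    have h : ∀ i, x.rep i * (starRingEnd ℂ) (x.rep j) / ((‖x.rep‖ ^ 2 : ℝ) : ℂ) =
      y.rep i * (starRingEnd ℂ) (y.rep j) / ((‖y.rep‖ ^ 2 : ℝ) : ℂ) := fun i =>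
        congrFun (congrFun hxy i) j
    have hcj : (starRingEnd ℂ) (x.rep j) ≠ 0 := by simpa using hj
    have hyj : (starRingEnd ℂ) (y.rep j) ≠ 0 := by
      intro h0
      have := h j
      rw [h0, mul_zero, zero_div] at this
      exact div_ne_zero (mul_ne_zero hj hcj) (hN x) this
    rw [← proj_rep x, ← proj_rep y, proj_eq_proj_iff x.rep_ne_zero y.rep_ne_zero]
    refine ⟨((starRingEnd ℂ) (y.rep j) / ((‖y.rep‖ ^ 2 : ℝ) : ℂ)) /
      ((starRingEnd ℂ) (x.rep j) / ((‖x.rep‖ ^ 2 : ℝ) : ℂ)),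
      div_ne_zero (div_ne_zero hyj (hN y)) (div_ne_zero hcj (hN x)), ?_⟩
    ext i
    rw [PiLp.smul_apply, smul_eq_mul, div_mul_eq_mul_div,
      eq_div_iff (div_ne_zero hcj (hN x)), ← mul_div_assoc, h i]
    ring
  · rw [continuous_iff_continuousAt]
    intro x
    refine (contMDiffAt_comp_rep hinv ?_).continuousAt
    rw [contDiffAt_pi]; intro i
    rw [contDiffAt_pi]; intro j
    simp only [φ, div_eq_mul_inv]
    refine ContDiffAt.mul (ContDiffAt.mul (by fun_prop) ?_) (ContDiffAt.inv ?_ ?_)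
    · exact Complex.conjCLE.contDiff.contDiffAt.comp _ (by fun_prop)
    · exact Complex.ofRealCLM.contDiff.contDiffAt.comp _ (contDiff_norm_sq ℝ).contDiffAt
    · simp [x.rep_ne_zero]

end CP

/-! ### The Fubini–Study form on lifts -/

namespace CP

variable {N : ℕ}

/-- The pullback of the Fubini–Study form to `ℂ^{N+1} ∖ 0`, at the point `z`. -/
def liftedForm {m : ℕ} (z a b : EuclideanSpace ℂ (Fin m)) : ℝ :=
  (‖z‖ ^ 2)⁻¹ * (⟪horizontal z a, horizontal z b⟫_ℂ).im

theorem inner_horizontal {m : ℕ} (z a b : EuclideanSpace ℂ (Fin m)) :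
    ⟪horizontal z a, horizontal z b⟫_ℂ = ⟪a, b⟫_ℂ - ⟪a, z⟫_ℂ * ⟪z, b⟫_ℂ / ((‖z‖ ^ 2 : ℝ) : ℂ) := by
  have h1 : ∀ c, horizontal z c = (ℂ ∙ z)ᗮ.starProjection c := fun _ => rfl
  have h2 : ∀ c, (ℂ ∙ z)ᗮ.starProjection c = c - (⟪z, c⟫_ℂ / ((‖z‖ ^ 2 : ℝ) : ℂ)) • z := by
    intro c
    rw [Submodule.starProjection_orthogonal', sub_apply,
      Submodule.starProjection_singleton]
    simp
  rw [h1, h1, Submodule.inner_starProjection_left_eq_right, ← mul_apply_eq_comp,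
    (Submodule.isIdempotentElem_starProjection _).eq, h2, inner_sub_right, inner_smul_right]
  ring

theorem horizontal_smul_add_smul {m : ℕ} (z a : EuclideanSpace ℂ (Fin m)) (c d : ℂ) :
    horizontal z (c • a + d • z) = c • horizontal z a := by
  have h1 : ∀ c, horizontal z c = (ℂ ∙ z)ᗮ.starProjection c := fun _ => rfl
  have h2 : (ℂ ∙ z)ᗮ.starProjection z = 0 := by
    rw [Submodule.starProjection_apply_eq_zero_iff, Submodule.orthogonal_orthogonal]
    exact Submodule.mem_span_singleton_self z
  rw [h1, h1, map_add, map_smul, map_smul, h2, smul_zero, add_zero]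

theorem horizontal_smul_left {m : ℕ} (z : EuclideanSpace ℂ (Fin m)) {c : ℂ} (hc : c ≠ 0) :
    horizontal (c • z) = horizontal z := by
  unfold horizontal
  simp only [Submodule.span_singleton_smul_eq (IsUnit.mk0 c hc)]

theorem liftedForm_eq {m : ℕ} (z a b : EuclideanSpace ℂ (Fin m)) :
    liftedForm z a b = (‖z‖ ^ 2)⁻¹ * (⟪a, b⟫_ℂ).im -
      ((‖z‖ ^ 2)⁻¹) ^ 2 * ((⟪z, a⟫_ℂ).re * (⟪z, b⟫_ℂ).im - (⟪z, a⟫_ℂ).im * (⟪z, b⟫_ℂ).re) := by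
  rw [liftedForm, inner_horizontal, ← inner_conj_symm a z, Complex.sub_im, Complex.div_ofReal_im,
    Complex.mul_im, Complex.conj_re, Complex.conj_im]
  ring

variable {V : Type*} [NormedAddCommGroup V] [NormedSpace ℝ V]

/-- The differential of `x ↦ [L x]` in the affine chart `j`. -/
theorem exists_hasFDerivWithinAt_affineCoord {L : V → EuclideanSpace ℂ (Fin (N + 1))}
    {L' : V →L[ℝ] EuclideanSpace ℂ (Fin (N + 1))} {S : Set V} {x : V}
    (hL : HasFDerivWithinAt L L' S x) (j : Fin (N + 1)) (hj : L x j ≠ 0) :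
    ∃ D : V →L[ℝ] EuclideanSpace ℂ (Fin N),
      HasFDerivWithinAt (fun y => (WithLp.toLp 2 fun k => L y (j.succAbove k) / L y j :
        EuclideanSpace ℂ (Fin N))) D S x ∧
      ∀ a, affineInclusion j (D a) = (L x j)⁻¹ • L' a + (- (L' a j) * ((L x j)⁻¹) ^ 2) • L x := by
  have hk : ∀ k, HasFDerivWithinAt (fun y => L y k)
      ((EuclideanSpace.proj (𝕜 := ℂ) k).restrictScalars ℝ ∘L L') S x := fun k =>
    ((EuclideanSpace.proj (𝕜 := ℂ) k).restrictScalars ℝ).hasFDerivAt.comp_hasFDerivWithinAt x hL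
  have hi : HasFDerivWithinAt (fun y => (L y j)⁻¹) _ S x :=
    HasFDerivAt.comp_hasFDerivWithinAt x ((hasFDerivAt_inv hj).restrictScalars ℝ) (hk j)
  have hd : ∀ k : Fin N, ∃ D : V →L[ℝ] ℂ,
      HasFDerivWithinAt (fun y => L y (j.succAbove k) / L y j) D S x ∧
      ∀ a, D a = L x (j.succAbove k) * (L' a j * -(L x j ^ 2)⁻¹) +
        (L x j)⁻¹ * L' a (j.succAbove k) :=
    fun k => ⟨_, (hk (j.succAbove k)).mul hi, fun a => rfl⟩
  choose D hD hD' using hd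
  refine ⟨(PiLp.continuousLinearEquiv 2 ℝ fun _ : Fin N => ℂ).symm.toContinuousLinearMap ∘L
    ContinuousLinearMap.pi D, (hasFDerivWithinAt_piLp (𝕜 := ℝ) 2).2 fun k => ?_, ?_⟩
  · exact hD k
  intro a
  ext k
  refine Fin.succAboveCases j ?_ (fun i => ?_) k
  · simp [affineInclusion]
    field_simp
    ring
  · simp [affineInclusion, hD']
    ring

/-- The Fubini–Study form on tangent vectors given by a lift to `ℂ^{N+1}`. -/
theorem fubiniStudy_mfderivWithin {L : V → EuclideanSpace ℂ (Fin (N + 1))}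
    {L' : V →L[ℝ] EuclideanSpace ℂ (Fin (N + 1))} {S : Set V} {x : V}
    (hL : HasFDerivWithinAt L L' S x) (h0 : L x ≠ 0) {G : V → CP N} (hx : x ∈ S)
    (hG : ∀ y ∈ S, G y = proj (L y)) {a b : V} (ha : a ∈ tangentConeAt ℝ S x)
    (hb : b ∈ tangentConeAt ℝ S x) :
    fubiniStudy N (G x)
      ![mfderivWithin 𝓘(ℝ, V) 𝓘(ℝ, EuclideanSpace ℂ (Fin N)) G S x a,
        mfderivWithin 𝓘(ℝ, V) 𝓘(ℝ, EuclideanSpace ℂ (Fin N)) G S x b] =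
      liftedForm (L x) (L' a) (L' b) := by
  have hGx := hG x hx
  set j := (G x).chartIndex with hj
  have hrep : (G x).rep j ≠ 0 := (exists_rep_apply_ne_zero (G x)).choose_spec
  have hLj : L x j ≠ 0 := by
    rw [hGx] at hrep
    exact (rep_proj_apply_ne_zero j h0).1 hrep
  have hev : ∀ᶠ y in 𝓝[S] x, L y ≠ 0 := hL.continuousWithinAt.eventually_ne h0
  have hcont : ContinuousWithinAt G S x := by
    have h1 : ContinuousWithinAt (fun y => proj (L y)) S x :=
      (contMDiffAt_proj h0).continuousAt.comp_continuousWithinAt hL.continuousWithinAt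
    exact h1.congr hG hGx
  obtain ⟨D, hD, hD'⟩ := exists_hasFDerivWithinAt_affineCoord hL j hLj
  have hGD : HasMFDerivWithinAt 𝓘(ℝ, V) 𝓘(ℝ, EuclideanSpace ℂ (Fin N)) G S x D := by
    refine hasMFDerivWithinAt_iff_chartAt_comp.2 ⟨hcont, hD.congr_of_eventuallyEq ?_ ?_⟩
    · filter_upwards [hev, self_mem_nhdsWithin] with y hy hyS
      rw [← affineCoord_proj j hy, ← hG y hyS]
      rfl
    · rw [← affineCoord_proj j h0, ← hGx]
      rfl
  have key : ∀ a ∈ tangentConeAt ℝ S x,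
      mfderivWithin 𝓘(ℝ, V) 𝓘(ℝ, EuclideanSpace ℂ (Fin N)) G S x a = D a := fun a ha =>
    hGD.mdifferentiableWithinAt.hasMFDerivWithinAt.eq_of_mem_tangentConeAt hGD ha
  rw [key a ha, key b hb]
  have hz : affineLift j (affineCoord j (G x)) = (L x j)⁻¹ • L x := by
    rw [hGx, affineCoord_proj j h0]
    ext k
    refine Fin.succAboveCases j ?_ (fun i => ?_) k
    · simp [affineLift, hLj]
    · simp [affineLift, div_eq_inv_mul]
  have h1 : fubiniStudy N (G x) ![D a, D b] =
      liftedForm (affineLift j (affineCoord j (G x))) (affineInclusion j (D a))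
        (affineInclusion j (D b)) := rfl
  -- The chart differential lifts to (L x)_j⁻¹ L' a plus a multiple of L x. The horizontal
  -- projection kills the multiple, and the factor |(L x)_j|⁻² cancels against the change of ‖z‖².
  rw [h1, hz, hD', hD', liftedForm, liftedForm, horizontal_smul_left _ (inv_ne_zero hLj),
    horizontal_smul_add_smul, horizontal_smul_add_smul, inner_smul_left, inner_smul_right,
    norm_smul, ← mul_assoc, ← Complex.normSq_eq_conj_mul_self, Complex.im_ofReal_mul,
    Complex.normSq_eq_norm_sq]
  have : ‖(L x j)⁻¹‖ ≠ 0 := by simpa using hLj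
  generalize ‖(L x j)⁻¹‖ = c at this
  field_simp

/-- A lift of constant norm `√2` pulls the standard form back to twice the Fubini–Study form. -/
theorem two_fubiniStudy_mfderivWithin {L : V → EuclideanSpace ℂ (Fin (N + 1))}
    {L' : V →L[ℝ] EuclideanSpace ℂ (Fin (N + 1))} {S : Set V} {x : V}
    (hL : HasFDerivWithinAt L L' S x) (hnorm : ∀ y ∈ S, ‖L y‖ ^ 2 = 2) {G : V → CP N} (hx : x ∈ S)
    (hG : ∀ y ∈ S, G y = proj (L y)) {a b : V} (ha : a ∈ tangentConeAt ℝ S x)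
    (hb : b ∈ tangentConeAt ℝ S x) :
    ((2 : ℝ) • fubiniStudy N (G x))
      ![mfderivWithin 𝓘(ℝ, V) 𝓘(ℝ, EuclideanSpace ℂ (Fin N)) G S x a,
        mfderivWithin 𝓘(ℝ, V) 𝓘(ℝ, EuclideanSpace ℂ (Fin N)) G S x b] = (⟪L' a, L' b⟫_ℂ).im := by
  have h0 : L x ≠ 0 := by
    intro h
    have := hnorm x hx
    rw [h] at this
    norm_num at this
  -- Constancy of the norm makes L' a real-orthogonal to L x. Each term of the quadratic correction
  -- in `liftedForm_eq` contains such a real part, so the correction vanishes, and 2 / ‖L x‖² = 1.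
  have hre : ∀ a ∈ tangentConeAt ℝ S x, (⟪L x, L' a⟫_ℂ).re = 0 := by
    intro a ha
    have h1 := hL.norm_sq.eq_zero_of_mem_tangentConeAt hnorm hx ha
    have h2 : ⟪L x, L' a⟫_ℝ = 0 := by simpa using h1
    rw [← h2]
    simp [PiLp.inner_apply, Complex.inner]
  have h := fubiniStudy_mfderivWithin hL h0 hx hG ha hb
  have h3 : ((2 : ℝ) • fubiniStudy N (G x))
      ![mfderivWithin 𝓘(ℝ, V) 𝓘(ℝ, EuclideanSpace ℂ (Fin N)) G S x a,
        mfderivWithin 𝓘(ℝ, V) 𝓘(ℝ, EuclideanSpace ℂ (Fin N)) G S x b] = 2 * fubiniStudy N (G x)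
      ![mfderivWithin 𝓘(ℝ, V) 𝓘(ℝ, EuclideanSpace ℂ (Fin N)) G S x a,
        mfderivWithin 𝓘(ℝ, V) 𝓘(ℝ, EuclideanSpace ℂ (Fin N)) G S x b] := rfl
  rw [h3, h, liftedForm_eq, hre a ha, hre b hb, hnorm x hx]
  ring

end CP

/-! ### The model maps -/

section Model

variable {n : ℕ}

/-- The space `ℝ^{n+1} ⊕ ℝ^{n+1}`. -/
abbrev Doubled (n : ℕ) : Type :=
  EuclideanSpace ℝ (Fin (n + 1)) × EuclideanSpace ℝ (Fin (n + 1))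

/-- The vector `(p + i q, τ)` of `ℂ^{n+2}`. -/
def assemble (n : ℕ) :
    (Doubled n × ℂ) →L[ℝ]
      EuclideanSpace ℂ (Fin (n + 1 + 1)) :=
  LinearMap.toContinuousLinearMap
    { toFun := fun x => WithLp.toLp 2
        (Fin.snoc (fun k => (x.1.1 k : ℂ) + Complex.I * (x.1.2 k : ℂ)) x.2 : Fin (n + 1 + 1) → ℂ)
      map_add' := fun a b => by
        ext k
        refine Fin.lastCases ?_ (fun i => ?_) k <;> simp
        ring
      map_smul' := fun c a => by
        ext k
        refine Fin.lastCases ?_ (fun i => ?_) k <;> simp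
        ring }

@[simp]
theorem assemble_castSucc (x : Doubled n × ℂ)
    (k : Fin (n + 1)) :
    assemble n x k.castSucc = (x.1.1 k : ℂ) + Complex.I * (x.1.2 k : ℂ) := by
  simp [assemble]

@[simp]
theorem assemble_last (x : Doubled n × ℂ) :
    assemble n x (Fin.last (n + 1)) = x.2 := by
  simp [assemble]

/-- This is the point where the form of the cut construction meets the form on ℂ^{n+2}: in the
coordinates p + iq the imaginary part of the Hermitian product is ∑ dp_k ∧ dq_k. -/
theorem inner_assemble_im
    (x y : Doubled n × ℂ) :
    (⟪assemble n x, assemble n y⟫_ℂ).im = formProdComplex (stdForm (n + 1)) x y := by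
  rw [PiLp.inner_apply, Fin.sum_univ_castSucc]
  simp only [assemble_castSucc, assemble_last, formProdComplex, stdForm, PiLp.inner_apply,
    Complex.add_im, Complex.im_sum]
  rw [← Finset.sum_sub_distrib]
  congr 1
  · refine Finset.sum_congr rfl fun k _ => ?_
    simp
    ring
  · simp
    ring

theorem norm_sq_assemble
    (x : Doubled n × ℂ) :
    ‖assemble n x‖ ^ 2 = ‖x.1.1‖ ^ 2 + ‖x.1.2‖ ^ 2 + ‖x.2‖ ^ 2 := by
  rw [EuclideanSpace.norm_sq_eq, Fin.sum_univ_castSucc, EuclideanSpace.norm_sq_eq,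
    EuclideanSpace.norm_sq_eq, ← Finset.sum_add_distrib]
  simp only [assemble_castSucc, assemble_last]
  congr 1
  refine Finset.sum_congr rfl fun k _ => ?_
  rw [← Complex.normSq_eq_norm_sq, Complex.normSq_apply]
  simp
  ring

/-- For τ = it with t real, the quadric equation splits into |p|² = |q|² + t² and p ⊥ q, which
together with the norm condition describes the disc bundle. -/
theorem sum_sq_assemble
    (x : Doubled n × ℂ) :
    ∑ k, assemble n x k ^ 2 = ((‖x.1.1‖ ^ 2 - ‖x.1.2‖ ^ 2 : ℝ) : ℂ) +
      2 * Complex.I * ((⟪x.1.1, x.1.2⟫_ℝ : ℝ) : ℂ) + x.2 ^ 2 := by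
  rw [EuclideanSpace.real_norm_sq_eq, EuclideanSpace.real_norm_sq_eq, ← Finset.sum_sub_distrib,
    PiLp.inner_apply, Fin.sum_univ_castSucc]
  simp only [assemble_castSucc, assemble_last]
  push_cast
  rw [Finset.mul_sum, ← Finset.sum_add_distrib]
  congr 1
  refine Finset.sum_congr rfl fun k _ => ?_
  simp
  ring_nf
  simp
  ring

/-- The lift `(u + i v, i √(1 - |v|²))` to `ℂ^{n+2}` of the embedding of the unit disc bundle. -/
def discLift (n : ℕ) (x : Doubled n) :
    EuclideanSpace ℂ (Fin (n + 1 + 1)) :=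
  assemble n (x, Complex.I * (Real.sqrt (1 - ‖x.2‖ ^ 2) : ℂ))

/-- The unit vector in the direction of `v`. -/
def fibreDirection (x : Doubled n) :
    EuclideanSpace ℝ (Fin (n + 1)) :=
  ‖x.2‖⁻¹ • x.2

/-- The number `√((1 + |v|) / 2)`. -/
def fibreRadius (x : Doubled n) : ℝ :=
  Real.sqrt ((1 + ‖x.2‖) / 2)

/-- For `e = u + i s` and `c = a + i b`, the vector `(r² e + c² ē, 2 i r c)` of `ℂ^{n+2}`. -/
def conicPoint (u s : EuclideanSpace ℝ (Fin (n + 1))) (r a b : ℝ) :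
    EuclideanSpace ℂ (Fin (n + 1 + 1)) :=
  assemble n (((r ^ 2 + (a ^ 2 - b ^ 2)) • u + (2 * a * b) • s,
    (r ^ 2 - (a ^ 2 - b ^ 2)) • s + (2 * a * b) • u), ⟨-(2 * r * b), 2 * r * a⟩)

/-- The lift to `ℂ^{n+2}` of the reduction map at the level `1` of `|v| + |w|² / 2`. -/
def reductionLift (n : ℕ)
    (x : Doubled n × ℂ) :
    EuclideanSpace ℂ (Fin (n + 1 + 1)) :=
  conicPoint x.1.1 (fibreDirection x.1) (fibreRadius x.1) (x.2.re / 2) (x.2.im / 2)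

/-- The cotangent bundle of `S^n` without its zero section. -/
abbrev punctured (n : ℕ) :
    Set (Doubled n) :=
  cotangentSphere n ∩ {x | x.2 ≠ 0}

/-- The level set of `|v| + |w|² / 2`. -/
abbrev cutLevel (n : ℕ) :
    Set (Doubled n × ℂ) :=
  {x ∈ punctured n ×ˢ Set.univ | cutHamiltonian (fun x => ‖x.2‖) x = 1}

section Pointwise

variable {x : Doubled n} {w : ℂ}

theorem norm_fibreDirection (hx : x.2 ≠ 0) : ‖fibreDirection x‖ = 1 := by
  rw [fibreDirection, norm_smul, norm_inv, norm_norm, inv_mul_cancel₀ (norm_ne_zero_iff.2 hx)]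

theorem norm_smul_fibreDirection (x : Doubled n) :
    ‖x.2‖ • fibreDirection x = x.2 := by
  by_cases hx : x.2 = 0
  · simp [hx]
  · rw [fibreDirection, smul_inv_smul₀ (norm_ne_zero_iff.2 hx)]

theorem inner_fibreDirection (hx : x ∈ cotangentSphere n) : ⟪x.1, fibreDirection x⟫_ℝ = 0 := by
  rw [fibreDirection, inner_smul_right, hx.2, mul_zero]

theorem fibreRadius_pos (x : Doubled n) :
    0 < fibreRadius x := Real.sqrt_pos.2 (by positivity)

theorem fibreRadius_sq (x : Doubled n) :
    fibreRadius x ^ 2 = (1 + ‖x.2‖) / 2 := Real.sq_sqrt (by positivity)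

theorem fibreRadius_sq_add (h : (x, w) ∈ cutLevel n) :
    fibreRadius x ^ 2 + ((w.re / 2) ^ 2 + (w.im / 2) ^ 2) = 1 := by
  have h1 : ‖x.2‖ + ‖w‖ ^ 2 / 2 = 1 := h.2
  rw [← Complex.normSq_eq_norm_sq, Complex.normSq_apply] at h1
  rw [fibreRadius_sq]
  linarith

theorem discLift_norm_sq (hx : x ∈ cotangentSphere n) (h1 : ‖x.2‖ ≤ 1) :
    ‖discLift n x‖ ^ 2 = 2 := by
  have h2 : 0 ≤ 1 - ‖x.2‖ ^ 2 := by nlinarith [norm_nonneg x.2]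
  rw [discLift, norm_sq_assemble, hx.1, norm_mul, Complex.norm_I, one_mul, Complex.norm_real,
    Real.norm_eq_abs, sq_abs, Real.sq_sqrt h2]
  ring

theorem sum_sq_discLift (hx : x ∈ cotangentSphere n) (h1 : ‖x.2‖ ≤ 1) :
    ∑ k, discLift n x k ^ 2 = 0 := by
  have h2 : 0 ≤ 1 - ‖x.2‖ ^ 2 := by nlinarith [norm_nonneg x.2]
  rw [discLift, sum_sq_assemble, hx.1, hx.2, mul_pow, Complex.I_sq, ← Complex.ofReal_pow,
    Real.sq_sqrt h2]
  push_cast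
  ring

/-- In this complex form the equivariance under (e, c) ↦ (λe, λc), |λ| = 1, is visible, and the
equations can be solved for e. -/
theorem conicPoint_castSucc (u s : EuclideanSpace ℝ (Fin (n + 1))) (r a b : ℝ) (k : Fin (n + 1)) :
    conicPoint u s r a b k.castSucc =
      (r : ℂ) ^ 2 * (u k + Complex.I * s k) +
        (a + Complex.I * b) ^ 2 * (starRingEnd ℂ) (u k + Complex.I * s k) := by
  simp [conicPoint]
  ring_nf
  simp
  ring

theorem conicPoint_last (u s : EuclideanSpace ℝ (Fin (n + 1))) (r a b : ℝ) :
    conicPoint u s r a b (Fin.last (n + 1)) = 2 * Complex.I * r * (a + Complex.I * b) := by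
  simp only [conicPoint, assemble_last]
  apply Complex.ext <;> simp

/-- As e = u + is is isotropic with |e|² = 2, the vectors e and ē are Hermitian-orthogonal. Hence
the square of the norm is 2r⁴ + 2|c|⁴ + 4r²|c|² = 2(r² + |c|²)². -/
theorem conicPoint_norm_sq {u s : EuclideanSpace ℝ (Fin (n + 1))} {r a b : ℝ} (hu : ‖u‖ = 1)
    (hs : ‖s‖ = 1) (hus : ⟪u, s⟫_ℝ = 0) (hr : r ^ 2 + (a ^ 2 + b ^ 2) = 1) :
    ‖conicPoint u s r a b‖ ^ 2 = 2 := by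
  rw [conicPoint, norm_sq_assemble]
  simp only
  rw [norm_add_sq_real, norm_add_sq_real, ← Complex.normSq_eq_norm_sq, Complex.normSq_apply]
  simp only [norm_smul, inner_smul_left, inner_smul_right, real_inner_comm u s, hus, hu, hs,
    mul_pow, Real.norm_eq_abs, sq_abs]
  linear_combination (2 * (r ^ 2 + a ^ 2 + b ^ 2 + 1)) * hr

/-- The circle action generated by `|v|`. -/
def normFlow (t : ℝ) (x : Doubled n) :
    Doubled n :=
  (Real.cos t • x.1 + Real.sin t • fibreDirection x,
    ‖x.2‖ • (- Real.sin t • x.1 + Real.cos t • fibreDirection x))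

theorem norm_rotate {u s : EuclideanSpace ℝ (Fin (n + 1))} (hu : ‖u‖ = 1)
    (hs : ‖s‖ = 1) (hus : ⟪u, s⟫_ℝ = 0) {a b : ℝ} (hab : a ^ 2 + b ^ 2 = 1) :
    ‖a • u + b • s‖ = 1 := by
  rw [← sq_eq_sq₀ (norm_nonneg _) zero_le_one, norm_add_sq_real]
  simp only [norm_smul, inner_smul_left, inner_smul_right, hus, hu, hs,
    mul_pow, Real.norm_eq_abs, sq_abs]
  linear_combination hab

theorem norm_normFlow_snd (hx : x ∈ punctured n) (t : ℝ) : ‖(normFlow t x).2‖ = ‖x.2‖ := by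
  rw [normFlow, norm_smul, norm_norm, norm_rotate hx.1.1 (norm_fibreDirection hx.2)
    (inner_fibreDirection hx.1) (by simp [add_comm]), mul_one]

theorem normFlow_mem (hx : x ∈ punctured n) (t : ℝ) : normFlow t x ∈ punctured n := by
  refine ⟨⟨norm_rotate hx.1.1 (norm_fibreDirection hx.2)
    (inner_fibreDirection hx.1) (by simp), ?_⟩, ?_⟩
  · have h1 := inner_fibreDirection hx.1
    have h2 := norm_fibreDirection hx.2
    simp only [normFlow, inner_add_left, inner_add_right, inner_smul_left, inner_smul_right, h1,
      real_inner_comm x.1 (fibreDirection x), real_inner_self_eq_norm_sq, h2, hx.1.1]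
    simp
    ring_nf
    simp
  · rw [Set.mem_ofPred_eq, ← norm_ne_zero_iff, norm_normFlow_snd hx]
    exact norm_ne_zero_iff.2 hx.2

theorem fibreDirection_normFlow (hx : x ∈ punctured n) (t : ℝ) :
    fibreDirection (normFlow t x) = - Real.sin t • x.1 + Real.cos t • fibreDirection x := by
  rw [fibreDirection, norm_normFlow_snd hx, normFlow,
    inv_smul_smul₀ (norm_ne_zero_iff.2 hx.2)]

theorem fibreRadius_normFlow (hx : x ∈ punctured n) (t : ℝ) :
    fibreRadius (normFlow t x) = fibreRadius x := by
  rw [fibreRadius, norm_normFlow_snd hx, fibreRadius]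

theorem euclideanSpace_ext_castSucc {z z' : EuclideanSpace ℂ (Fin (n + 1 + 1))}
    (h : ∀ k : Fin (n + 1), z k.castSucc = z' k.castSucc)
    (h' : z (Fin.last (n + 1)) = z' (Fin.last (n + 1))) : z = z' := by
  ext k
  exact Fin.lastCases h' h k

/-- With λ = e^{-it}, the flow of |v| turns e into λe. Then (λc)² times the conjugate of λe is λ c²
ē because λ has modulus one, and the remaining terms are linear in e or in c. -/
theorem reductionLift_normFlow (hx : x ∈ punctured n) (t : ℝ) (w : ℂ) :
    reductionLift n (normFlow t x, Complex.exp (-(t * Complex.I)) * w) =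
      Complex.exp (-(t * Complex.I)) • reductionLift n (x, w) := by
  have hexp : Complex.exp (-(t * Complex.I)) = Real.cos t - Real.sin t * Complex.I := by
    rw [← neg_mul, Complex.exp_mul_I, Complex.cos_neg, Complex.sin_neg]
    push_cast; ring
  have hcs : (Real.cos t : ℂ) ^ 2 + (Real.sin t : ℂ) ^ 2 = 1 := by
    exact_mod_cast Real.cos_sq_add_sin_sq t
  have hw : ∀ w : ℂ, (((w.re / 2 : ℝ) : ℂ) + Complex.I * ((w.im / 2 : ℝ) : ℂ)) = w / 2 := by
    intro w
    apply Complex.ext <;> simp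
  unfold reductionLift
  refine euclideanSpace_ext_castSucc (fun k => ?_) ?_
  · rw [PiLp.smul_apply, conicPoint_castSucc, conicPoint_castSucc, hw, hw, hexp,
      fibreDirection_normFlow hx, fibreRadius_normFlow hx]
    simp only [normFlow, PiLp.add_apply, PiLp.smul_apply, smul_eq_mul, map_add, map_mul, map_neg,
      Complex.conj_ofReal, Complex.conj_I, Complex.ofReal_add, Complex.ofReal_mul,
      Complex.ofReal_neg]
    generalize (Real.cos t : ℂ) = C at *
    generalize (Real.sin t : ℂ) = S at *
    generalize (fibreDirection x k : ℂ) = s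
    generalize (x.1 k : ℂ) = u
    generalize (fibreRadius x : ℂ) = r
    have hI : Complex.I ^ 2 = -1 := Complex.I_sq
    -- The first summand is |λ|² = 1 applied to the term c² ē. The second one only reduces powers of
    -- i.
    linear_combination (w ^ 2 / 4 * (C - S * Complex.I) * (u - Complex.I * s)) * hcs +
      (r ^ 2 * S * s - C * u * S ^ 2 * w ^ 2 / 4 - C * S ^ 2 * s * Complex.I * w ^ 2 / 4 +
        C ^ 2 * S * s * w ^ 2 / 4 + u * S ^ 3 * Complex.I * w ^ 2 / 4) * hI
  · rw [PiLp.smul_apply, conicPoint_last, conicPoint_last, hw, hw, fibreRadius_normFlow hx]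
    simp only [smul_eq_mul]
    ring

/-- For this real w one has c² = (1 - |v|)/2, so r² + c² = 1, r² - c² = |v| and 2rc = √(1 - |v|²).
The two lifts therefore agree exactly where a cut requires Ψ to agree with ψ. -/
theorem reductionLift_sqrt (h1 : ‖x.2‖ ≤ 1) :
    reductionLift n (x, (Real.sqrt (2 * (1 - ‖x.2‖)) : ℂ)) = discLift n x := by
  have h3 : Real.sqrt (2 * (1 - ‖x.2‖)) ^ 2 = 2 * (1 - ‖x.2‖) := Real.sq_sqrt (by linarith)
  have h4 : Real.sqrt (1 - ‖x.2‖ ^ 2) = fibreRadius x * Real.sqrt (2 * (1 - ‖x.2‖)) := by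
    rw [fibreRadius, ← Real.sqrt_mul (by positivity)]
    congr 1
    ring
  have h5 := fibreRadius_sq x
  unfold reductionLift
  rw [conicPoint, discLift]
  simp only [Complex.ofReal_re, Complex.ofReal_im]
  congr 1
  refine Prod.ext (Prod.ext ?_ ?_) ?_
  · rw [h5, div_pow, h3]
    simp only [zero_div, mul_zero, zero_smul, add_zero]
    rw [show (1 + ‖x.2‖) / 2 + (2 * (1 - ‖x.2‖) / 2 ^ 2 - 0 ^ 2) = 1 by ring, one_smul]
  · rw [h5, div_pow, h3]
    simp only [zero_div, mul_zero, zero_smul, add_zero]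
    rw [show (1 + ‖x.2‖) / 2 - (2 * (1 - ‖x.2‖) / 2 ^ 2 - 0 ^ 2) = ‖x.2‖ by ring,
      norm_smul_fibreDirection]
  · simp only
    rw [h4]
    apply Complex.ext <;> simp
    ring

end Pointwise

end Model

/-! ### Smoothness of the lifts and their pullbacks of the standard form -/

section Pullback

variable {n : ℕ}

theorem contDiffOn_fibreDirection : ContDiffOn ℝ ∞ (fibreDirection (n := n)) {x | x.2 ≠ 0} := by
  intro x hx
  unfold fibreDirection
  exact (((contDiffAt_snd.norm ℝ hx).inv (norm_ne_zero_iff.2 hx)).smul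
    contDiffAt_snd).contDiffWithinAt

theorem contDiffOn_fibreRadius : ContDiffOn ℝ ∞ (fibreRadius (n := n)) {x | x.2 ≠ 0} := by
  intro x hx
  unfold fibreRadius
  refine (ContDiffAt.sqrt ?_ (by positivity)).contDiffWithinAt
  exact (contDiffAt_const.add (contDiffAt_snd.norm ℝ hx)).div_const _

theorem isOpen_snd_ne_zero : IsOpen {x : Doubled n | x.2 ≠ 0} :=
  isOpen_ne_fun continuous_snd continuous_const

theorem contDiffOn_conicPoint {V : Type*} [NormedAddCommGroup V] [NormedSpace ℝ V] {S : Set V}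
    {u s : V → EuclideanSpace ℝ (Fin (n + 1))} {r a b : V → ℝ} (hu : ContDiffOn ℝ ∞ u S)
    (hs : ContDiffOn ℝ ∞ s S) (hr : ContDiffOn ℝ ∞ r S) (ha : ContDiffOn ℝ ∞ a S)
    (hb : ContDiffOn ℝ ∞ b S) :
    ContDiffOn ℝ ∞ (fun x => conicPoint (u x) (s x) (r x) (a x) (b x)) S := by
  unfold conicPoint
  refine (assemble n).contDiff.comp_contDiffOn ?_
  refine ContDiffOn.prodMk (ContDiffOn.prodMk ?_ ?_) ?_
  · fun_prop
  · fun_prop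
  · have h : (fun x => (⟨-(2 * r x * b x), 2 * r x * a x⟩ : ℂ)) = fun x =>
        Complex.equivRealProdCLM.symm (-(2 * r x * b x), 2 * r x * a x) := by
      funext x; apply Complex.ext <;> simp
    rw [h]
    exact Complex.equivRealProdCLM.symm.contDiff.comp_contDiffOn (by fun_prop)

/-- Here w is an independent variable and no root of 1 - |v| occurs, so smoothness extends across
|v| = 1, where `discLift` is singular. -/
theorem contDiffOn_reductionLift : ContDiffOn ℝ ∞ (reductionLift n) {x | x.1.2 ≠ 0} := by
  have hre : ContDiff ℝ ∞ fun x : Doubled n × ℂ => x.2.re / 2 :=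
    (Complex.reCLM.contDiff.comp contDiff_snd).div_const _
  have him : ContDiff ℝ ∞ fun x : Doubled n × ℂ => x.2.im / 2 :=
    (Complex.imCLM.contDiff.comp contDiff_snd).div_const _
  unfold reductionLift
  exact contDiffOn_conicPoint (by fun_prop)
    (contDiffOn_fibreDirection.comp contDiff_fst.contDiffOn fun x hx => hx)
    (contDiffOn_fibreRadius.comp contDiff_fst.contDiffOn fun x hx => hx)
    hre.contDiffOn him.contDiffOn

theorem contDiffOn_discLift : ContDiffOn ℝ ∞ (discLift n) {x | ‖x.2‖ < 1} := by
  intro x hx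
  unfold discLift
  refine (ContDiffAt.comp x (assemble n).contDiff.contDiffAt
    (contDiffAt_id.prodMk ?_)).contDiffWithinAt
  refine contDiffAt_const.mul (Complex.ofRealCLM.contDiff.contDiffAt.comp x ?_)
  refine ContDiffAt.sqrt (contDiffAt_const.sub (contDiffAt_snd.norm_sq ℝ)) ?_
  have h1 : ‖x.2‖ < 1 := hx
  nlinarith [norm_nonneg x.2]

/-- The pullback of the standard form by `conicPoint`. -/
theorem formProdComplex_conicPoint_variation {u s u₁ u₂ s₁ s₂ : EuclideanSpace ℝ (Fin (n + 1))}
    {r a b r₁ r₂ a₁ a₂ b₁ b₂ : ℝ} (hu : ⟪u, u⟫_ℝ = 1) (hs : ⟪s, s⟫_ℝ = 1) (hus : ⟪u, s⟫_ℝ = 0)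
    (hu₁ : ⟪u, u₁⟫_ℝ = 0) (hu₂ : ⟪u, u₂⟫_ℝ = 0) (hs₁ : ⟪s, s₁⟫_ℝ = 0) (hs₂ : ⟪s, s₂⟫_ℝ = 0)
    (hus₁ : ⟪s, u₁⟫_ℝ = - ⟪u, s₁⟫_ℝ) (hus₂ : ⟪s, u₂⟫_ℝ = - ⟪u, s₂⟫_ℝ)
    (hr : r ^ 2 + (a ^ 2 + b ^ 2) = 1) (hr₁ : r * r₁ + (a * a₁ + b * b₁) = 0)
    (hr₂ : r * r₂ + (a * a₂ + b * b₂) = 0) :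
    formProdComplex (stdForm (n + 1))
      (((2 * r * r₁ + (2 * a * a₁ - 2 * b * b₁)) • u + (r ^ 2 + (a ^ 2 - b ^ 2)) • u₁ +
          ((2 * a₁ * b + 2 * a * b₁) • s + (2 * a * b) • s₁),
        (2 * r * r₁ - (2 * a * a₁ - 2 * b * b₁)) • s + (r ^ 2 - (a ^ 2 - b ^ 2)) • s₁ +
          ((2 * a₁ * b + 2 * a * b₁) • u + (2 * a * b) • u₁)),
        ⟨-(2 * r₁ * b + 2 * r * b₁), 2 * r₁ * a + 2 * r * a₁⟩)
      (((2 * r * r₂ + (2 * a * a₂ - 2 * b * b₂)) • u + (r ^ 2 + (a ^ 2 - b ^ 2)) • u₂ +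
          ((2 * a₂ * b + 2 * a * b₂) • s + (2 * a * b) • s₂),
        (2 * r * r₂ - (2 * a * a₂ - 2 * b * b₂)) • s + (r ^ 2 - (a ^ 2 - b ^ 2)) • s₂ +
          ((2 * a₂ * b + 2 * a * b₂) • u + (2 * a * b) • u₂)),
        ⟨-(2 * r₂ * b + 2 * r * b₂), 2 * r₂ * a + 2 * r * a₂⟩) =
    ⟪u₁, (4 * r * r₂) • s + (2 * r ^ 2 - 1) • s₂⟫_ℝ -
      ⟪(4 * r * r₁) • s + (2 * r ^ 2 - 1) • s₁, u₂⟫_ℝ + 4 * (a₁ * b₂ - b₁ * a₂) := by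
  have hsu : ⟪s, u⟫_ℝ = 0 := by rw [real_inner_comm, hus]
  have e1 : ⟪u₁, u⟫_ℝ = 0 := by rw [real_inner_comm, hu₁]
  have e2 : ⟪s₁, s⟫_ℝ = 0 := by rw [real_inner_comm, hs₁]
  have e3 : ⟪u₁, s⟫_ℝ = - ⟪u, s₁⟫_ℝ := by rw [real_inner_comm, hus₁]
  have e4 : ⟪s₁, u⟫_ℝ = ⟪u, s₁⟫_ℝ := real_inner_comm _ _
  simp only [formProdComplex, stdForm, inner_add_left, inner_add_right, real_inner_smul_left,
    real_inner_smul_right, hu, hs, hus, hu₂, hs₂, hus₂, hsu, e1, e2, e3, e4]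
  -- The constraints leave only these four pairings. What remains is a polynomial identity modulo r²
  -- + a² + b² = 1 and its linearizations in the two directions.
  generalize ⟪u, s₁⟫_ℝ = B₁
  generalize ⟪u, s₂⟫_ℝ = B₂
  generalize ⟪u₁, s₂⟫_ℝ = P
  generalize ⟪s₁, u₂⟫_ℝ = Q
  linear_combination ((P - Q) * (r ^ 2 - (a ^ 2 + b ^ 2) - 1) + 4 * r * r₁ * B₂ - 4 * r * r₂ * B₁ +
      4 * (a₁ * b₂ - b₁ * a₂)) * hr +
    (-4 * (a ^ 2 + b ^ 2) * B₂ + 4 * (a * b₂ - b * a₂)) * hr₁ +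
    (4 * (a ^ 2 + b ^ 2) * B₁ + 4 * (b * a₁ - a * b₁)) * hr₂

theorem exists_hasFDerivAt_conicPoint {V : Type*} [NormedAddCommGroup V] [NormedSpace ℝ V] {x : V}
    {u s : V → EuclideanSpace ℝ (Fin (n + 1))} {r a b : V → ℝ}
    {u' s' : V →L[ℝ] EuclideanSpace ℝ (Fin (n + 1))} {r' a' b' : V →L[ℝ] ℝ}
    (hu : HasFDerivAt u u' x) (hs : HasFDerivAt s s' x) (hr : HasFDerivAt r r' x)
    (ha : HasFDerivAt a a' x) (hb : HasFDerivAt b b' x) :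
    ∃ L' : V →L[ℝ] EuclideanSpace ℂ (Fin (n + 1 + 1)),
      HasFDerivAt (fun y => conicPoint (u y) (s y) (r y) (a y) (b y)) L' x ∧ ∀ c, L' c =
      assemble n
      (((2 * r x * r' c + (2 * a x * a' c - 2 * b x * b' c)) • u x +
          (r x ^ 2 + (a x ^ 2 - b x ^ 2)) • u' c +
          ((2 * a' c * b x + 2 * a x * b' c) • s x + (2 * a x * b x) • s' c),
        (2 * r x * r' c - (2 * a x * a' c - 2 * b x * b' c)) • s x +
          (r x ^ 2 - (a x ^ 2 - b x ^ 2)) • s' c +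
          ((2 * a' c * b x + 2 * a x * b' c) • u x + (2 * a x * b x) • u' c)),
        ⟨-(2 * r' c * b x + 2 * r x * b' c), 2 * r' c * a x + 2 * r x * a' c⟩) := by
  have hα := ((hr.pow 2).add ((ha.pow 2).sub (hb.pow 2))).smul hu
  have hβ := ((hr.pow 2).sub ((ha.pow 2).sub (hb.pow 2))).smul hs
  have hγ := ((ha.const_mul 2).mul hb)
  have hτ := ((((hr.const_mul 2).mul hb).neg.prodMk ((hr.const_mul 2).mul ha)))
  have hτ' := Complex.equivRealProdCLM.symm.hasFDerivAt.comp x hτ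
  have key := (assemble n).hasFDerivAt.comp x
    (((hα.add (hγ.smul hs)).prodMk (hβ.add (hγ.smul hu))).prodMk hτ')
  refine ⟨_, key.congr_of_eventuallyEq (Filter.Eventually.of_forall fun y => ?_), fun c => ?_⟩
  · simp only [conicPoint, Function.comp]
    congr 1
  · simp only [ContinuousLinearMap.comp_apply, ContinuousLinearMap.prod_apply]
    congr 1
    refine Prod.ext (Prod.ext ?_ ?_) ?_
    · simp
      module
    · simp
      module
    · apply Complex.ext <;> simp <;> ring

theorem inner_add_inner_eq_zero_of_mem_tangentConeAt {V W : Type*} [NormedAddCommGroup V]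
    [NormedSpace ℝ V] [NormedAddCommGroup W] [InnerProductSpace ℝ W] {f g : V → W}
    {f' g' : V →L[ℝ] W} {S : Set V} {x c : V} {k : ℝ} (hf : HasFDerivAt f f' x)
    (hg : HasFDerivAt g g' x) (hS : ∀ y ∈ S, ⟪f y, g y⟫_ℝ = k) (hx : x ∈ S)
    (hc : c ∈ tangentConeAt ℝ S x) : ⟪f x, g' c⟫_ℝ + ⟪f' c, g x⟫_ℝ = 0 := by
  simpa using (hf.inner ℝ hg).hasFDerivWithinAt.eq_zero_of_mem_tangentConeAt hS hx hc

/-- The lift of the reduction map pulls the standard form back to `ω ⊕ ω_ℂ`. -/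
theorem exists_hasFDerivAt_reductionLift {x : Doubled n × ℂ} (hx : x ∈ cutLevel n) :
    ∃ L' : Doubled n × ℂ →L[ℝ] EuclideanSpace ℂ (Fin (n + 1 + 1)),
      HasFDerivAt (reductionLift n) L' x ∧ ∀ c ∈ tangentConeAt ℝ (cutLevel n) x,
      ∀ d ∈ tangentConeAt ℝ (cutLevel n) x,
        (⟪L' c, L' d⟫_ℂ).im = formProdComplex (stdForm (n + 1)) c d := by
  have hx0 : x.1.2 ≠ 0 := hx.1.1.2
  have hn := isOpen_snd_ne_zero.mem_nhds (x := x.1) hx0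
  have htop : (∞ : WithTop ℕ∞) ≠ 0 := by simp
  obtain ⟨u', hu, hu'⟩ : ∃ u' : Doubled n × ℂ →L[ℝ] EuclideanSpace ℝ (Fin (n + 1)),
      HasFDerivAt (fun y : Doubled n × ℂ => y.1.1) u' x ∧ ∀ c, u' c = c.1.1 :=
    ⟨_, hasFDerivAt_fst.fst, fun c => rfl⟩
  obtain ⟨v', hv, hv'⟩ : ∃ v' : Doubled n × ℂ →L[ℝ] EuclideanSpace ℝ (Fin (n + 1)),
      HasFDerivAt (fun y : Doubled n × ℂ => y.1.2) v' x ∧ ∀ c, v' c = c.1.2 :=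
    ⟨_, hasFDerivAt_fst.snd, fun c => rfl⟩
  obtain ⟨s', hs⟩ : ∃ s' : Doubled n × ℂ →L[ℝ] EuclideanSpace ℝ (Fin (n + 1)),
      HasFDerivAt (fun y : Doubled n × ℂ => fibreDirection y.1) s' x :=
    ⟨_, (((contDiffOn_fibreDirection (n := n)).contDiffAt hn).differentiableAt
      htop).hasFDerivAt.comp x hasFDerivAt_fst⟩
  obtain ⟨r', hr⟩ : ∃ r' : Doubled n × ℂ →L[ℝ] ℝ,
      HasFDerivAt (fun y : Doubled n × ℂ => fibreRadius y.1) r' x :=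
    ⟨_, (((contDiffOn_fibreRadius (n := n)).contDiffAt hn).differentiableAt
      htop).hasFDerivAt.comp x hasFDerivAt_fst⟩
  obtain ⟨a', ha, ha'⟩ : ∃ a' : Doubled n × ℂ →L[ℝ] ℝ,
      HasFDerivAt (fun y : Doubled n × ℂ => y.2.re / 2) a' x ∧ ∀ c, a' c = 2⁻¹ * c.2.re := by
    simp only [div_eq_mul_inv]
    exact ⟨_, (Complex.reCLM.hasFDerivAt.comp x hasFDerivAt_snd).mul_const 2⁻¹, fun c => rfl⟩
  obtain ⟨b', hb, hb'⟩ : ∃ b' : Doubled n × ℂ →L[ℝ] ℝ,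
      HasFDerivAt (fun y : Doubled n × ℂ => y.2.im / 2) b' x ∧ ∀ c, b' c = 2⁻¹ * c.2.im := by
    simp only [div_eq_mul_inv]
    exact ⟨_, (Complex.imCLM.hasFDerivAt.comp x hasFDerivAt_snd).mul_const 2⁻¹, fun c => rfl⟩
  obtain ⟨L', hL, hL'⟩ := exists_hasFDerivAt_conicPoint hu hs hr ha hb
  have h2r : ∀ y : Doubled n × ℂ, 2 * fibreRadius y.1 ^ 2 - 1 = ‖y.1.2‖ := fun y => by
    rw [fibreRadius_sq]; ring
  -- This differentiates v = (2r² - 1)s. The right-hand side is the vector in the variation formula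
  -- that has to be recognized as the fibre component dv.
  have hvs : ∀ c, c.1.2 = (4 * fibreRadius x.1 * r' c) • fibreDirection x.1 +
      (2 * fibreRadius x.1 ^ 2 - 1) • s' c := by
    have h1 := ((((hr.pow 2).const_mul 2).sub_const 1).smul hs).congr_of_eventuallyEq
      (f₁ := fun y : Doubled n × ℂ => y.1.2) (Filter.Eventually.of_forall fun y => by
        simp only [Pi.smul_apply']
        exact ((congrArg (· • fibreDirection y.1) (h2r y)).trans
          (norm_smul_fibreDirection y.1)).symm)
    intro c
    rw [← hv', hv.unique h1]
    simp
    module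
  have c1 : ∀ y ∈ cutLevel n, ⟪y.1.1, y.1.1⟫_ℝ = 1 := fun y hy => by
    rw [real_inner_self_eq_norm_sq, hy.1.1.1.1, one_pow]
  have c2 : ∀ y ∈ cutLevel n, ⟪fibreDirection y.1, fibreDirection y.1⟫_ℝ = 1 := fun y hy => by
    rw [real_inner_self_eq_norm_sq, norm_fibreDirection hy.1.1.2, one_pow]
  have c3 : ∀ y ∈ cutLevel n, ⟪y.1.1, fibreDirection y.1⟫_ℝ = 0 := fun y hy =>
    inner_fibreDirection hy.1.1.1
  have c4 : ∀ y ∈ cutLevel n, fibreRadius y.1 ^ 2 + ((y.2.re / 2) ^ 2 + (y.2.im / 2) ^ 2) = 1 :=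
    fun y hy => fibreRadius_sq_add hy
  have t1 : ∀ c ∈ tangentConeAt ℝ (cutLevel n) x, ⟪x.1.1, u' c⟫_ℝ = 0 := fun c hc => by
    have := inner_add_inner_eq_zero_of_mem_tangentConeAt hu hu c1 hx hc
    rw [real_inner_comm] at this
    linarith [real_inner_comm (u' c) x.1.1]
  have t2 : ∀ c ∈ tangentConeAt ℝ (cutLevel n) x, ⟪fibreDirection x.1, s' c⟫_ℝ = 0 := fun c hc => by
    have := inner_add_inner_eq_zero_of_mem_tangentConeAt hs hs c2 hx hc
    rw [real_inner_comm] at this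
    linarith [real_inner_comm (s' c) (fibreDirection x.1)]
  have t3 : ∀ c ∈ tangentConeAt ℝ (cutLevel n) x,
      ⟪fibreDirection x.1, u' c⟫_ℝ = - ⟪x.1.1, s' c⟫_ℝ := fun c hc => by
    have := inner_add_inner_eq_zero_of_mem_tangentConeAt hu hs c3 hx hc
    linarith [real_inner_comm (u' c) (fibreDirection x.1)]
  have t4 : ∀ c ∈ tangentConeAt ℝ (cutLevel n) x,
      fibreRadius x.1 * r' c + (x.2.re / 2 * a' c + x.2.im / 2 * b' c) = 0 := fun c hc => by
    have := ((hr.pow 2).add ((ha.pow 2).add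
      (hb.pow 2))).hasFDerivWithinAt.eq_zero_of_mem_tangentConeAt c4 hx hc
    simp at this
    linarith
  refine ⟨L', hL, fun c hc d hd => ?_⟩
  rw [hL', hL', inner_assemble_im, formProdComplex_conicPoint_variation (c1 x hx) (c2 x hx) (c3 x hx)
    (t1 c hc) (t1 d hd) (t2 c hc) (t2 d hd) (t3 c hc) (t3 d hd) (c4 x hx) (t4 c hc) (t4 d hd),
    ← hvs, ← hvs, hu', hu', ha', ha', hb', hb', formProdComplex, stdForm]
  ring

/-- The lift of the embedding of the disc bundle pulls the standard form back to `ω`. -/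
theorem exists_hasFDerivAt_discLift {x : Doubled n} (hx : ‖x.2‖ < 1) :
    ∃ L' : Doubled n →L[ℝ] EuclideanSpace ℂ (Fin (n + 1 + 1)),
      HasFDerivAt (discLift n) L' x ∧ ∀ c d, (⟪L' c, L' d⟫_ℂ).im = stdForm (n + 1) c d := by
  have h1 : (0 : ℝ) < 1 - ‖x.2‖ ^ 2 := by nlinarith [norm_nonneg x.2]
  obtain ⟨t', ht⟩ : ∃ t' : Doubled n →L[ℝ] ℝ,
      HasFDerivAt (fun y : Doubled n => Real.sqrt (1 - ‖y.2‖ ^ 2)) t' x :=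
    ⟨_, ((hasFDerivAt_snd.norm_sq).const_sub 1).sqrt h1.ne'⟩
  have h2 := (Complex.ofRealCLM.hasFDerivAt.comp x ht).const_mul Complex.I
  refine ⟨_, (assemble n).hasFDerivAt.comp x ((hasFDerivAt_id x).prodMk h2), fun c d => ?_⟩
  -- The last coordinate moves in the real line iℝ, on which ω_ℂ vanishes, so only the form of the
  -- first component survives.
  rw [ContinuousLinearMap.comp_apply, ContinuousLinearMap.comp_apply, inner_assemble_im,
    formProdComplex]
  simp

/-- On the unit cosphere bundle, `(u + i v, 0)` pulls the standard form back to `ω`. -/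
theorem hasFDerivAt_assemble_zero (x : Doubled n) :
    ∃ L' : Doubled n →L[ℝ] EuclideanSpace ℂ (Fin (n + 1 + 1)),
      HasFDerivAt (fun y : Doubled n => assemble n (y, 0)) L' x ∧
        ∀ c d, (⟪L' c, L' d⟫_ℂ).im = stdForm (n + 1) c d := by
  refine ⟨_, (assemble n).hasFDerivAt.comp x ((hasFDerivAt_id x).prodMk (hasFDerivAt_const 0 x)),
    fun c d => ?_⟩
  rw [ContinuousLinearMap.comp_apply, ContinuousLinearMap.comp_apply, inner_assemble_im,
    formProdComplex]
  simp

end Pullback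

/-! ### The Hamiltonian flows -/

section Flow

variable {n : ℕ}

theorem HasFDerivAt.fderivWithin_apply_of_mem_tangentConeAt {V W : Type*} [NormedAddCommGroup V]
    [NormedSpace ℝ V] [NormedAddCommGroup W] [NormedSpace ℝ W] {f : V → W} {f' : V →L[ℝ] W}
    {S : Set V} {x b : V} (h : HasFDerivAt f f' x) (hb : b ∈ tangentConeAt ℝ S x) :
    fderivWithin ℝ f S x b = f' b :=
  h.hasFDerivWithinAt.differentiableWithinAt.hasFDerivWithinAt.unique_on h.hasFDerivWithinAt hb

theorem HasDerivAt.fst_comp {V W : Type*} [NormedAddCommGroup V] [NormedSpace ℝ V]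
    [NormedAddCommGroup W] [NormedSpace ℝ W] {γ : ℝ → V × W} {ξ : V × W} {t : ℝ}
    (h : HasDerivAt γ ξ t) : HasDerivAt (fun t => (γ t).1) ξ.1 t :=
  (hasFDerivAt_fst (𝕜 := ℝ) (p := γ t)).comp_hasDerivAt t h

theorem HasDerivAt.snd_comp {V W : Type*} [NormedAddCommGroup V] [NormedSpace ℝ V]
    [NormedAddCommGroup W] [NormedSpace ℝ W] {γ : ℝ → V × W} {ξ : V × W} {t : ℝ}
    (h : HasDerivAt γ ξ t) : HasDerivAt (fun t => (γ t).2) ξ.2 t :=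
  (hasFDerivAt_snd (𝕜 := ℝ) (p := γ t)).comp_hasDerivAt t h

theorem exists_hasFDerivAt_norm_snd {x : Doubled n} (hx : x.2 ≠ 0) :
    ∃ H' : Doubled n →L[ℝ] ℝ, HasFDerivAt (fun y : Doubled n => ‖y.2‖) H' x ∧
      ∀ b, H' b = ⟪fibreDirection x, b.2⟫_ℝ := by
  have h1 : ‖x.2‖ ^ 2 ≠ 0 := pow_ne_zero _ (norm_ne_zero_iff.2 hx)
  have h2 := (HasFDerivAt.norm_sq (hasFDerivAt_snd (𝕜 := ℝ) (p := x))).sqrt h1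
  refine ⟨_, h2.congr_of_eventuallyEq (Filter.Eventually.of_forall fun y => ?_), fun b => ?_⟩
  · simp [Real.sqrt_sq (norm_nonneg y.2)]
  · simp [Real.sqrt_sq (norm_nonneg x.2), fibreDirection, inner_smul_left]
    ring

theorem fderivWithin_norm_snd {x b : Doubled n} {S : Set (Doubled n)} (hx : x.2 ≠ 0)
    (hb : b ∈ tangentConeAt ℝ S x) :
    fderivWithin ℝ (fun y : Doubled n => ‖y.2‖) S x b = ⟪fibreDirection x, b.2⟫_ℝ := by
  obtain ⟨H', h1, h2⟩ := exists_hasFDerivAt_norm_snd hx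
  rw [h1.fderivWithin_apply_of_mem_tangentConeAt hb, h2]

theorem inner_of_mem_tangentConeAt_punctured {x b : Doubled n} (hx : x ∈ punctured n)
    (hb : b ∈ tangentConeAt ℝ (punctured n) x) :
    ⟪x.1, b.1⟫_ℝ = 0 ∧ ⟪x.1, b.2⟫_ℝ + ⟪b.1, x.2⟫_ℝ = 0 := by
  have h1 : HasFDerivAt (fun y : Doubled n => y.1) (ContinuousLinearMap.fst ℝ _ _) x :=
    hasFDerivAt_fst
  have h2 : HasFDerivAt (fun y : Doubled n => y.2) (ContinuousLinearMap.snd ℝ _ _) x :=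
    hasFDerivAt_snd
  have e1 := inner_add_inner_eq_zero_of_mem_tangentConeAt h1 h1 (S := punctured n) (k := 1)
    (fun y hy => by rw [real_inner_self_eq_norm_sq, hy.1.1, one_pow]) hx hb
  have e2 := inner_add_inner_eq_zero_of_mem_tangentConeAt h1 h2 (S := punctured n) (k := 0)
    (fun y hy => hy.1.2) hx hb
  refine ⟨?_, e2⟩
  rw [real_inner_comm x.1] at e1
  simp at e1
  exact e1

/-- These fibre directions, together with the rotations of `rotation_mem_tangentConeAt`, are enough
test vectors to determine the Hamiltonian vector field. -/
theorem vertical_mem_tangentConeAt {x : Doubled n} (hx : x ∈ punctured n)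
    {b : EuclideanSpace ℝ (Fin (n + 1))} (hb : ⟪x.1, b⟫_ℝ = 0) :
    ((0, b) : Doubled n) ∈ tangentConeAt ℝ (punctured n) x := by
  have h1 : HasDerivAt (fun t : ℝ => ((x.1, x.2 + t • b) : Doubled n)) (0, b) 0 := by
    refine (hasDerivAt_const 0 x.1).prodMk ?_
    simpa using ((hasDerivAt_id (0 : ℝ)).smul_const b).const_add x.2
  have h2 : ∀ᶠ t : ℝ in 𝓝 0, ((x.1, x.2 + t • b) : Doubled n) ∈ punctured n := by
    have h3 : ∀ᶠ t : ℝ in 𝓝 0, x.2 + t • b ≠ 0 := by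
      refine ContinuousAt.eventually_ne (by fun_prop) ?_
      simpa using hx.2
    filter_upwards [h3] with t ht
    refine ⟨⟨hx.1.1, ?_⟩, ht⟩
    simp [inner_add_right, inner_smul_right, hx.1.2, hb]
  simpa using h1.mem_tangentConeAt h2

theorem rotation_mem_tangentConeAt {x : Doubled n} (hx : x ∈ punctured n)
    {a : EuclideanSpace ℝ (Fin (n + 1))} (ha : ⟪x.1, a⟫_ℝ = 0) (ha1 : ‖a‖ = 1) :
    ((a, - ⟪x.2, a⟫_ℝ • x.1) : Doubled n) ∈ tangentConeAt ℝ (punctured n) x := by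
  set k := ⟪x.2, a⟫_ℝ with hk
  -- The base point rotates in the plane of u and a. The component of v along a rotates with it, and
  -- the rest of v is orthogonal to this plane, so the curve stays in the cotangent bundle.
  let γ : ℝ → Doubled n := fun t => (Real.cos t • x.1 + Real.sin t • a,
    (x.2 - k • a) + k • (Real.cos t • a - Real.sin t • x.1))
  have h0 : γ 0 = x := by simp [γ]
  have h1 : HasDerivAt γ (a, - k • x.1) 0 := by
    have hc := Real.hasDerivAt_cos 0
    have hs := Real.hasDerivAt_sin 0
    have := ((hc.smul_const x.1).add (hs.smul_const a)).prodMk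
      ((((hc.smul_const a).sub (hs.smul_const x.1)).const_smul k).const_add (x.2 - k • a))
    simpa using this
  have h2 : ∀ᶠ t : ℝ in 𝓝 0, γ t ∈ punctured n := by
    have h3 : ∀ᶠ t : ℝ in 𝓝 0, (γ t).2 ≠ 0 := by
      refine ContinuousAt.eventually_ne (by fun_prop) ?_
      rw [h0]
      exact hx.2
    filter_upwards [h3] with t ht
    refine ⟨⟨norm_rotate hx.1.1 ha1 ha (by simp), ?_⟩, ht⟩
    have e1 : ⟪a, x.2⟫_ℝ = k := real_inner_comm _ _
    have e2 : ⟪a, x.1⟫_ℝ = 0 := by rw [real_inner_comm, ha]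
    simp only [γ, inner_add_left, inner_add_right, inner_sub_right, real_inner_smul_left,
      real_inner_smul_right, ha, e1, e2, hx.1.2, real_inner_self_eq_norm_sq, ha1, hx.1.1]
    ring
  have h4 := h1.mem_tangentConeAt h2
  rwa [h0] at h4

/-- The Hamiltonian vector field of `|v|`. -/
theorem hamiltonianVector_eq {x ξ : Doubled n} (hx : x ∈ punctured n)
    (hξ : ξ ∈ tangentConeAt ℝ (punctured n) x)
    (h : ∀ b ∈ tangentConeAt ℝ (punctured n) x, stdForm (n + 1) ξ b = ⟪fibreDirection x, b.2⟫_ℝ) :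
    ξ = (fibreDirection x, -‖x.2‖ • x.1) := by
  obtain ⟨c1, c2⟩ := inner_of_mem_tangentConeAt_punctured hx hξ
  have hu : ⟪x.1, x.1⟫_ℝ = 1 := by rw [real_inner_self_eq_norm_sq, hx.1.1, one_pow]
  -- The vertical test vectors pair only with the base component of ξ.
  have e1 : ξ.1 = fibreDirection x := by
    have h1 : ⟪x.1, ξ.1 - fibreDirection x⟫_ℝ = 0 := by
      rw [inner_sub_right, c1, inner_fibreDirection hx.1, sub_zero]
    have h2 := h _ (vertical_mem_tangentConeAt hx h1)
    simp only [stdForm, inner_zero_right, sub_zero] at h2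
    rw [← sub_eq_zero, ← inner_self_eq_zero (𝕜 := ℝ), inner_sub_left, h2, sub_self]
  -- The second component of a rotation vector is a multiple of u, which is orthogonal both to ξ.1
  -- and to s. The equation reduces to the pairing of ξ.2 with a.
  have h3 : ∀ a, ⟪x.1, a⟫_ℝ = 0 → ⟪ξ.2, a⟫_ℝ = 0 := by
    intro a ha
    by_cases ha0 : a = 0
    · simp [ha0]
    have hn : ‖a‖ ≠ 0 := norm_ne_zero_iff.2 ha0
    have h4 := h _ (rotation_mem_tangentConeAt hx (a := ‖a‖⁻¹ • a)
      (by rw [inner_smul_right, ha, mul_zero])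
      (by rw [norm_smul, norm_inv, norm_norm, inv_mul_cancel₀ hn]))
    have e2 : ⟪ξ.1, x.1⟫_ℝ = 0 := by rw [real_inner_comm, c1]
    have e3 : ⟪fibreDirection x, x.1⟫_ℝ = 0 := by rw [real_inner_comm, inner_fibreDirection hx.1]
    simp only [stdForm, real_inner_smul_right, e2, e3] at h4
    simpa [hn] using h4
  have e2 : ξ.2 = -‖x.2‖ • x.1 := by
    -- The component of ξ.2 along u is not seen by the test vectors. It comes from the tangency of
    -- ξ, the derivative of ⟨u, v⟩ = 0.
    have h4 : ⟪x.1, ξ.2⟫_ℝ = -‖x.2‖ := by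
      have h5 : ⟪fibreDirection x, x.2⟫_ℝ = ‖x.2‖ := by
        rw [fibreDirection, real_inner_smul_left, real_inner_self_eq_norm_sq]
        field_simp [norm_ne_zero_iff.2 hx.2]
      rw [e1, h5] at c2
      linarith
    have h5 : ⟪x.1, ξ.2 - -‖x.2‖ • x.1⟫_ℝ = 0 := by
      rw [inner_sub_right, inner_smul_right, h4, hu]; simp
    rw [← sub_eq_zero, ← inner_self_eq_zero (𝕜 := ℝ), inner_sub_left, h3 _ h5,
      real_inner_smul_left, h5]
    simp
  exact Prod.ext e1 e2

theorem normFlow_zero (x : Doubled n) : normFlow 0 x = x := by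
  refine Prod.ext ?_ ?_ <;> simp [normFlow, norm_smul_fibreDirection]

theorem normFlow_periodic (x : Doubled n) :
    Function.Periodic (fun t => normFlow t x) (2 * Real.pi) := fun t => by
  simp [normFlow]

theorem hasDerivAt_normFlow {x : Doubled n} (hx : x ∈ punctured n) (t : ℝ) :
    HasDerivAt (fun t => normFlow t x)
      (fibreDirection (normFlow t x), -‖(normFlow t x).2‖ • (normFlow t x).1) t := by
  rw [fibreDirection_normFlow hx, norm_normFlow_snd hx]
  have hc := Real.hasDerivAt_cos t
  have hs := Real.hasDerivAt_sin t
  have := ((hc.smul_const x.1).add (hs.smul_const (fibreDirection x))).prodMk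
      (((hs.neg.smul_const x.1).add (hc.smul_const (fibreDirection x))).const_smul ‖x.2‖)
  refine HasDerivAt.congr_deriv (f := fun t => normFlow t x) this (Prod.ext rfl ?_)
  simp only [normFlow]
  module

theorem isHamiltonianTrajectory_normFlow {x : Doubled n} (hx : x ∈ punctured n) :
    IsHamiltonianTrajectory (stdForm (n + 1)) (punctured n) (fun y => ‖y.2‖)
      (fun t => normFlow t x) := by
  intro t
  refine ⟨normFlow_mem hx t, _, hasDerivAt_normFlow hx t, fun b hb => ?_⟩
  rw [fderivWithin_norm_snd (normFlow_mem hx t).2 hb, stdForm, real_inner_smul_left,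
    (inner_of_mem_tangentConeAt_punctured (normFlow_mem hx t) hb).1]
  simp

theorem IsHamiltonianTrajectory.hasDerivAt {γ : ℝ → Doubled n}
    (hγ : IsHamiltonianTrajectory (stdForm (n + 1)) (punctured n) (fun y => ‖y.2‖) γ) (t : ℝ) :
    HasDerivAt γ (fibreDirection (γ t), -‖(γ t).2‖ • (γ t).1) t := by
  obtain ⟨hS, ξ, hξ, h⟩ := hγ t
  have h1 := hamiltonianVector_eq hS
    (hξ.mem_tangentConeAt (Filter.Eventually.of_forall fun τ => (hγ τ).1))
    fun b hb => (h b hb).trans (fderivWithin_norm_snd hS.2 hb)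
  rwa [h1] at hξ

/-- Along a trajectory |v| is constant, so u and s solve the linear system u' = s, s' = -u. Undoing
the rotation by the angle t turns the pair into constants (`hA`, `hB`), which gives uniqueness
directly. -/
theorem IsHamiltonianTrajectory.eq_normFlow {γ : ℝ → Doubled n}
    (hγ : IsHamiltonianTrajectory (stdForm (n + 1)) (punctured n) (fun y => ‖y.2‖) γ) (t : ℝ) :
    γ t = normFlow t (γ 0) := by
  have hd := fun t => IsHamiltonianTrajectory.hasDerivAt hγ t
  have hS : ∀ t, γ t ∈ punctured n := fun t => (hγ t).1
  have hfst : ∀ t, HasDerivAt (fun t => (γ t).1) (fibreDirection (γ t)) t := fun t =>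
    (hd t).fst_comp
  have hsnd : ∀ t, HasDerivAt (fun t => (γ t).2) (-‖(γ t).2‖ • (γ t).1) t := fun t =>
    (hd t).snd_comp
  have hnorm : ∀ t, ‖(γ t).2‖ = ‖(γ 0).2‖ := by
    intro t
    refine is_const_of_deriv_eq_zero (f := fun t => ‖(γ t).2‖) (𝕜 := ℝ) ?_ ?_ t 0
    · intro t
      exact (hsnd t).differentiableAt.norm ℝ (hS t).2
    · intro t
      obtain ⟨H', h1, h2⟩ := exists_hasFDerivAt_norm_snd (hS t).2
      have h3 : deriv (fun t => ‖(γ t).2‖) t = _ := (h1.comp_hasDerivAt t (hd t)).deriv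
      rw [h3, h2, real_inner_smul_right, real_inner_comm,
        inner_fibreDirection (hS t).1, mul_zero]
  have hs : ∀ t, HasDerivAt (fun t => fibreDirection (γ t)) (-(γ t).1) t := by
    intro t
    have h1 := (hsnd t).const_smul ‖(γ 0).2‖⁻¹
    have h2 : (fun t => fibreDirection (γ t)) = fun t => ‖(γ 0).2‖⁻¹ • (γ t).2 := by
      funext t; rw [fibreDirection, hnorm]
    rw [h2]
    refine HasDerivAt.congr_deriv (f := fun t => ‖(γ 0).2‖⁻¹ • (γ t).2) h1 ?_
    rw [hnorm t, smul_smul, mul_neg, inv_mul_cancel₀ (norm_ne_zero_iff.2 (hS 0).2), neg_one_smul]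
  have hA : ∀ t, Real.cos t • (γ t).1 - Real.sin t • fibreDirection (γ t) = (γ 0).1 := by
    intro t
    have h1 : ∀ t, HasDerivAt (fun t => Real.cos t • (γ t).1 - Real.sin t • fibreDirection (γ t))
        0 t := fun t => by
      refine HasDerivAt.congr_deriv
        (((Real.hasDerivAt_cos t).smul (hfst t)).sub ((Real.hasDerivAt_sin t).smul (hs t))) ?_
      module
    have := is_const_of_deriv_eq_zero (𝕜 := ℝ) (fun t => (h1 t).differentiableAt)
      (fun t => (h1 t).deriv) t 0
    simpa using this
  have hB : ∀ t, Real.sin t • (γ t).1 + Real.cos t • fibreDirection (γ t) =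
      fibreDirection (γ 0) := by
    intro t
    have h1 : ∀ t, HasDerivAt (fun t => Real.sin t • (γ t).1 + Real.cos t • fibreDirection (γ t))
        0 t := fun t => by
      refine HasDerivAt.congr_deriv
        (((Real.hasDerivAt_sin t).smul (hfst t)).add ((Real.hasDerivAt_cos t).smul (hs t))) ?_
      module
    have := is_const_of_deriv_eq_zero (𝕜 := ℝ) (fun t => (h1 t).differentiableAt)
      (fun t => (h1 t).deriv) t 0
    simpa using this
  have hcs := Real.cos_sq_add_sin_sq t
  refine Prod.ext ?_ ?_
  · rw [normFlow, ← hA t, ← hB t]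
    calc (γ t).1 = (Real.cos t ^ 2 + Real.sin t ^ 2) • (γ t).1 := by rw [hcs, one_smul]
      _ = _ := by simp only; module
  · rw [normFlow, ← hA t, ← hB t, ← hnorm t]
    calc (γ t).2 = ‖(γ t).2‖ • ((Real.cos t ^ 2 + Real.sin t ^ 2) • fibreDirection (γ t)) := by
          rw [hcs, one_smul, norm_smul_fibreDirection]
      _ = _ := by simp only; module

theorem sameOrbit_iff {x y : Doubled n} (hx : x ∈ punctured n) :
    SameOrbit (stdForm (n + 1)) (punctured n) (fun y => ‖y.2‖) x y ↔ ∃ t, y = normFlow t x := by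
  constructor
  · rintro ⟨γ, hγ, rfl, t, rfl⟩
    exact ⟨t, IsHamiltonianTrajectory.eq_normFlow hγ t⟩
  · rintro ⟨t, rfl⟩
    exact ⟨_, isHamiltonianTrajectory_normFlow hx, normFlow_zero x, t, rfl⟩

theorem fderivWithin_cutHamiltonian {x b : Doubled n × ℂ} {S : Set (Doubled n × ℂ)}
    (hx : x.1.2 ≠ 0) (hb : b ∈ tangentConeAt ℝ S x) :
    fderivWithin ℝ (cutHamiltonian fun y : Doubled n => ‖y.2‖) S x b =
      ⟪fibreDirection x.1, b.1.2⟫_ℝ + (x.2.re * b.2.re + x.2.im * b.2.im) := by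
  obtain ⟨H', h1, h2⟩ := exists_hasFDerivAt_norm_snd hx
  have h3 := (h1.comp x hasFDerivAt_fst).add
    ((HasFDerivAt.norm_sq (hasFDerivAt_snd (𝕜 := ℝ) (p := x))).mul_const 2⁻¹)
  have h4 : HasFDerivAt (cutHamiltonian fun y : Doubled n => ‖y.2‖) _ x := h3
  rw [h4.fderivWithin_apply_of_mem_tangentConeAt hb]
  simp [h2, Complex.inner]
  ring

/-- The orbits of the circle action on `T^*S^n × ℂ` generated by `|v| + |w|² / 2`. -/
theorem sameOrbit_cut_iff {x y : Doubled n × ℂ} (hx : x.1 ∈ punctured n) :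
    SameOrbit (formProdComplex (stdForm (n + 1))) (punctured n ×ˢ Set.univ)
      (cutHamiltonian fun y => ‖y.2‖) x y ↔
      ∃ t : ℝ, y = (normFlow t x.1, Complex.exp (-(t * Complex.I)) * x.2) := by
  constructor
  · rintro ⟨γ, hγ, rfl, t, rfl⟩
    -- The Hamiltonian is a sum of functions on the two factors. Test vectors (b, 0) isolate the
    -- equation for |v|, and the vectors (0, 1) and (0, i) isolate w' = -iw.
    have h1 : IsHamiltonianTrajectory (stdForm (n + 1)) (punctured n) (fun y => ‖y.2‖)
        (fun t => (γ t).1) := by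
      intro t
      obtain ⟨hS, ξ, hξ, h⟩ := hγ t
      refine ⟨hS.1, ξ.1, hξ.fst_comp, fun b hb => ?_⟩
      have hb' : ((b, 0) : Doubled n × ℂ) ∈ tangentConeAt ℝ (punctured n ×ˢ Set.univ) (γ t) :=
        subset_tangentConeAt_prod_left (by simp) ⟨b, hb, rfl⟩
      have := h _ hb'
      rw [fderivWithin_cutHamiltonian hS.1.2 hb'] at this
      rw [fderivWithin_norm_snd hS.1.2 hb]
      simpa [formProdComplex] using this
    have h2 : ∀ t, HasDerivAt (fun t => (γ t).2) (-(Complex.I * (γ t).2)) t := by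
      intro t
      obtain ⟨hS, ξ, hξ, h⟩ := hγ t
      have hc : ∀ c : ℂ, ((0, c) : Doubled n × ℂ) ∈
          tangentConeAt ℝ (punctured n ×ˢ Set.univ) (γ t) := fun c =>
        subset_tangentConeAt_prod_right (subset_closure hS.1) ⟨c, by simp, rfl⟩
      have e := fun c => (h _ (hc c)).trans (fderivWithin_cutHamiltonian hS.1.2 (hc c))
      have hξ2 : ξ.2 = -(Complex.I * (γ t).2) := by
        have e1 := e 1
        have e2 := e Complex.I
        simp [formProdComplex, stdForm] at e1 e2
        apply Complex.ext
        · simp [e2]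
        · simp
          linarith
      rw [← hξ2]
      exact hξ.snd_comp
    have h3 : ∀ t : ℝ, HasDerivAt (fun t : ℝ => Complex.exp (t * Complex.I) * (γ t).2) 0 t := by
      intro t
      have h4 : HasDerivAt (fun t : ℝ => Complex.exp (t * Complex.I))
          (Complex.exp (t * Complex.I) * Complex.I) t := by
        simpa using ((hasDerivAt_id (t : ℂ)).mul_const Complex.I).cexp.comp_ofReal
      refine HasDerivAt.congr_deriv (h4.mul (h2 t)) ?_
      ring
    have h5 := is_const_of_deriv_eq_zero (𝕜 := ℝ) (fun t => (h3 t).differentiableAt)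
      (fun t => (h3 t).deriv) t 0
    refine ⟨t, Prod.ext (IsHamiltonianTrajectory.eq_normFlow h1 t) ?_⟩
    simp at h5
    rw [← h5, ← mul_assoc, ← Complex.exp_add]
    simp
  · rintro ⟨t, rfl⟩
    refine ⟨fun t => (normFlow t x.1, Complex.exp (-(t * Complex.I)) * x.2), ?_, ?_, t, rfl⟩
    · intro t
      have h4 : HasDerivAt (fun t : ℝ => Complex.exp (-(t * Complex.I)) * x.2)
          (Complex.exp (-(t * Complex.I)) * -Complex.I * x.2) t := by
        simpa using (((hasDerivAt_id (t : ℂ)).mul_const Complex.I).neg.cexp.comp_ofReal).mul_const x.2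
      refine ⟨⟨normFlow_mem hx t, trivial⟩, _, (hasDerivAt_normFlow hx t).prodMk h4,
        fun b hb => ?_⟩
      rw [fderivWithin_cutHamiltonian (x := (normFlow t x.1, _)) (normFlow_mem hx t).2 hb]
      have hb1 : b.1 ∈ tangentConeAt ℝ (punctured n) (normFlow t x.1) := by
        have := (hasFDerivAt_fst (𝕜 := ℝ) (E := Doubled n) (F := ℂ)
          (p := (normFlow t x.1, Complex.exp (-(t * Complex.I)) * x.2))).hasFDerivWithinAt
            (s := punctured n ×ˢ Set.univ) |>.mapsTo_tangent_cone hb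
        exact tangentConeAt_mono (Set.fst_image_prod_subset _ _) this
      have h5 := (inner_of_mem_tangentConeAt_punctured (normFlow_mem hx t) hb1).1
      simp only [formProdComplex, stdForm, real_inner_smul_left, h5]
      simp
      ring
    · simp [normFlow_zero]

end Flow

/-! ### Recovering a point of the level set from its image -/

section Recover

variable {n : ℕ}

/-- The value of `|v|` at the point of the disc bundle that corresponds to `[z]`. -/
def recoverHeight (z : EuclideanSpace ℂ (Fin (n + 1 + 1))) : ℝ :=
  Real.sqrt (1 - 2 * ‖z (Fin.last (n + 1))‖ ^ 2 / ‖z‖ ^ 2)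

/-- The value of `fibreRadius` at the point of the disc bundle that corresponds to `[z]`. -/
def recoverRadius (z : EuclideanSpace ℂ (Fin (n + 1 + 1))) : ℝ :=
  Real.sqrt ((1 + recoverHeight z) / 2)

/-- The isotropic vector `u + i s`, up to a factor, that corresponds to `z`. -/
def recoverFrame (z : EuclideanSpace ℂ (Fin (n + 1 + 1))) (k : Fin (n + 1)) : ℂ :=
  ((recoverRadius z : ℂ) ^ 2 * z k.castSucc + z (Fin.last (n + 1)) ^ 2 *
    (starRingEnd ℂ) (z k.castSucc) * (((2 * recoverRadius z ^ 2 * ‖z‖ ^ 2 : ℝ) : ℂ))⁻¹) *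
      (recoverHeight z : ℂ)⁻¹

/-- The factor that makes the `k`-th coordinate of `recoverFrame z` a positive multiple of `c`. -/
def recoverPhase (k : Fin (n + 1)) (c : ℂ) (z : EuclideanSpace ℂ (Fin (n + 1 + 1))) : ℂ :=
  c * (starRingEnd ℂ) (recoverFrame z k) *
    ((‖recoverFrame z k‖ * ‖z‖ * (Real.sqrt 2)⁻¹ : ℝ) : ℂ)⁻¹

/-- A local section of the reduction map. -/
def recover (k : Fin (n + 1)) (c : ℂ) (z : EuclideanSpace ℂ (Fin (n + 1 + 1))) : Doubled n × ℂ :=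
  ((WithLp.toLp 2 fun l => (recoverPhase k c z * recoverFrame z l).re,
    WithLp.toLp 2 fun l => recoverHeight z * (recoverPhase k c z * recoverFrame z l).im),
    recoverPhase k c z * (z (Fin.last (n + 1)) * (Complex.I * (recoverRadius z : ℂ))⁻¹))

theorem recoverRadius_pos (z : EuclideanSpace ℂ (Fin (n + 1 + 1))) : 0 < recoverRadius z :=
  Real.sqrt_pos.2 (by have := Real.sqrt_nonneg (1 - 2 * ‖z (Fin.last (n + 1))‖ ^ 2 / ‖z‖ ^ 2)
                      unfold recoverHeight; linarith)

theorem recoverHeight_smul {c : ℂ} (hc : c ≠ 0) (z : EuclideanSpace ℂ (Fin (n + 1 + 1)))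
    : recoverHeight (c • z) = recoverHeight z := by
  unfold recoverHeight
  rw [PiLp.smul_apply, smul_eq_mul, norm_mul, norm_smul, mul_pow, mul_pow]
  have : ‖c‖ ^ 2 ≠ 0 := by simpa using hc
  rw [mul_left_comm, mul_div_mul_left _ _ this]

theorem recoverRadius_smul {c : ℂ} (hc : c ≠ 0) (z : EuclideanSpace ℂ (Fin (n + 1 + 1)))
    : recoverRadius (c • z) = recoverRadius z := by
  unfold recoverRadius
  rw [recoverHeight_smul hc]

theorem recoverFrame_smul {c : ℂ} (hc : c ≠ 0) (z : EuclideanSpace ℂ (Fin (n + 1 + 1)))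
    (k : Fin (n + 1)) :
    recoverFrame (c • z) k = c * recoverFrame z k := by
  unfold recoverFrame
  rw [recoverHeight_smul hc, recoverRadius_smul hc, PiLp.smul_apply, PiLp.smul_apply, smul_eq_mul,
    smul_eq_mul, norm_smul]
  have h1 : ((2 * recoverRadius z ^ 2 * (‖c‖ * ‖z‖) ^ 2 : ℝ) : ℂ) =
      (c * (starRingEnd ℂ) c) * ((2 * recoverRadius z ^ 2 * ‖z‖ ^ 2 : ℝ) : ℂ) := by
    rw [Complex.mul_conj, Complex.normSq_eq_norm_sq]
    push_cast; ring
  have h2 : (starRingEnd ℂ) c ≠ 0 := by simpa using hc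
  rw [h1, map_mul, mul_inv, mul_inv]
  field_simp

theorem recoverPhase_smul {c : ℂ} (hc : c ≠ 0) (z : EuclideanSpace ℂ (Fin (n + 1 + 1)))
    (k : Fin (n + 1)) (d : ℂ) :
    recoverPhase k d (c • z) = c⁻¹ * recoverPhase k d z := by
  unfold recoverPhase
  rw [recoverFrame_smul hc, norm_mul, norm_smul, map_mul]
  have h1 : ((‖c‖ * ‖recoverFrame z k‖ * (‖c‖ * ‖z‖) * (Real.sqrt 2)⁻¹ : ℝ) : ℂ) =
      (c * (starRingEnd ℂ) c) * ((‖recoverFrame z k‖ * ‖z‖ * (Real.sqrt 2)⁻¹ : ℝ) : ℂ) := by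
    rw [Complex.mul_conj, Complex.normSq_eq_norm_sq]
    push_cast; ring
  have h2 : (starRingEnd ℂ) c ≠ 0 := by simpa using hc
  rw [h1, mul_inv, mul_inv]
  field_simp

/-- Under scaling by c, height and radius are invariant, the frame acquires c and the phase c⁻¹.
These factors cancel, so the construction descends to projective space. -/
theorem recover_smul {c : ℂ} (hc : c ≠ 0) (z : EuclideanSpace ℂ (Fin (n + 1 + 1)))
    (k : Fin (n + 1)) (d : ℂ) : recover k d (c • z) = recover k d z := by
  unfold recover
  have h : ∀ l, recoverPhase k d (c • z) * recoverFrame (c • z) l =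
      recoverPhase k d z * recoverFrame z l := fun l => by
    rw [recoverPhase_smul hc, recoverFrame_smul hc]
    field_simp
  simp only [h]
  rw [recoverHeight_smul hc, recoverRadius_smul hc, recoverPhase_smul hc, PiLp.smul_apply,
    smul_eq_mul, mul_assoc c, mul_mul_mul_comm, inv_mul_cancel₀ hc, one_mul]

section Level

variable {x : Doubled n} {w : ℂ}

theorem half_eq (w : ℂ) : ((w.re / 2 : ℝ) : ℂ) + Complex.I * ((w.im / 2 : ℝ) : ℂ) = w / 2 := by
  apply Complex.ext <;> simp

theorem reductionLift_castSucc (x : Doubled n) (w : ℂ) (k : Fin (n + 1)) :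
    reductionLift n (x, w) k.castSucc =
      (fibreRadius x : ℂ) ^ 2 * (x.1 k + Complex.I * fibreDirection x k) +
        (w / 2) ^ 2 * (starRingEnd ℂ) (x.1 k + Complex.I * fibreDirection x k) := by
  rw [reductionLift, conicPoint_castSucc, half_eq]

theorem reductionLift_last (x : Doubled n) (w : ℂ) :
    reductionLift n (x, w) (Fin.last (n + 1)) = Complex.I * fibreRadius x * w := by
  rw [reductionLift, conicPoint_last, half_eq]
  ring

theorem reductionLift_norm_sq (h : (x, w) ∈ cutLevel n) : ‖reductionLift n (x, w)‖ ^ 2 = 2 :=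
  conicPoint_norm_sq h.1.1.1.1 (norm_fibreDirection h.1.1.2) (inner_fibreDirection h.1.1.1)
    (fibreRadius_sq_add h)

theorem reductionLift_ne_zero (h : (x, w) ∈ cutLevel n) : reductionLift n (x, w) ≠ 0 := by
  intro h0
  have := reductionLift_norm_sq h
  rw [h0] at this
  norm_num at this

theorem norm_sq_eq_of_mem_cutLevel (h : (x, w) ∈ cutLevel n) :
    ‖w‖ ^ 2 = 4 * (1 - fibreRadius x ^ 2) := by
  have h1 : ‖x.2‖ + ‖w‖ ^ 2 / 2 = 1 := h.2
  rw [fibreRadius_sq]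
  linarith

/-- The last coordinate satisfies |z_last|² = r²|w|² = 4r²(1 - r²) = 1 - |v|², and ‖z‖² = 2. -/
theorem recoverHeight_reductionLift (h : (x, w) ∈ cutLevel n) :
    recoverHeight (reductionLift n (x, w)) = ‖x.2‖ := by
  unfold recoverHeight
  rw [reductionLift_norm_sq h, reductionLift_last, norm_mul, norm_mul, Complex.norm_I, one_mul,
    Complex.norm_real, mul_pow, norm_sq_eq_of_mem_cutLevel h, Real.norm_eq_abs, sq_abs,
    fibreRadius_sq]
  rw [← Real.sqrt_sq (norm_nonneg x.2)]
  congr 1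
  rw [Real.sqrt_sq (norm_nonneg x.2)]
  ring

theorem recoverRadius_reductionLift (h : (x, w) ∈ cutLevel n) :
    recoverRadius (reductionLift n (x, w)) = fibreRadius x := by
  rw [recoverRadius, recoverHeight_reductionLift h, fibreRadius]

/-- From z = r²e + c²ē and its conjugate, r²z - c²z̄ = (r⁴ - |c|⁴)e. Since r² + |c|² = 1, the factor
is r² - |c|² = |v|. In `recoverFrame`, c² is written through the last coordinate as -z_last²/(4r²).
-/
theorem recoverFrame_reductionLift (h : (x, w) ∈ cutLevel n) (k : Fin (n + 1)) :
    recoverFrame (reductionLift n (x, w)) k = x.1 k + Complex.I * fibreDirection x k := by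
  have hh : (‖x.2‖ : ℂ) ≠ 0 := by simpa using h.1.1.2
  have hr : (fibreRadius x : ℂ) ≠ 0 := by simpa using (fibreRadius_pos x).ne'
  have h2 : (fibreRadius x : ℂ) ^ 2 = (1 + ‖x.2‖) / 2 := by
    exact_mod_cast congrArg (fun t : ℝ => (t : ℂ)) (fibreRadius_sq x)
  have h3 : w * (starRingEnd ℂ) w = 4 * (1 - (fibreRadius x : ℂ) ^ 2) := by
    rw [Complex.mul_conj, Complex.normSq_eq_norm_sq, norm_sq_eq_of_mem_cutLevel h]
    push_cast; ring
  unfold recoverFrame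
  rw [recoverHeight_reductionLift h, recoverRadius_reductionLift h, reductionLift_norm_sq h,
    reductionLift_castSucc, reductionLift_last, mul_inv_eq_iff_eq_mul₀ hh]
  generalize (x.1 k + Complex.I * fibreDirection x k : ℂ) = e
  simp only [map_add, map_mul, map_pow, Complex.conj_conj, Complex.conj_ofReal, map_div₀]
  have hI : Complex.I ^ 2 = -1 := Complex.I_sq
  have h4 : (starRingEnd ℂ) (2 : ℂ) = 2 := Complex.conj_ofNat 2
  rw [h4]
  push_cast
  generalize (fibreRadius x : ℂ) = r at *
  generalize (starRingEnd ℂ) w = w' at *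
  generalize (‖x.2‖ : ℂ) = t at *
  have h5 : t = 2 * r ^ 2 - 1 := by rw [h2]; ring
  rw [h5, mul_pow, mul_pow, hI]
  field_simp
  linear_combination (-(e * (w * w' + 4 * (1 - r ^ 2)))) * h3

end Level

end Recover

/-! ### Fibres and images of the model maps -/

section Sections

variable {n : ℕ} {x : Doubled n} {w : ℂ}

theorem exists_exp_neg_mul_I_eq {c : ℂ} (hc : ‖c‖ = 1) :
    ∃ t : ℝ, c = Complex.exp (-(t * Complex.I)) := by
  refine ⟨-c.arg, ?_⟩
  have := Complex.norm_mul_exp_arg_mul_I c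
  rw [hc] at this
  simpa using this.symm

theorem exp_neg_mul_I_eq (t : ℝ) :
    Complex.exp (-(t * Complex.I)) = Real.cos t - Real.sin t * Complex.I := by
  rw [← neg_mul, Complex.exp_mul_I, Complex.cos_neg, Complex.sin_neg]
  push_cast; ring

/-- In terms of `u + i s`, the circle action is multiplication by a unit complex number. -/
theorem normFlow_coord (x : Doubled n) (t : ℝ) (k : Fin (n + 1)) :
    (normFlow t x).1 k =
        (Complex.exp (-(t * Complex.I)) * (x.1 k + Complex.I * fibreDirection x k)).re ∧
      (normFlow t x).2 k =
        ‖x.2‖ * (Complex.exp (-(t * Complex.I)) * (x.1 k + Complex.I * fibreDirection x k)).im := by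
  rw [exp_neg_mul_I_eq, normFlow]
  generalize Real.cos t = C
  generalize Real.sin t = S
  constructor
  · simp
  · simp
    ring

theorem exists_frame_ne_zero (hx : x ∈ punctured n) :
    ∃ k, (x.1 k : ℂ) + Complex.I * fibreDirection x k ≠ 0 := by
  by_contra! h
  have h1 : x.1 = 0 := by
    ext k
    simpa using congrArg Complex.re (h k)
  have := hx.1.1
  rw [h1] at this
  simp at this

theorem recoverPhase_reductionLift (h : (x, w) ∈ cutLevel n) (k : Fin (n + 1)) (c : ℂ) :
    recoverPhase k c (reductionLift n (x, w)) =
      c * (starRingEnd ℂ) (x.1 k + Complex.I * fibreDirection x k) *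
        (‖(x.1 k : ℂ) + Complex.I * fibreDirection x k‖ : ℂ)⁻¹ := by
  have h1 : ‖reductionLift n (x, w)‖ = Real.sqrt 2 := by
    rw [← reductionLift_norm_sq h, Real.sqrt_sq (norm_nonneg _)]
  unfold recoverPhase
  rw [recoverFrame_reductionLift h, h1, mul_assoc ‖_‖, mul_inv_cancel₀ (by positivity), mul_one]

/-- The frame of the lift is e itself, so multiplication by a unit phase is the circle action. For a
unit c, `recover` thus picks the point of the orbit at which e_k is a positive multiple of c. -/
theorem recover_reductionLift (h : (x, w) ∈ cutLevel n) (k : Fin (n + 1)) (c : ℂ) {t : ℝ}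
    (ht : recoverPhase k c (reductionLift n (x, w)) = Complex.exp (-(t * Complex.I))) :
    recover k c (reductionLift n (x, w)) = (normFlow t x, Complex.exp (-(t * Complex.I)) * w) := by
  unfold recover
  simp only [ht, recoverFrame_reductionLift h, recoverHeight_reductionLift h]
  rw [recoverRadius_reductionLift h, reductionLift_last]
  refine Prod.ext (Prod.ext ?_ ?_) ?_
  · ext l
    exact (normFlow_coord x t l).1.symm
  · ext l
    exact (normFlow_coord x t l).2.symm
  · have hr : (fibreRadius x : ℂ) ≠ 0 := by simpa using (fibreRadius_pos x).ne'
    simp only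
    field_simp

theorem normFlow_mem_cutLevel (h : (x, w) ∈ cutLevel n) (t : ℝ) :
    (normFlow t x, Complex.exp (-(t * Complex.I)) * w) ∈ cutLevel n := by
  refine ⟨⟨normFlow_mem h.1.1 t, trivial⟩, ?_⟩
  have h1 : ‖x.2‖ + ‖w‖ ^ 2 / 2 = 1 := h.2
  have h2 : ‖Complex.exp (-(t * Complex.I))‖ = 1 := by
    rw [← neg_mul, ← Complex.ofReal_neg, Complex.norm_exp_ofReal_mul_I]
  simp only [cutHamiltonian]
  rw [norm_normFlow_snd h.1.1, norm_mul, h2, one_mul, h1]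

/-- The fibres of the reduction map are the orbits of the circle action. -/
theorem proj_reductionLift_eq_iff {y : Doubled n × ℂ} (h : (x, w) ∈ cutLevel n)
    (hy : y ∈ cutLevel n) :
    CP.proj (reductionLift n (x, w)) = CP.proj (reductionLift n y) ↔
      ∃ t : ℝ, y = (normFlow t x, Complex.exp (-(t * Complex.I)) * w) := by
  obtain ⟨y, w'⟩ := y
  constructor
  · intro he
    obtain ⟨c, hc, hcz⟩ :=
      (CP.proj_eq_proj_iff (reductionLift_ne_zero hy) (reductionLift_ne_zero h)).1 he.symm
    have hn : ‖c‖ = 1 := by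
      have h1 := reductionLift_norm_sq hy
      rw [hcz, norm_smul, mul_pow, reductionLift_norm_sq h] at h1
      have h2 : ‖c‖ ^ 2 = 1 := by linarith
      nlinarith [norm_nonneg c]
    obtain ⟨t, rfl⟩ := exists_exp_neg_mul_I_eq hn
    refine ⟨t, ?_⟩
    -- The two lifts differ by a unit factor. The height is homogeneous of degree 0 and the frame of
    -- degree 1, so the factor is read off as a rotation of e, and then of w.
    have hh : ‖y.2‖ = ‖x.2‖ := by
      rw [← recoverHeight_reductionLift hy, ← recoverHeight_reductionLift h, hcz,
        recoverHeight_smul hc]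
    have hf : ∀ k, (y.1 k : ℂ) + Complex.I * fibreDirection y k =
        Complex.exp (-(t * Complex.I)) * (x.1 k + Complex.I * fibreDirection x k) := fun k => by
      rw [← recoverFrame_reductionLift hy, ← recoverFrame_reductionLift h, hcz,
        recoverFrame_smul hc]
    have hr : fibreRadius y = fibreRadius x := by rw [fibreRadius, hh, fibreRadius]
    have hw : w' = Complex.exp (-(t * Complex.I)) * w := by
      have h1 := congrArg (fun z : EuclideanSpace ℂ (Fin (n + 1 + 1)) => z (Fin.last (n + 1))) hcz
      simp only [PiLp.smul_apply, smul_eq_mul, reductionLift_last, hr] at h1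
      have hr : (fibreRadius x : ℂ) ≠ 0 := by simpa using (fibreRadius_pos x).ne'
      have h2 : Complex.I * (fibreRadius x : ℂ) ≠ 0 := mul_ne_zero Complex.I_ne_zero hr
      refine mul_left_cancel₀ h2 ?_
      rw [h1]; ring
    refine Prod.ext (Prod.ext ?_ ?_) hw
    · ext k
      rw [(normFlow_coord x t k).1, ← hf]
      simp
    · ext k
      rw [(normFlow_coord x t k).2, ← hf, ← hh]
      have := congrArg (fun v : EuclideanSpace ℝ (Fin (n + 1)) => v k) (norm_smul_fibreDirection y)
      simp at this
      simp [this]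
  · rintro ⟨t, h1⟩
    rw [h1, reductionLift_normFlow h.1.1, CP.proj_smul (reductionLift_ne_zero h) (Complex.exp_ne_zero _)]

/-- The part of the quadric that corresponds to the complement of the zero section. -/
def CP.regularQuadric (n : ℕ) : Set (CP (n + 1)) :=
  {x ∈ CP.quadric n | 2 * ‖x.rep (Fin.last (n + 1))‖ ^ 2 < ‖x.rep‖ ^ 2}

theorem CP.proj_mem_quadric_iff {z : EuclideanSpace ℂ (Fin (n + 1 + 1))} (hz : z ≠ 0) :
    CP.proj z ∈ CP.quadric n ↔ ∑ k, z k ^ 2 = 0 := by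
  obtain ⟨c, hc, h⟩ := CP.exists_rep_proj hz
  change ∑ k, (CP.proj z).rep k ^ 2 = 0 ↔ _
  rw [h]
  simp only [PiLp.smul_apply, smul_eq_mul, mul_pow, ← Finset.mul_sum]
  simp [hc]

theorem CP.proj_mem_regularQuadric_iff {z : EuclideanSpace ℂ (Fin (n + 1 + 1))} (hz : z ≠ 0) :
    CP.proj z ∈ CP.regularQuadric n ↔
      ∑ k, z k ^ 2 = 0 ∧ 2 * ‖z (Fin.last (n + 1))‖ ^ 2 < ‖z‖ ^ 2 := by
  refine and_congr (CP.proj_mem_quadric_iff hz) ?_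
  obtain ⟨c, hc, h⟩ := CP.exists_rep_proj hz
  rw [h, PiLp.smul_apply, smul_eq_mul, norm_mul, norm_smul, mul_pow, mul_pow, mul_left_comm]
  exact mul_lt_mul_iff_right₀ (by positivity)

theorem CP.rep_proj_last_eq_zero_iff {z : EuclideanSpace ℂ (Fin (n + 1 + 1))} (hz : z ≠ 0) :
    (CP.proj z).rep (Fin.last (n + 1)) = 0 ↔ z (Fin.last (n + 1)) = 0 :=
  not_iff_not.1 (CP.rep_proj_apply_ne_zero _ hz)

theorem discLift_ne_zero (hx : x ∈ cotangentSphere n) (h1 : ‖x.2‖ ≤ 1) : discLift n x ≠ 0 := by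
  intro h0
  have := discLift_norm_sq hx h1
  rw [h0] at this
  norm_num at this

theorem discLift_last (x : Doubled n) : discLift n x (Fin.last (n + 1)) =
    Complex.I * (Real.sqrt (1 - ‖x.2‖ ^ 2) : ℂ) := by
  simp [discLift]

theorem discLift_last_eq_zero_iff (h1 : ‖x.2‖ ≤ 1) :
    discLift n x (Fin.last (n + 1)) = 0 ↔ ‖x.2‖ = 1 := by
  rw [discLift_last]
  simp only [mul_eq_zero, Complex.I_ne_zero, false_or, Complex.ofReal_eq_zero]
  rw [Real.sqrt_eq_zero (by nlinarith [norm_nonneg x.2])]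
  constructor
  · intro h; nlinarith [norm_nonneg x.2]
  · intro h; rw [h]; ring

theorem two_mul_norm_discLift_last_sq (h1 : ‖x.2‖ ≤ 1) :
    2 * ‖discLift n x (Fin.last (n + 1))‖ ^ 2 = 2 - 2 * ‖x.2‖ ^ 2 := by
  rw [discLift_last, norm_mul, Complex.norm_I, one_mul, Complex.norm_real, Real.norm_eq_abs, sq_abs,
    Real.sq_sqrt (by nlinarith [norm_nonneg x.2])]
  ring

/-- The disc bundle covers the quadric. -/
theorem exists_proj_discLift_eq {q : CP (n + 1)} (hq : q ∈ CP.quadric n) :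
    ∃ x ∈ cotangentSphere n, ‖x.2‖ ≤ 1 ∧ CP.proj (discLift n x) = q := by
  -- Multiplying by θ brings the last coordinate into i[0, ∞), the shape it has in `discLift`. The
  -- positive factor d below then adjusts the norm to √2.
  obtain ⟨θ, hθ, hθτ⟩ : ∃ θ : ℂ, θ ≠ 0 ∧ ∃ t : ℝ, 0 ≤ t ∧
      θ * q.rep (Fin.last (n + 1)) = Complex.I * t := by
    by_cases h : q.rep (Fin.last (n + 1)) = 0
    · exact ⟨1, one_ne_zero, 0, le_rfl, by simp [h]⟩
    · exact ⟨Complex.I / q.rep (Fin.last (n + 1)), div_ne_zero Complex.I_ne_zero h, 1, zero_le_one,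
        by field_simp; simp⟩
  obtain ⟨t, ht, hτ⟩ := hθτ
  have hz0 : θ • q.rep ≠ 0 := smul_ne_zero hθ q.rep_ne_zero
  have hN : 0 < ‖θ • q.rep‖ := norm_pos_iff.2 hz0
  set d : ℝ := Real.sqrt 2 / ‖θ • q.rep‖ with hd
  have hdpos : 0 < d := by positivity
  set z := (d : ℂ) • θ • q.rep with hz
  have hz1 : z ≠ 0 := smul_ne_zero (by exact_mod_cast hdpos.ne') hz0
  have hzn : ‖z‖ ^ 2 = 2 := by
    rw [hz, norm_smul, Complex.norm_real, Real.norm_eq_abs, abs_of_pos hdpos, hd,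
      div_mul_cancel₀ _ hN.ne', Real.sq_sqrt (by norm_num)]
  have hzq : CP.proj z = q := by
    rw [hz, CP.proj_smul hz0 (by exact_mod_cast hdpos.ne'), CP.proj_smul q.rep_ne_zero hθ,
      CP.proj_rep]
  have hzl : z (Fin.last (n + 1)) = Complex.I * ((d * t : ℝ) : ℂ) := by
    rw [hz, PiLp.smul_apply, PiLp.smul_apply, smul_eq_mul, smul_eq_mul, hτ]
    push_cast; ring
  let p : Doubled n := (WithLp.toLp 2 fun k => (z k.castSucc).re,
    WithLp.toLp 2 fun k => (z k.castSucc).im)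
  have hzp : z = assemble n (p, Complex.I * ((d * t : ℝ) : ℂ)) := by
    refine euclideanSpace_ext_castSucc (fun k => ?_) ?_
    · rw [assemble_castSucc]
      simp only [p]
      rw [mul_comm, Complex.re_add_im]
    · rw [assemble_last, hzl]
  have hsq : ∑ k, z k ^ 2 = 0 := (CP.proj_mem_quadric_iff hz1).1 (hzq ▸ hq)
  rw [hzp, sum_sq_assemble, mul_pow, Complex.I_sq] at hsq
  rw [hzp, norm_sq_assemble, norm_mul, Complex.norm_I, one_mul, Complex.norm_real,
    Real.norm_eq_abs, sq_abs] at hzn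
  simp only at hsq hzn
  -- Adding the real part of the quadric equation to |p|² + |q|² + (dt)² = 2 gives |p| = 1. The
  -- imaginary part gives orthogonality, and the last coordinate is then forced to be i√(1 - |q|²).
  have e1 : ‖p.1‖ ^ 2 - ‖p.2‖ ^ 2 - (d * t) ^ 2 = 0 := by
    have := congrArg Complex.re hsq
    simp [← Complex.ofReal_pow, -Complex.ofReal_mul] at this
    linarith
  have e2 : ⟪p.1, p.2⟫_ℝ = 0 := by
    have := congrArg Complex.im hsq
    simpa [← Complex.ofReal_pow, -Complex.ofReal_mul] using this
  have hp1 : ‖p.1‖ = 1 := by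
    have : ‖p.1‖ ^ 2 = 1 := by linarith
    nlinarith [norm_nonneg p.1]
  have hp2 : (d * t) ^ 2 = 1 - ‖p.2‖ ^ 2 := by rw [hp1] at e1; linarith
  refine ⟨p, ⟨hp1, e2⟩, by nlinarith [norm_nonneg p.2, sq_nonneg (d * t)], ?_⟩
  rw [discLift, ← hp2, Real.sqrt_sq (by positivity), ← hzp, hzq]

theorem mem_cutLevel_sqrt (hx : x ∈ punctured n) (h1 : ‖x.2‖ ≤ 1) :
    (x, (Real.sqrt (2 * (1 - ‖x.2‖)) : ℂ)) ∈ cutLevel n := by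
  refine ⟨⟨hx, trivial⟩, ?_⟩
  simp only [cutHamiltonian]
  rw [Complex.norm_real, Real.norm_eq_abs, sq_abs, Real.sq_sqrt (by linarith)]
  ring

theorem norm_snd_le_of_mem_cutLevel (h : (x, w) ∈ cutLevel n) : ‖x.2‖ ≤ 1 := by
  have h1 : ‖x.2‖ + ‖w‖ ^ 2 / 2 = 1 := h.2
  nlinarith [sq_nonneg ‖w‖]

/-- Every orbit of the circle action on the level set meets the image of the disc bundle. -/
theorem exists_normFlow_eq_sqrt (h : (x, w) ∈ cutLevel n) :
    ∃ t : ℝ, Complex.exp (-(t * Complex.I)) * w =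
      (Real.sqrt (2 * (1 - ‖(normFlow t x).2‖)) : ℂ) := by
  refine ⟨w.arg, ?_⟩
  have h1 : ‖x.2‖ + ‖w‖ ^ 2 / 2 = 1 := h.2
  have h2 := Complex.norm_mul_exp_arg_mul_I w
  rw [norm_normFlow_snd h.1.1, show 2 * (1 - ‖x.2‖) = ‖w‖ ^ 2 by linarith,
    Real.sqrt_sq (norm_nonneg w)]
  nth_rewrite 2 [← h2]
  rw [mul_left_comm, ← Complex.exp_add]
  simp

theorem proj_discLift_mem_quadric (hx : x ∈ cotangentSphere n) (h1 : ‖x.2‖ ≤ 1) :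
    CP.proj (discLift n x) ∈ CP.quadric n :=
  (CP.proj_mem_quadric_iff (discLift_ne_zero hx h1)).2 (sum_sq_discLift hx h1)

/-- On the lift, 2|z_last|² = 2 - 2|v|² and ‖z‖² = 2, so the strict inequality says |v| > 0. -/
theorem proj_discLift_mem_regularQuadric_iff (hx : x ∈ cotangentSphere n) (h1 : ‖x.2‖ ≤ 1) :
    CP.proj (discLift n x) ∈ CP.regularQuadric n ↔ x.2 ≠ 0 := by
  rw [CP.proj_mem_regularQuadric_iff (discLift_ne_zero hx h1), discLift_norm_sq hx h1,
    two_mul_norm_discLift_last_sq h1, and_iff_right (sum_sq_discLift hx h1), ← norm_pos_iff]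
  constructor
  · intro h
    by_contra h2
    have : ‖x.2‖ = 0 := le_antisymm (not_lt.1 h2) (norm_nonneg _)
    rw [this] at h
    norm_num at h
  · intro h
    nlinarith

theorem image_discLift_regular :
    (fun x => CP.proj (discLift n x)) '' {x ∈ punctured n | ‖x.2‖ ≤ 1} = CP.regularQuadric n := by
  ext q
  constructor
  · rintro ⟨x, ⟨hx, h1⟩, rfl⟩
    exact (proj_discLift_mem_regularQuadric_iff hx.1 h1).2 hx.2
  · intro hq
    obtain ⟨x, hx, h1, rfl⟩ := exists_proj_discLift_eq hq.1
    exact ⟨x, ⟨⟨hx, (proj_discLift_mem_regularQuadric_iff hx h1).1 hq⟩, h1⟩, rfl⟩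

/-- Flowing by the argument of w makes w real and nonnegative without changing the class. There the
lift is `discLift`. -/
theorem image_reductionLift :
    (fun x => CP.proj (reductionLift n x)) '' cutLevel n = CP.regularQuadric n := by
  rw [← image_discLift_regular]
  ext q
  constructor
  · rintro ⟨⟨x, w⟩, h, rfl⟩
    obtain ⟨t, ht⟩ := exists_normFlow_eq_sqrt h
    have h2 := normFlow_mem_cutLevel h t
    refine ⟨normFlow t x, ⟨h2.1.1, norm_snd_le_of_mem_cutLevel h2⟩, ?_⟩
    simp only
    rw [← reductionLift_sqrt (norm_snd_le_of_mem_cutLevel h2), ← ht]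
    exact ((proj_reductionLift_eq_iff h h2).2 ⟨t, rfl⟩).symm
  · rintro ⟨x, ⟨hx, h1⟩, rfl⟩
    exact ⟨_, mem_cutLevel_sqrt hx h1, by simp only [reductionLift_sqrt h1]⟩

end Sections

/-! ### Smooth inverses and local sections on projective space -/

section Smoothness

variable {n : ℕ}

theorem contDiffAt_recoverHeight {z : EuclideanSpace ℂ (Fin (n + 1 + 1))}
    (h : 2 * ‖z (Fin.last (n + 1))‖ ^ 2 < ‖z‖ ^ 2) : ContDiffAt ℝ ∞ recoverHeight z := by
  have hz : 0 < ‖z‖ ^ 2 := lt_of_le_of_lt (by positivity) h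
  unfold recoverHeight
  refine ContDiffAt.sqrt (contDiffAt_const.sub (ContDiffAt.div ?_ ?_ hz.ne')) ?_
  · refine contDiffAt_const.mul (ContDiffAt.norm_sq ℝ ?_)
    fun_prop
  · exact contDiffAt_id.norm_sq ℝ
  · have : 2 * ‖z (Fin.last (n + 1))‖ ^ 2 / ‖z‖ ^ 2 < 1 := (div_lt_one hz).2 h
    linarith

theorem recoverHeight_pos {z : EuclideanSpace ℂ (Fin (n + 1 + 1))}
    (h : 2 * ‖z (Fin.last (n + 1))‖ ^ 2 < ‖z‖ ^ 2) : 0 < recoverHeight z := by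
  have hz : 0 < ‖z‖ ^ 2 := lt_of_le_of_lt (by positivity) h
  have : 2 * ‖z (Fin.last (n + 1))‖ ^ 2 / ‖z‖ ^ 2 < 1 := (div_lt_one hz).2 h
  exact Real.sqrt_pos.2 (by linarith)

theorem contDiffAt_recoverRadius {z : EuclideanSpace ℂ (Fin (n + 1 + 1))}
    (h : 2 * ‖z (Fin.last (n + 1))‖ ^ 2 < ‖z‖ ^ 2) : ContDiffAt ℝ ∞ recoverRadius z := by
  unfold recoverRadius
  refine ContDiffAt.sqrt ((contDiffAt_const.add (contDiffAt_recoverHeight h)).div_const _) ?_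
  have := recoverHeight_pos h
  positivity

theorem ContDiffAt.complex_ofReal {V : Type*} [NormedAddCommGroup V] [NormedSpace ℝ V] {f : V → ℝ}
    {x : V} (hf : ContDiffAt ℝ ∞ f x) : ContDiffAt ℝ ∞ (fun y => (f y : ℂ)) x :=
  Complex.ofRealCLM.contDiff.contDiffAt.comp x hf

theorem ContDiffAt.complex_conj {V : Type*} [NormedAddCommGroup V] [NormedSpace ℝ V] {f : V → ℂ}
    {x : V} (hf : ContDiffAt ℝ ∞ f x) : ContDiffAt ℝ ∞ (fun y => (starRingEnd ℂ) (f y)) x :=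
  Complex.conjCLE.contDiff.contDiffAt.comp x hf

theorem ContDiffAt.complex_re {V : Type*} [NormedAddCommGroup V] [NormedSpace ℝ V] {f : V → ℂ}
    {x : V} (hf : ContDiffAt ℝ ∞ f x) : ContDiffAt ℝ ∞ (fun y => (f y).re) x :=
  Complex.reCLM.contDiff.contDiffAt.comp x hf

theorem ContDiffAt.complex_im {V : Type*} [NormedAddCommGroup V] [NormedSpace ℝ V] {f : V → ℂ}
    {x : V} (hf : ContDiffAt ℝ ∞ f x) : ContDiffAt ℝ ∞ (fun y => (f y).im) x :=
  Complex.imCLM.contDiff.contDiffAt.comp x hf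

theorem contDiffAt_coord {m : ℕ} (k : Fin m) (z : EuclideanSpace ℂ (Fin m)) :
    ContDiffAt ℝ ∞ (fun z : EuclideanSpace ℂ (Fin m) => z k) z := by
  fun_prop

theorem contDiffAt_recoverFrame {z : EuclideanSpace ℂ (Fin (n + 1 + 1))}
    (h : 2 * ‖z (Fin.last (n + 1))‖ ^ 2 < ‖z‖ ^ 2) (k : Fin (n + 1)) :
    ContDiffAt ℝ ∞ (fun z => recoverFrame z k) z := by
  have hz : 0 < ‖z‖ ^ 2 := lt_of_le_of_lt (by positivity) h
  have hr := contDiffAt_recoverRadius h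
  have hr0 := recoverRadius_pos z
  unfold recoverFrame
  refine ContDiffAt.mul (ContDiffAt.add ?_ ?_) (ContDiffAt.inv ?_ ?_)
  · exact (hr.complex_ofReal.pow 2).mul (contDiffAt_coord _ z)
  · refine (((contDiffAt_coord _ z).pow 2).mul (contDiffAt_coord _ z).complex_conj).mul
      (ContDiffAt.inv (ContDiffAt.complex_ofReal ?_) ?_)
    · exact (contDiffAt_const.mul (hr.pow 2)).mul (contDiffAt_id.norm_sq ℝ)
    · exact Complex.ofReal_ne_zero.2 (by positivity)
  · exact (contDiffAt_recoverHeight h).complex_ofReal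
  · exact Complex.ofReal_ne_zero.2 (recoverHeight_pos h).ne'

theorem contDiffAt_recover {z : EuclideanSpace ℂ (Fin (n + 1 + 1))}
    (h : 2 * ‖z (Fin.last (n + 1))‖ ^ 2 < ‖z‖ ^ 2) {k : Fin (n + 1)} (hk : recoverFrame z k ≠ 0)
    (c : ℂ) : ContDiffAt ℝ ∞ (recover k c) z := by
  have hz : 0 < ‖z‖ ^ 2 := lt_of_le_of_lt (by positivity) h
  have hz0 : z ≠ 0 := by rintro rfl; simp at hz
  have hr := contDiffAt_recoverRadius h
  have hr0 := recoverRadius_pos z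
  have hf := contDiffAt_recoverFrame h
  have hp : ContDiffAt ℝ ∞ (recoverPhase k c) z := by
    unfold recoverPhase
    refine (contDiffAt_const.mul (hf k).complex_conj).mul
      (ContDiffAt.inv (ContDiffAt.complex_ofReal ?_) ?_)
    · exact ((((hf k).norm ℝ hk)).mul (contDiffAt_id.norm ℝ hz0)).mul contDiffAt_const
    · have h1 : ‖recoverFrame z k‖ ≠ 0 := norm_ne_zero_iff.2 hk
      have h2 : ‖z‖ ≠ 0 := norm_ne_zero_iff.2 hz0
      exact Complex.ofReal_ne_zero.2 (by positivity)
  unfold recover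
  refine ContDiffAt.prodMk (ContDiffAt.prodMk ?_ ?_) ?_
  · exact contDiffAt_piLp' (p := 2) fun l => (hp.mul (hf l)).complex_re
  · exact contDiffAt_piLp' (p := 2) fun l =>
      (contDiffAt_recoverHeight h).mul (hp.mul (hf l)).complex_im
  · refine hp.mul ((contDiffAt_coord _ z).mul (ContDiffAt.inv ?_ ?_))
    · exact contDiffAt_const.mul hr.complex_ofReal
    · exact mul_ne_zero Complex.I_ne_zero (Complex.ofReal_ne_zero.2 (ne_of_gt hr0))

/-- The reduction map has smooth local sections. -/
theorem exists_section_reductionLift {y : Doubled n × ℂ} (h : y ∈ cutLevel n) :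
    ∃ O ∈ 𝓝 (CP.proj (reductionLift n y)), ∃ σ : CP (n + 1) → Doubled n × ℂ,
      (∀ q ∈ CP.regularQuadric n ∩ O, ContMDiffAt 𝓘(ℝ, EuclideanSpace ℂ (Fin (n + 1)))
        𝓘(ℝ, Doubled n × ℂ) ∞ σ q) ∧
      σ (CP.proj (reductionLift n y)) = y ∧
      ∀ q ∈ CP.regularQuadric n ∩ O, σ q ∈ cutLevel n ∧ CP.proj (reductionLift n (σ q)) = q := by
  obtain ⟨x, w⟩ := y
  obtain ⟨k, hk⟩ := exists_frame_ne_zero h.1.1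
  set e := (x.1 k : ℂ) + Complex.I * fibreDirection x k with he
  have hen : (‖e‖ : ℂ) ≠ 0 := by simpa using hk
  have hL0 := reductionLift_ne_zero h
  -- With this choice the phase at the given point is 1, so the section passes through y itself and
  -- not only through its orbit.
  set c : ℂ := e * (‖e‖ : ℂ)⁻¹ with hc
  have hcn : ‖c‖ = 1 := by
    rw [hc, norm_mul, norm_inv, Complex.norm_real, norm_norm,
      mul_inv_cancel₀ (norm_ne_zero_iff.2 hk)]
  have hLreg : CP.proj (reductionLift n (x, w)) ∈ CP.regularQuadric n :=
    image_reductionLift (n := n) ▸ ⟨_, h, rfl⟩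
  have hinv : ∀ d : ℂ, d ≠ 0 → ∀ z : EuclideanSpace ℂ (Fin (n + 1 + 1)),
      ‖recoverFrame (d • z) k‖ / ‖d • z‖ = ‖recoverFrame z k‖ / ‖z‖ := by
    intro d hd z
    rw [recoverFrame_smul hd, norm_mul, norm_smul, mul_div_mul_left _ _ (norm_ne_zero_iff.2 hd)]
  have hfr : recoverFrame (CP.proj (reductionLift n (x, w))).rep k ≠ 0 := by
    obtain ⟨d, hd, hrep⟩ := CP.exists_rep_proj hL0
    rw [hrep, recoverFrame_smul hd, recoverFrame_reductionLift h]
    exact mul_ne_zero hd hk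
  have hcont : ContinuousAt (fun q : CP (n + 1) => ‖recoverFrame q.rep k‖ / ‖q.rep‖)
      (CP.proj (reductionLift n (x, w))) := by
    refine (CP.contMDiffAt_comp_rep (φ := fun z => ‖recoverFrame z k‖ / ‖z‖) hinv ?_).continuousAt
    refine ContDiffAt.div ((contDiffAt_recoverFrame hLreg.2 k).norm ℝ hfr)
      (contDiffAt_id.norm ℝ (CP.rep_ne_zero _)) (norm_ne_zero_iff.2 (CP.rep_ne_zero _))
  -- The condition that the k-th frame coordinate is nonzero is expressed by a scale-invariant
  -- function. Its continuity at the base point does not depend on a continuous choice of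
  -- representatives.
  refine ⟨{q | ‖recoverFrame q.rep k‖ / ‖q.rep‖ ≠ 0}, hcont.eventually_ne
    (div_ne_zero (norm_ne_zero_iff.2 hfr) (norm_ne_zero_iff.2 (CP.rep_ne_zero _))),
    fun q => recover k c q.rep, ?_, ?_, ?_⟩
  · rintro q ⟨hq, hqO⟩
    refine CP.contMDiffAt_comp_rep (fun d hd z => recover_smul hd z k c)
      (contDiffAt_recover hq.2 ?_ c)
    rintro h0
    exact hqO (by simp [h0])
  · obtain ⟨d, hd, hrep⟩ := CP.exists_rep_proj hL0
    simp only
    rw [hrep, recover_smul hd, recover_reductionLift h k c (t := 0)]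
    · simp [normFlow_zero]
    · rw [recoverPhase_reductionLift h, ← he, hc, mul_assoc, mul_assoc, mul_left_comm _ _ (_ : ℂ)⁻¹,
        ← mul_assoc, Complex.mul_conj, Complex.normSq_eq_norm_sq]
      push_cast
      field_simp
      simp
  · rintro q ⟨hq, hqO⟩
    obtain ⟨⟨x', w'⟩, h', rfl⟩ := image_reductionLift (n := n) ▸ hq
    obtain ⟨d, hd, hrep⟩ := CP.exists_rep_proj (reductionLift_ne_zero h')
    have hk' : (x'.1 k : ℂ) + Complex.I * fibreDirection x' k ≠ 0 := by
      intro h0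
      refine hqO ?_
      simp only
      rw [hrep, recoverFrame_smul hd, recoverFrame_reductionLift h', h0]
      simp
    -- A phase of modulus one acts as a time of the flow, so the recovered point stays on the level
    -- set and in the orbit of (x', w').
    have hph : ‖recoverPhase k c (reductionLift n (x', w'))‖ = 1 := by
      rw [recoverPhase_reductionLift h', norm_mul, norm_mul, hcn, norm_inv, Complex.norm_real,
        norm_norm, RCLike.norm_conj, one_mul, mul_inv_cancel₀ (norm_ne_zero_iff.2 hk')]
    obtain ⟨t, ht⟩ := exists_exp_neg_mul_I_eq hph
    simp only
    rw [hrep, recover_smul hd, recover_reductionLift h' k c ht]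
    have h2 := normFlow_mem_cutLevel h' t
    exact ⟨h2, ((proj_reductionLift_eq_iff h' h2).2 ⟨t, rfl⟩).symm⟩

/-- The inverse of the embedding of the open disc bundle. -/
def discInverse (z : EuclideanSpace ℂ (Fin (n + 1 + 1))) : Doubled n :=
  (WithLp.toLp 2 fun k => (((Real.sqrt 2 * ‖z (Fin.last (n + 1))‖ * ‖z‖⁻¹ : ℝ) : ℂ) *
      (Complex.I * (z (Fin.last (n + 1)))⁻¹ * z k.castSucc)).re,
    WithLp.toLp 2 fun k => (((Real.sqrt 2 * ‖z (Fin.last (n + 1))‖ * ‖z‖⁻¹ : ℝ) : ℂ) *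
      (Complex.I * (z (Fin.last (n + 1)))⁻¹ * z k.castSucc)).im)

/-- When z_last ≠ 0, the scalar in `discInverse` selects the unique representative of norm √2 with
last coordinate in i(0, ∞). Its real and imaginary parts are u and v. -/
theorem discInverse_smul {c : ℂ} (hc : c ≠ 0) (z : EuclideanSpace ℂ (Fin (n + 1 + 1))) :
    discInverse (c • z) = discInverse z := by
  have h1 : Real.sqrt 2 * ‖(c • z) (Fin.last (n + 1))‖ * ‖c • z‖⁻¹ =
      Real.sqrt 2 * ‖z (Fin.last (n + 1))‖ * ‖z‖⁻¹ := by
    rw [PiLp.smul_apply, smul_eq_mul, norm_mul, norm_smul]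
    have : ‖c‖ ≠ 0 := norm_ne_zero_iff.2 hc
    field_simp
  have h2 : ∀ k : Fin (n + 1), Complex.I * ((c • z) (Fin.last (n + 1)))⁻¹ * (c • z) k.castSucc =
      Complex.I * (z (Fin.last (n + 1)))⁻¹ * z k.castSucc := fun k => by
    rw [PiLp.smul_apply, PiLp.smul_apply, smul_eq_mul, smul_eq_mul, mul_inv]
    field_simp
  unfold discInverse
  rw [h1]
  simp only [h2]

theorem discInverse_discLift {x : Doubled n} (hx : x ∈ cotangentSphere n) (h1 : ‖x.2‖ < 1) :
    discInverse (discLift n x) = x := by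
  have h2 : 0 < 1 - ‖x.2‖ ^ 2 := by nlinarith [norm_nonneg x.2]
  have h3 : ‖discLift n x‖ = Real.sqrt 2 := by
    rw [← discLift_norm_sq hx h1.le, Real.sqrt_sq (norm_nonneg _)]
  have h4 : 0 < Real.sqrt (1 - ‖x.2‖ ^ 2) := Real.sqrt_pos.2 h2
  have h5 : ∀ k : Fin (n + 1),
      ((Real.sqrt 2 * ‖discLift n x (Fin.last (n + 1))‖ * ‖discLift n x‖⁻¹ : ℝ) : ℂ) *
      (Complex.I * (discLift n x (Fin.last (n + 1)))⁻¹ * discLift n x k.castSucc) =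
      x.1 k + Complex.I * x.2 k := fun k => by
    rw [h3, discLift_last, norm_mul, Complex.norm_I, one_mul, Complex.norm_real, Real.norm_eq_abs,
      abs_of_pos h4, mul_right_comm, mul_inv_cancel₀ (by positivity), one_mul, discLift,
      assemble_castSucc]
    have : ((Real.sqrt (1 - ‖x.2‖ ^ 2) : ℝ) : ℂ) ≠ 0 := by exact_mod_cast h4.ne'
    field_simp
  unfold discInverse
  simp only [h5]
  refine Prod.ext ?_ ?_ <;> ext k <;> simp

theorem contMDiffAt_discInverse {q : CP (n + 1)} (hq : q.rep (Fin.last (n + 1)) ≠ 0) :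
    ContMDiffAt 𝓘(ℝ, EuclideanSpace ℂ (Fin (n + 1))) 𝓘(ℝ, Doubled n) ∞
      (fun q => discInverse q.rep) q := by
  refine CP.contMDiffAt_comp_rep (fun c hc z => discInverse_smul hc z) ?_
  have h1 : ∀ k : Fin (n + 1), ContDiffAt ℝ ∞ (fun z : EuclideanSpace ℂ (Fin (n + 1 + 1)) =>
      ((Real.sqrt 2 * ‖z (Fin.last (n + 1))‖ * ‖z‖⁻¹ : ℝ) : ℂ) *
      (Complex.I * (z (Fin.last (n + 1)))⁻¹ * z k.castSucc)) q.rep := fun k => by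
    refine ContDiffAt.mul (ContDiffAt.complex_ofReal ?_) ?_
    · exact (contDiffAt_const.mul ((contDiffAt_coord _ _).norm ℝ hq)).mul
        ((contDiffAt_id.norm ℝ q.rep_ne_zero).inv (norm_ne_zero_iff.2 q.rep_ne_zero))
    · exact (contDiffAt_const.mul ((contDiffAt_coord _ _).inv hq)).mul (contDiffAt_coord _ _)
  exact (contDiffAt_piLp' (p := 2) fun k => (h1 k).complex_re).prodMk
    (contDiffAt_piLp' (p := 2) fun k => (h1 k).complex_im)

theorem discInverse_rep_proj {x : Doubled n} (hx : x ∈ cotangentSphere n) (h1 : ‖x.2‖ < 1) :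
    discInverse (CP.proj (discLift n x)).rep = x := by
  obtain ⟨d, hd, hrep⟩ := CP.exists_rep_proj (discLift_ne_zero hx h1.le)
  rw [hrep, discInverse_smul hd, discInverse_discLift hx h1]

theorem image_discLift_interior :
    (fun x => CP.proj (discLift n x)) '' {x ∈ cotangentSphere n | ‖x.2‖ < 1} =
      {q ∈ CP.quadric n | q.rep (Fin.last (n + 1)) ≠ 0} := by
  ext q
  constructor
  · rintro ⟨x, ⟨hx, h1⟩, rfl⟩
    refine ⟨proj_discLift_mem_quadric hx h1.le, ?_⟩
    rw [CP.rep_proj_apply_ne_zero _ (discLift_ne_zero hx h1.le), Ne, discLift_last_eq_zero_iff h1.le]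
    exact h1.ne
  · rintro ⟨hq, hl⟩
    obtain ⟨x, hx, h1, rfl⟩ := exists_proj_discLift_eq hq
    rw [CP.rep_proj_apply_ne_zero _ (discLift_ne_zero hx h1), Ne, discLift_last_eq_zero_iff h1] at hl
    exact ⟨x, ⟨hx, lt_of_le_of_ne h1 hl⟩, rfl⟩

theorem image_discLift_boundary :
    (fun x => CP.proj (discLift n x)) '' {x ∈ punctured n | ‖x.2‖ = 1} =
      CP.hyperplaneQuadric n := by
  ext q
  constructor
  · rintro ⟨x, ⟨hx, h1⟩, rfl⟩
    refine ⟨proj_discLift_mem_quadric hx.1 h1.le, ?_⟩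
    rw [CP.rep_proj_last_eq_zero_iff (discLift_ne_zero hx.1 h1.le),
      discLift_last_eq_zero_iff h1.le]
    exact h1
  · rintro ⟨hq, hl⟩
    obtain ⟨x, hx, h1, rfl⟩ := exists_proj_discLift_eq hq
    rw [CP.rep_proj_last_eq_zero_iff (discLift_ne_zero hx h1), discLift_last_eq_zero_iff h1] at hl
    refine ⟨x, ⟨⟨hx, ?_⟩, hl⟩, rfl⟩
    rintro h0
    rw [h0] at hl
    simp at hl

end Smoothness

/-! ### Reduction of the unit cosphere bundle, and the comparison map -/

section Reduction

variable {n : ℕ}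

theorem zero_mem_cutLevel {x : Doubled n} (hx : x ∈ punctured n) (h1 : ‖x.2‖ = 1) :
    (x, (0 : ℂ)) ∈ cutLevel n :=
  ⟨⟨hx, trivial⟩, by simp [cutHamiltonian, h1]⟩

theorem reductionLift_zero {x : Doubled n} (h1 : ‖x.2‖ = 1) :
    reductionLift n (x, 0) = discLift n x := by
  rw [← reductionLift_sqrt h1.le, h1]
  simp

theorem discLift_of_norm_eq_one {x : Doubled n} (h1 : ‖x.2‖ = 1) :
    discLift n x = assemble n (x, 0) := by
  rw [discLift, h1]
  simp

/-- The unit cosphere bundle reduces to the hyperplane section of the quadric. -/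
theorem isSymplecticReduction_hyperplaneQuadric {G : Doubled n → CP (n + 1)}
    (hG : ∀ x ∈ punctured n, ‖x.2‖ = 1 → G x = CP.proj (discLift n x)) :
    IsSymplecticReduction (stdForm (n + 1)) (punctured n) (fun x => ‖x.2‖) 1 G
      (CP.hyperplaneQuadric n) (fun x => (2 : ℝ) • CP.fubiniStudy (n + 1) x) where
  smooth := by
    -- On |v| = 1 the square root vanishes identically, and the lift may be replaced by the
    -- restriction of a linear map. This avoids the singularity of `discLift`.
    refine ContMDiffOn.congr (f := fun x => CP.proj (assemble n (x, 0))) ?_ ?_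
    · refine CP.contMDiffOn_proj_comp ?_ ?_
      · exact ((assemble n).contDiff.comp (contDiff_id.prodMk contDiff_const)).contDiffOn
      · rintro x ⟨hx, h1⟩
        rw [← discLift_of_norm_eq_one h1]
        exact discLift_ne_zero hx.1 h1.le
    · rintro x ⟨hx, h1⟩
      rw [hG x hx h1, discLift_of_norm_eq_one h1]
  image_eq := by
    rw [← image_discLift_boundary]
    exact Set.image_congr fun x hx => hG x hx.1 hx.2
  fibres := by
    intro x hx h1 y hy h2
    rw [hG x hx h1, hG y hy h2, ← reductionLift_zero h1, ← reductionLift_zero h2,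
      proj_reductionLift_eq_iff (zero_mem_cutLevel hx h1) (zero_mem_cutLevel hy h2),
      sameOrbit_iff hx]
    simp
  sections := by
    intro x hx h1
    obtain ⟨O, hO, σ, hσ1, hσ2, hσ3⟩ := exists_section_reductionLift (zero_mem_cutLevel hx h1)
    rw [reductionLift_zero h1, ← hG x hx h1] at hO hσ2
    have hsub : CP.hyperplaneQuadric n ⊆ CP.regularQuadric n := by
      rintro q ⟨hq, hl⟩
      refine ⟨hq, ?_⟩
      rw [hl]
      have := norm_pos_iff.2 q.rep_ne_zero
      rw [norm_zero, zero_pow two_ne_zero, mul_zero]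
      positivity
    refine ⟨O, hO, fun q => (σ q).1, ?_, by simp only [hσ2], ?_⟩
    · intro q hq
      exact (contDiff_fst.contMDiff.contMDiffAt.comp q
        (hσ1 q ⟨hsub hq.1, hq.2⟩)).contMDiffWithinAt
    · rintro q ⟨hq, hqO⟩
      obtain ⟨h3, h4⟩ := hσ3 q ⟨hsub hq, hqO⟩
      -- The last coordinate of the lift is irw with r > 0. On the hyperplane section the section of
      -- the larger reduction therefore has w = 0 and |v| = 1.
      have h5 : (σ q).2 = 0 := by
        have hl := hq.2
        rw [← h4, CP.rep_proj_last_eq_zero_iff (reductionLift_ne_zero h3),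
          reductionLift_last] at hl
        simpa [(fibreRadius_pos (σ q).1).ne'] using hl
      have h6 : ‖(σ q).1.2‖ = 1 := by
        have : ‖(σ q).1.2‖ + ‖(σ q).2‖ ^ 2 / 2 = 1 := h3.2
        simpa [h5] using this
      refine ⟨h3.1.1, h6, ?_⟩
      rw [hG _ h3.1.1 h6, ← reductionLift_zero h6, ← h5]
      exact h4
  pullsBack := by
    intro x hx a ha b hb
    obtain ⟨L', hL, hL'⟩ := hasFDerivAt_assemble_zero x
    rw [← hL']
    refine CP.two_fubiniStudy_mfderivWithin hL.hasFDerivWithinAt ?_ hx ?_ ha hb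
    · rintro y ⟨hy, h2⟩
      rw [← discLift_of_norm_eq_one h2, discLift_norm_sq hy.1 h2.le]
    · rintro y ⟨hy, h2⟩
      rw [hG y hy h2, discLift_of_norm_eq_one h2]

end Reduction

/-! ### The comparison map of a cut as a bijection, and compactness of the cut -/

section Uniqueness

variable {n : ℕ} {X : Type*} [TopologicalSpace X]
  [ChartedSpace (EuclideanSpace ℝ (Fin (2 * n))) X]
  {ωX : TwoForm (EuclideanSpace ℝ (Fin (2 * n))) X} {ψ : Doubled n → X}

/-- The closed unit disc bundle. -/
abbrev closedDisc (n : ℕ) : Set (Doubled n) := {x ∈ cotangentSphere n | ‖x.2‖ ≤ 1}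

instance : Nonempty (Doubled n) := ⟨0⟩

/-- The comparison map from a cut to projective space. -/
def cutMap (ψ : Doubled n → X) (p : X) : CP (n + 1) :=
  CP.proj (discLift n (Classical.epsilon fun x => x ∈ closedDisc n ∧ ψ x = p))

namespace IsUnitCut

/-- Both maps are injective on the open disc bundle, separate it from the boundary, and collapse
precisely the circle orbits on the boundary. This makes the comparison map well defined and
injective. -/
theorem eq_iff (h : IsUnitCut n ωX ψ) {x y : Doubled n} (hx : x ∈ closedDisc n)
    (hy : y ∈ closedDisc n) :
    ψ x = ψ y ↔ CP.proj (discLift n x) = CP.proj (discLift n y) := by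
  have hlast : ∀ {x y : Doubled n}, x ∈ closedDisc n → y ∈ closedDisc n →
      CP.proj (discLift n x) = CP.proj (discLift n y) → ‖x.2‖ = 1 → ‖y.2‖ = 1 := by
    intro x y hx hy he h1
    rw [← discLift_last_eq_zero_iff hy.2, ← CP.rep_proj_last_eq_zero_iff
      (discLift_ne_zero hy.1 hy.2), ← he, CP.rep_proj_last_eq_zero_iff
      (discLift_ne_zero hx.1 hx.2), discLift_last_eq_zero_iff hx.2]
    exact h1
  obtain ⟨g, -, hg⟩ := h.interior.inverse
  obtain ⟨Ψ, hΨ, hΨψ⟩ := h.boundary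
  rcases lt_or_eq_of_le hx.2 with hx1 | hx1 <;> rcases lt_or_eq_of_le hy.2 with hy1 | hy1
  · constructor
    · intro he
      rw [← hg x ⟨hx.1, hx1⟩, ← hg y ⟨hy.1, hy1⟩, he]
    · intro he
      rw [← discInverse_rep_proj hx.1 hx1, ← discInverse_rep_proj hy.1 hy1, he]
  · constructor
    · intro he
      exact absurd he (Set.disjoint_iff_forall_ne.1 h.disjoint ⟨x, ⟨hx.1, hx1⟩, rfl⟩
        ⟨y, ⟨hy.1, hy1⟩, rfl⟩)
    · intro he
      exact absurd (hlast hy hx he.symm hy1) hx1.ne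
  · constructor
    · intro he
      exact absurd he.symm (Set.disjoint_iff_forall_ne.1 h.disjoint ⟨y, ⟨hy.1, hy1⟩, rfl⟩
        ⟨x, ⟨hx.1, hx1⟩, rfl⟩)
    · intro he
      exact absurd (hlast hx hy he hx1) hy1.ne
  · have hxU := h.level_subset x hx.1 hx1
    have hyU := h.level_subset y hy.1 hy1
    have hxp : x ∈ punctured n := ⟨hx.1, hxU⟩
    have hyp : y ∈ punctured n := ⟨hy.1, hyU⟩
    have hxc := zero_mem_cutLevel hxp hx1
    have hyc := zero_mem_cutLevel hyp hy1
    -- At |v| = 1 the second argument √(2(1 - |v|)) is 0, so ψ on the boundary is Ψ at w = 0, whose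
    -- fibres are known.
    have e1 := hΨψ x hxp hx.2
    have e2 := hΨψ y hyp hy.2
    simp only [hx1, hy1, sub_self, mul_zero, Real.sqrt_zero, Complex.ofReal_zero] at e1 e2
    rw [← e1, ← e2, hΨ.fibres _ hxc.1 hxc.2 _ hyc.1 hyc.2,
      sameOrbit_cut_iff (x := (x, 0)) hxp,
      ← reductionLift_zero hx1, ← reductionLift_zero hy1, proj_reductionLift_eq_iff hxc hyc]

theorem exists_eq (h : IsUnitCut n ωX ψ) (p : X) : ∃ x ∈ closedDisc n, ψ x = p := by
  have hp : p ∈ ψ '' {x ∈ cotangentSphere n | ‖x.2‖ ≤ 1} := by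
    rw [h.surjective]; trivial
  exact hp

/-- The arbitrary preimage chosen in `cutMap` does not matter, by `eq_iff`. -/
theorem cutMap_apply (h : IsUnitCut n ωX ψ) {x : Doubled n} (hx : x ∈ closedDisc n) :
    cutMap ψ (ψ x) = CP.proj (discLift n x) := by
  have h1 := Classical.epsilon_spec (p := fun y => y ∈ closedDisc n ∧ ψ y = ψ x) ⟨x, hx, rfl⟩
  exact (h.eq_iff h1.1 hx).1 h1.2

theorem cutMap_injective (h : IsUnitCut n ωX ψ) : Function.Injective (cutMap (n := n) ψ) := by
  intro p q hpq
  obtain ⟨x, hx, rfl⟩ := h.exists_eq p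
  obtain ⟨y, hy, rfl⟩ := h.exists_eq q
  rw [h.cutMap_apply hx, h.cutMap_apply hy] at hpq
  exact (h.eq_iff hx hy).2 hpq

theorem range_cutMap (h : IsUnitCut n ωX ψ) : Set.range (cutMap (n := n) ψ) = CP.quadric n := by
  ext q
  constructor
  · rintro ⟨p, rfl⟩
    obtain ⟨x, hx, rfl⟩ := h.exists_eq p
    rw [h.cutMap_apply hx]
    exact proj_discLift_mem_quadric hx.1 hx.2
  · intro hq
    obtain ⟨x, hx, h1, rfl⟩ := exists_proj_discLift_eq hq
    exact ⟨ψ x, h.cutMap_apply ⟨hx, h1⟩⟩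

/-- The comparison map on the reduced part of the cut. -/
theorem cutMap_reduction (h : IsUnitCut n ωX ψ) {Ψ : Doubled n × ℂ → X} {R : Set X}
    (hΨ : IsSymplecticReduction (formProdComplex (stdForm (n + 1))) (punctured n ×ˢ Set.univ)
      (cutHamiltonian fun x => ‖x.2‖) 1 Ψ R ωX)
    (hΨψ : ∀ x ∈ punctured n, ‖x.2‖ ≤ 1 → Ψ (x, (Real.sqrt (2 * (1 - ‖x.2‖)) : ℂ)) = ψ x)
    {y : Doubled n × ℂ} (hy : y ∈ cutLevel n) :
    cutMap ψ (Ψ y) = CP.proj (reductionLift n y) := by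
  obtain ⟨x, w⟩ := y
  -- Both sides are constant on orbits. It suffices to compare them at the point where w is the
  -- nonnegative root, where Ψ is ψ and the two lifts coincide.
  obtain ⟨t, ht⟩ := exists_normFlow_eq_sqrt hy
  have h2 := normFlow_mem_cutLevel hy t
  have h3 := norm_snd_le_of_mem_cutLevel h2
  rw [(proj_reductionLift_eq_iff hy h2).2 ⟨t, rfl⟩,
    (hΨ.fibres _ hy.1 hy.2 _ h2.1 h2.2).2 ((sameOrbit_cut_iff hy.1.1).2 ⟨t, rfl⟩), ht,
    hΨψ _ h2.1.1 h3, reductionLift_sqrt h3, h.cutMap_apply ⟨h2.1.1.1, h3⟩]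

/-- A point of the cut lies in its interior part or in its reduced part. -/
theorem mem_interior_or_exists (h : IsUnitCut n ωX ψ) {Ψ : Doubled n × ℂ → X}
    (hΨψ : ∀ x ∈ punctured n, ‖x.2‖ ≤ 1 → Ψ (x, (Real.sqrt (2 * (1 - ‖x.2‖)) : ℂ)) = ψ x) (p : X) :
    (∃ x, (x ∈ cotangentSphere n ∧ ‖x.2‖ < 1) ∧ ψ x = p) ∨ ∃ y ∈ cutLevel n, Ψ y = p := by
  obtain ⟨x, hx, rfl⟩ := h.exists_eq p
  rcases lt_or_eq_of_le hx.2 with hx1 | hx1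
  · exact Or.inl ⟨x, ⟨hx.1, hx1⟩, rfl⟩
  · have hxp : x ∈ punctured n := ⟨hx.1, h.level_subset x hx.1 hx1⟩
    exact Or.inr ⟨_, mem_cutLevel_sqrt hxp hx.2, hΨψ x hxp hx.2⟩

theorem isCompact_closedDisc : IsCompact (closedDisc n) := by
  refine Metric.isCompact_of_isClosed_isBounded ?_ ?_
  · have h1 : IsClosed {x : Doubled n | ‖x.1‖ = 1} := isClosed_eq (by fun_prop) continuous_const
    have h2 : IsClosed {x : Doubled n | ⟪x.1, x.2⟫_ℝ = 0} :=
      isClosed_eq (by fun_prop) continuous_const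
    have h3 : IsClosed {x : Doubled n | ‖x.2‖ ≤ 1} := isClosed_le (by fun_prop) continuous_const
    exact (h1.inter h2).inter h3
  · refine (Metric.isBounded_closedBall (x := (0 : Doubled n)) (r := 1)).subset ?_
    rintro x ⟨hx, h1⟩
    rw [mem_closedBall_zero_iff, Prod.norm_def]
    exact max_le hx.1.le h1

/-- At the boundary ψ factors as Ψ after x ↦ (x, √(2(1 - |v|))). The root is not smooth there but it
is continuous, which is all that compactness needs. -/
theorem continuousOn_closedDisc (h : IsUnitCut n ωX ψ) : ContinuousOn ψ (closedDisc n) := by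
  obtain ⟨Ψ, hΨ, hΨψ⟩ := h.boundary
  intro x hx
  rcases lt_or_eq_of_le hx.2 with hx1 | hx1
  · have h1 := h.interior.smooth.continuousOn x ⟨hx.1, hx1⟩
    have hopen : IsOpen {x : Doubled n | ‖x.2‖ < 1} := isOpen_lt (by fun_prop) continuous_const
    refine h1.mono_of_mem_nhdsWithin ?_
    filter_upwards [self_mem_nhdsWithin, mem_nhdsWithin_of_mem_nhds (hopen.mem_nhds hx1)]
      with y hy hy1
    exact ⟨hy.1, hy1⟩
  · have hxp : x ∈ punctured n := ⟨hx.1, h.level_subset x hx.1 hx1⟩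
    have h1 : ContinuousWithinAt Ψ (cutLevel n) (x, (Real.sqrt (2 * (1 - ‖x.2‖)) : ℂ)) :=
      hΨ.smooth.continuousOn _ (mem_cutLevel_sqrt hxp hx.2)
    have h2 : ContinuousWithinAt
        (fun y : Doubled n => (y, (Real.sqrt (2 * (1 - ‖y.2‖)) : ℂ)))
        {x ∈ punctured n | ‖x.2‖ ≤ 1} x := by
      refine Continuous.continuousWithinAt ?_
      fun_prop
    have h3 : ContinuousWithinAt ψ {x ∈ punctured n | ‖x.2‖ ≤ 1} x := by
      refine (ContinuousWithinAt.comp (g := Ψ)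
        (f := fun y : Doubled n => (y, (Real.sqrt (2 * (1 - ‖y.2‖)) : ℂ))) h1 h2
        fun y hy => mem_cutLevel_sqrt hy.1 hy.2).congr ?_ ?_
      · intro y hy
        exact (hΨψ y hy.1 hy.2).symm
      · exact (hΨψ x hxp hx.2).symm
    refine h3.mono_of_mem_nhdsWithin ?_
    filter_upwards [self_mem_nhdsWithin,
      mem_nhdsWithin_of_mem_nhds (isOpen_snd_ne_zero.mem_nhds hxp.2)] with y hy hy1
    exact ⟨⟨hy.1, hy1⟩, hy.2⟩

theorem compactSpace (h : IsUnitCut n ωX ψ) : CompactSpace X := by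
  rw [← isCompact_univ_iff, ← h.surjective]
  exact isCompact_closedDisc.image_of_continuousOn h.continuousOn_closedDisc

end IsUnitCut

end Uniqueness

/-! ### Uniqueness of the cut -/

section PullBack

variable {V : Type*} [NormedAddCommGroup V] [NormedSpace ℝ V]
  {E X : Type*} [NormedAddCommGroup E] [NormedSpace ℝ E] [TopologicalSpace X] [ChartedSpace E X]
  {N : ℕ}

/-- Suppose that `f` pulls `ωX` back to `Ω`, that `F ∘ f` has a lift `L` to the sphere of radius
`√2`, and that `L` pulls the standard form back to `Ω`. Then `F` pulls `2 ω_FS` back to `ωX`. -/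
theorem two_fubiniStudy_mfderiv_eq {Ω : V → V → ℝ} {S : Set V} {f : V → X} {ωX : TwoForm E X}
    {F : X → CP N} {x : V} (hx : x ∈ S) (hf : MDifferentiableWithinAt 𝓘(ℝ, V) 𝓘(ℝ, E) f S x)
    (hF : MDifferentiableAt 𝓘(ℝ, E) 𝓘(ℝ, EuclideanSpace ℂ (Fin N)) F (f x))
    (hΩ : PullsBackOn Ω S f ωX)
    {g : X → V} (hg : MDifferentiableAt 𝓘(ℝ, E) 𝓘(ℝ, V) g (f x)) (hgx : g (f x) = x)
    (hgS : ∀ᶠ z in 𝓝 (f x), g z ∈ S ∧ f (g z) = z)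
    {L : V → EuclideanSpace ℂ (Fin (N + 1))} {L' : V →L[ℝ] EuclideanSpace ℂ (Fin (N + 1))}
    (hL : HasFDerivWithinAt L L' S x) (hnorm : ∀ y ∈ S, ‖L y‖ ^ 2 = 2)
    (hFL : ∀ y ∈ S, F (f y) = CP.proj (L y))
    (hL' : ∀ a ∈ tangentConeAt ℝ S x, ∀ b ∈ tangentConeAt ℝ S x, (⟪L' a, L' b⟫_ℂ).im = Ω a b)
    (a b : TangentSpace 𝓘(ℝ, E) (f x)) :
    ((2 : ℝ) • CP.fubiniStudy N (F (f x)))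
      ![mfderiv 𝓘(ℝ, E) 𝓘(ℝ, EuclideanSpace ℂ (Fin N)) F (f x) a,
        mfderiv 𝓘(ℝ, E) 𝓘(ℝ, EuclideanSpace ℂ (Fin N)) F (f x) b] = ωX (f x) ![a, b] := by
  obtain ⟨a, ha, rfl⟩ := exists_mem_tangentConeAt_mfderivWithin_eq hx hf hg hgx hgS a
  obtain ⟨b, hb, rfl⟩ := exists_mem_tangentConeAt_mfderivWithin_eq hx hf hg hgx hgS b
  rw [hΩ x hx a ha b hb, ← hL' a ha b hb]
  have h := CP.two_fubiniStudy_mfderivWithin hL hnorm (G := fun y => F (f y)) hx hFL ha hb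
  rw [mfderivWithin_comp_of_mem_tangentConeAt hf hF hx (fun _ _ => rfl) ha,
    mfderivWithin_comp_of_mem_tangentConeAt hf hF hx (fun _ _ => rfl) hb] at h
  exact h

end PullBack

/-! ### Smoothness and symplecticity of the comparison map -/

namespace IsUnitCut

variable {n : ℕ} {X : Type*} [TopologicalSpace X]
  [ChartedSpace (EuclideanSpace ℝ (Fin (2 * n))) X]
  {ωX : TwoForm (EuclideanSpace ℝ (Fin (2 * n))) X} {ψ : Doubled n → X}

/-- Near an interior point the map is [L] composed with the inverse of ψ. Near a reduced point it is
[M] composed with a local section of Ψ. Openness of the two pieces in X turns smoothness on a set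
into smoothness at the point. -/
theorem contMDiff_cutMap (h : IsUnitCut n ωX ψ) :
    ContMDiff 𝓘(ℝ, EuclideanSpace ℝ (Fin (2 * n))) 𝓘(ℝ, EuclideanSpace ℂ (Fin (n + 1))) ∞
      (cutMap (n := n) ψ) := by
  intro p
  obtain ⟨Ψ, hΨ, hΨψ⟩ := h.boundary
  rcases h.mem_interior_or_exists hΨψ p with ⟨x, hx, rfl⟩ | ⟨y, hy, rfl⟩
  · obtain ⟨g, hg, hgx⟩ := h.interior.inverse
    have hU : ψ '' {x ∈ cotangentSphere n | ‖x.2‖ < 1} ∈ 𝓝 (ψ x) :=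
      h.interior.isOpen_image.mem_nhds ⟨x, hx, rfl⟩
    have h1 := (hg _ ⟨x, hx, rfl⟩).contMDiffAt hU
    have hopen : IsOpen {x : Doubled n | ‖x.2‖ < 1} := isOpen_lt (by fun_prop) continuous_const
    have h2 : ContMDiffAt 𝓘(ℝ, Doubled n) 𝓘(ℝ, EuclideanSpace ℂ (Fin (n + 1))) ∞
        (fun x => CP.proj (discLift n x)) (g (ψ x)) := by
      rw [hgx x hx]
      exact (CP.contMDiffAt_proj (discLift_ne_zero hx.1 hx.2.le)).comp x
        (contDiffOn_discLift.contDiffAt (hopen.mem_nhds hx.2)).contMDiffAt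
    refine (h2.comp (ψ x) h1).congr_of_eventuallyEq ?_
    filter_upwards [hU]
    rintro _ ⟨z, hz, rfl⟩
    rw [h.cutMap_apply ⟨hz.1, hz.2.le⟩]
    simp only [Function.comp_apply, hgx z hz]
  · obtain ⟨O, hO, σ, hσ, hσy, hσ1⟩ := hΨ.sections y hy.1 hy.2
    have hR : Ψ y ∈ ψ '' {x ∈ cotangentSphere n ∩ {x | x.2 ≠ 0} | ‖x.2‖ ≤ 1} := by
      rw [← hΨ.image_eq]
      exact ⟨y, hy, rfl⟩
    have hU := Filter.inter_mem (h.isOpen_boundary.mem_nhds hR) hO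
    have h1 := (hσ _ ⟨hR, mem_of_mem_nhds hO⟩).contMDiffAt hU
    have hopen : IsOpen {x : Doubled n × ℂ | x.1.2 ≠ 0} :=
      isOpen_ne_fun (by fun_prop) continuous_const
    have h2 : ContMDiffAt 𝓘(ℝ, Doubled n × ℂ) 𝓘(ℝ, EuclideanSpace ℂ (Fin (n + 1))) ∞
        (fun x => CP.proj (reductionLift n x)) (σ (Ψ y)) := by
      rw [hσy]
      exact (CP.contMDiffAt_proj (reductionLift_ne_zero hy)).comp y
        (contDiffOn_reductionLift.contDiffAt (hopen.mem_nhds hy.1.1.2)).contMDiffAt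
    refine (h2.comp (Ψ y) h1).congr_of_eventuallyEq ?_
    filter_upwards [hU] with z hz
    obtain ⟨h3, h4, h5⟩ := hσ1 z hz
    simp only [Function.comp_apply]
    rw [← h.cutMap_reduction hΨ hΨψ ⟨h3, h4⟩, h5]

theorem fubiniStudy_cutMap (h : IsUnitCut n ωX ψ) (p : X)
    (a b : TangentSpace 𝓘(ℝ, EuclideanSpace ℝ (Fin (2 * n))) p) :
    ((2 : ℝ) • CP.fubiniStudy (n + 1) (cutMap ψ p))
      ![mfderiv 𝓘(ℝ, EuclideanSpace ℝ (Fin (2 * n))) 𝓘(ℝ, EuclideanSpace ℂ (Fin (n + 1)))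
          (cutMap ψ) p a,
        mfderiv 𝓘(ℝ, EuclideanSpace ℝ (Fin (2 * n))) 𝓘(ℝ, EuclideanSpace ℂ (Fin (n + 1)))
          (cutMap ψ) p b] = ωX p ![a, b] := by
  obtain ⟨Ψ, hΨ, hΨψ⟩ := h.boundary
  have hF := h.contMDiff_cutMap.mdifferentiable (by simp)
  rcases h.mem_interior_or_exists hΨψ p with ⟨x, hx, rfl⟩ | ⟨y, hy, rfl⟩
  · obtain ⟨g, hg, hgx⟩ := h.interior.inverse
    have hU : ψ '' {x ∈ cotangentSphere n | ‖x.2‖ < 1} ∈ 𝓝 (ψ x) :=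
      h.interior.isOpen_image.mem_nhds ⟨x, hx, rfl⟩
    obtain ⟨L', hL, hL'⟩ := exists_hasFDerivAt_discLift hx.2
    refine two_fubiniStudy_mfderiv_eq (L := discLift n) (L' := L') (g := g)
      (S := {x ∈ cotangentSphere n | ‖x.2‖ < 1}) hx
      ((h.interior.smooth x hx).mdifferentiableWithinAt (by simp)) (hF _) h.interior.pullsBack
      (((hg _ ⟨x, hx, rfl⟩).contMDiffAt hU).mdifferentiableAt (by simp)) (hgx x hx) ?_
      hL.hasFDerivWithinAt (fun y hy => discLift_norm_sq hy.1 hy.2.le)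
      (fun y hy => h.cutMap_apply ⟨hy.1, hy.2.le⟩) (fun c _ d _ => hL' c d) a b
    filter_upwards [hU]
    rintro _ ⟨z, hz, rfl⟩
    rw [hgx z hz]
    exact ⟨hz, rfl⟩
  · obtain ⟨O, hO, σ, hσ, hσy, hσ1⟩ := hΨ.sections y hy.1 hy.2
    have hR : Ψ y ∈ ψ '' {x ∈ cotangentSphere n ∩ {x | x.2 ≠ 0} | ‖x.2‖ ≤ 1} := by
      rw [← hΨ.image_eq]
      exact ⟨y, hy, rfl⟩
    have hU := Filter.inter_mem (h.isOpen_boundary.mem_nhds hR) hO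
    obtain ⟨L', hL, hL'⟩ := exists_hasFDerivAt_reductionLift hy
    refine two_fubiniStudy_mfderiv_eq (L := reductionLift n) (L' := L') (g := σ)
      (S := cutLevel n) hy
      ((hΨ.smooth y hy).mdifferentiableWithinAt (by simp)) (hF _) hΨ.pullsBack
      (((hσ _ ⟨hR, mem_of_mem_nhds hO⟩).contMDiffAt hU).mdifferentiableAt (by simp)) hσy ?_
      hL.hasFDerivWithinAt (fun y hy => reductionLift_norm_sq hy)
      (fun y hy => h.cutMap_reduction hΨ hΨψ hy) hL' a b
    filter_upwards [hU] with z hz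
    obtain ⟨h3, h4, h5⟩ := hσ1 z hz
    exact ⟨⟨h3, h4⟩, h5⟩

/-- A vector killed by the differential pairs to zero with every vector under ω_X, since ω_X is a
pullback; nondegeneracy then gives an immersion. A continuous injection from a compact space to a
Hausdorff one is a topological embedding. -/
theorem isSymplectomorphismOnto_cutMap [T2Space X]
    [IsManifold 𝓘(ℝ, EuclideanSpace ℝ (Fin (2 * n))) ∞ X] (h : IsUnitCut n ωX ψ) :
    IsSymplectomorphismOnto ωX (cutMap (n := n) ψ) (CP.quadric n)
      (fun x => (2 : ℝ) • CP.fubiniStudy (n + 1) x) where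
  isSmoothEmbedding := by
    -- The normal directions form a complex line: the real dimensions are 2n + 2 = 2(n + 1).
    refine ⟨⟨ℂ, inferInstance, inferInstance, ?_⟩, ?_⟩
    · refine isImmersionOfComplement_of_injective_mfderiv h.contMDiff_cutMap (fun p => ?_) ?_
      · refine (injective_iff_map_eq_zero _).2 fun a ha => ?_
        refine h.isSymplecticForm.nondegenerate p a fun b => ?_
        rw [← h.fubiniStudy_cutMap p a b, ha]
        exact ContinuousAlternatingMap.map_coord_zero _ 0 rfl
      · rw [finrank_real_of_complex (EuclideanSpace ℂ (Fin (n + 1)))]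
        simp [mul_add]
    · have := h.compactSpace
      exact (h.contMDiff_cutMap.continuous.isClosedEmbedding h.cutMap_injective).isEmbedding
  range_eq := h.range_cutMap
  pullsBack := h.fubiniStudy_cutMap

theorem exists_symplectomorphism [T2Space X]
    [IsManifold 𝓘(ℝ, EuclideanSpace ℝ (Fin (2 * n))) ∞ X] (h : IsUnitCut n ωX ψ) :
    ∃ F : X → CP (n + 1),
        IsSymplectomorphismOnto ωX F (CP.quadric n) (fun x => (2 : ℝ) • CP.fubiniStudy (n + 1) x) ∧
        IsSymplecticReduction (stdForm (n + 1)) (cotangentSphere n ∩ {x | x.2 ≠ 0})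
          (fun x => ‖x.2‖) 1 (F ∘ ψ) (CP.hyperplaneQuadric n)
          (fun x => (2 : ℝ) • CP.fubiniStudy (n + 1) x) :=
  ⟨cutMap ψ, h.isSymplectomorphismOnto_cutMap, isSymplecticReduction_hyperplaneQuadric
    fun _ hx h1 => h.cutMap_apply ⟨hx.1, h1.le⟩⟩

end IsUnitCut

/-! ### A potential of the lifted Fubini–Study form -/

theorem ContDiffAt.ofSubsingleton {E W : Type*} [NormedAddCommGroup E] [NormedSpace ℝ E]
    [NormedAddCommGroup W] [NormedSpace ℝ W] {f : W → E →L[ℝ] ℝ} {x : W}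
    (hf : ContDiffAt ℝ ∞ f x) :
    ContDiffAt ℝ ∞ (fun y => ContinuousAlternatingMap.ofSubsingleton ℝ E ℝ (0 : Fin 1) (f y)) x := by
  let T : (E →L[ℝ] ℝ) →ₗ[ℝ] (E [⋀^Fin 1]→L[ℝ] ℝ) :=
    { toFun := ContinuousAlternatingMap.ofSubsingleton ℝ E ℝ (0 : Fin 1)
      map_add' := fun _ _ => rfl
      map_smul' := fun _ _ => rfl }
  have hT : ∀ g, ‖T g‖ ≤ 1 * ‖g‖ := fun g => by
    rw [one_mul]
    exact (ContinuousAlternatingMap.norm_ofSubsingleton (0 : Fin 1) g).le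
  exact (T.mkContinuous 1 hT).contDiff.contDiffAt.comp x hf

theorem minSmoothness_two_le_infty : minSmoothness ℝ 2 ≤ (∞ : WithTop ℕ∞) := by
  rw [minSmoothness_of_isRCLikeNormedField]
  exact WithTop.coe_le_coe.2 (le_top : (2 : ℕ∞) ≤ ⊤)

namespace CP

variable {m : ℕ}

/-- The one-form `Im ⟨z, dz⟩ / |z|²` on `ℂ^m ∖ 0`, at the point `z`. -/
def angularForm (z : EuclideanSpace ℂ (Fin m)) : EuclideanSpace ℂ (Fin m) →L[ℝ] ℝ :=
  (‖z‖ ^ 2)⁻¹ • innerSL ℝ (Complex.I • z)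

theorem inner_I_smul (z a : EuclideanSpace ℂ (Fin m)) :
    ⟪Complex.I • z, a⟫_ℝ = (⟪z, a⟫_ℂ).im := by
  simp only [PiLp.inner_apply, Complex.inner, Complex.im_sum]
  refine Finset.sum_congr rfl fun k _ => ?_
  simp
  ring

theorem inner_im_symm (z a : EuclideanSpace ℂ (Fin m)) : (⟪z, a⟫_ℂ).im = -(⟪a, z⟫_ℂ).im := by
  rw [← inner_conj_symm, Complex.conj_im]

theorem inner_eq_re (z a : EuclideanSpace ℂ (Fin m)) : ⟪z, a⟫_ℝ = (⟪z, a⟫_ℂ).re := by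
  simp [PiLp.inner_apply, Complex.inner]

theorem contDiffAt_angularForm {z : EuclideanSpace ℂ (Fin m)} (hz : z ≠ 0) :
    ContDiffAt ℝ ∞ (angularForm (m := m)) z := by
  unfold angularForm
  refine ContDiffAt.smul (ContDiffAt.inv (contDiff_norm_sq ℝ).contDiffAt ?_) ?_
  · simpa using hz
  · exact (innerSL ℝ).contDiff.contDiffAt.comp z (by fun_prop)

theorem fderiv_angularForm_apply {z : EuclideanSpace ℂ (Fin m)} (hz : z ≠ 0)
    (a b : EuclideanSpace ℂ (Fin m)) :
    fderiv ℝ (fun z => angularForm z b) z a = (‖z‖ ^ 2)⁻¹ * (⟪a, b⟫_ℂ).im -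
      ((‖z‖ ^ 2)⁻¹) ^ 2 * (2 * (⟪z, a⟫_ℂ).re * (⟪z, b⟫_ℂ).im) := by
  have h0 : ‖z‖ ^ 2 ≠ 0 := by simpa using hz
  have h1 : HasFDerivAt (fun z : EuclideanSpace ℂ (Fin m) => ‖z‖ ^ 2) (2 • innerSL ℝ z) z :=
    (hasStrictFDerivAt_norm_sq z).hasFDerivAt
  have h2 : HasFDerivAt (fun z : EuclideanSpace ℂ (Fin m) => (‖z‖ ^ 2)⁻¹)
      (-((‖z‖ ^ 2) ^ 2)⁻¹ • (2 • innerSL ℝ z)) z := (hasDerivAt_inv h0).comp_hasFDerivAt z h1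
  have h3 : HasFDerivAt (fun z : EuclideanSpace ℂ (Fin m) => (⟪z, b⟫_ℂ).im)
      (-innerSL ℝ (Complex.I • b)) z := by
    have : (fun z : EuclideanSpace ℂ (Fin m) => (⟪z, b⟫_ℂ).im) =
        (-innerSL ℝ (Complex.I • b) : EuclideanSpace ℂ (Fin m) →L[ℝ] ℝ) := by
      funext w
      rw [neg_apply, innerSL_apply_apply, inner_I_smul, inner_im_symm]
    rw [this]
    exact ContinuousLinearMap.hasFDerivAt _
  have h4 : (fun z => angularForm z b) =
      fun z : EuclideanSpace ℂ (Fin m) => (‖z‖ ^ 2)⁻¹ * (⟪z, b⟫_ℂ).im := by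
    funext w
    simp only [angularForm, smul_apply, innerSL_apply_apply, inner_I_smul, smul_eq_mul]
  rw [h4, (h2.fun_mul h3).fderiv, inner_im_symm a b]
  simp only [add_apply, smul_apply, neg_apply, innerSL_apply_apply, inner_I_smul]
  simp only [inner_eq_re, smul_eq_mul, nsmul_eq_mul]
  field_simp
  push_cast
  ring

/-- The form `2 ω_FS`, lifted to `ℂ^m ∖ 0`, is exact. -/
theorem extDeriv_angularForm {z : EuclideanSpace ℂ (Fin m)} (hz : z ≠ 0)
    (v : Fin 2 → EuclideanSpace ℂ (Fin m)) :
    extDeriv (fun z => ContinuousAlternatingMap.ofSubsingleton ℝ (EuclideanSpace ℂ (Fin m)) ℝ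
      (0 : Fin 1) (angularForm z)) z v = 2 * liftedForm z (v 0) (v 1) := by
  have hd : DifferentiableAt ℝ (fun z => ContinuousAlternatingMap.ofSubsingleton ℝ
      (EuclideanSpace ℂ (Fin m)) ℝ (0 : Fin 1) (angularForm z)) z :=
    (contDiffAt_angularForm hz).ofSubsingleton.differentiableAt (by simp)
  rw [extDeriv_apply hd]
  refine (Fin.sum_univ_two _).trans ?_
  simp only [ContinuousAlternatingMap.ofSubsingleton_apply_apply]
  have e0 : Fin.removeNth (0 : Fin 2) v 0 = v 1 := rfl
  have e1 : Fin.removeNth (1 : Fin 2) v 0 = v 0 := rfl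
  rw [e0, e1, fderiv_angularForm_apply hz, fderiv_angularForm_apply hz, liftedForm_eq,
    inner_im_symm (v 1) (v 0)]
  simp
  ring

variable {E : Type*} [NormedAddCommGroup E] [NormedSpace ℝ E]

/-- A two-form on a vector space that is the pullback of `2 ω_FS` by a smooth lift is smooth
and closed. -/
theorem contDiff_and_closed_of_eq_liftedForm {L : E → EuclideanSpace ℂ (Fin m)}
    (hL : ContDiff ℝ ∞ L) (h0 : ∀ y, L y ≠ 0) {η : E → E [⋀^Fin 2]→L[ℝ] ℝ}
    (hη : ∀ y v, η y v = 2 * liftedForm (L y) (fderiv ℝ L y (v 0)) (fderiv ℝ L y (v 1))) :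
    ContDiff ℝ ∞ η ∧ ∀ y, extDeriv η y = 0 := by
  let α : E → E [⋀^Fin 1]→L[ℝ] ℝ := fun y =>
    ContinuousAlternatingMap.ofSubsingleton ℝ E ℝ (0 : Fin 1)
      (angularForm (L y) ∘L fderiv ℝ L y)
  have hα : ContDiff ℝ ∞ α := by
    refine contDiff_iff_contDiffAt.2 fun y => ContDiffAt.ofSubsingleton ?_
    exact ((contDiffAt_angularForm (h0 y)).comp y hL.contDiffAt).clm_comp
      (hL.fderiv_right (by simp)).contDiffAt
  -- The form is the exterior derivative of the pulled-back primitive α. Smoothness then follows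
  -- from that of α, and closedness from d² = 0.
  have hηα : η = extDeriv α := by
    funext y
    have hd : DifferentiableAt ℝ (fun z => ContinuousAlternatingMap.ofSubsingleton ℝ
        (EuclideanSpace ℂ (Fin m)) ℝ (0 : Fin 1) (angularForm z)) (L y) :=
      (contDiffAt_angularForm (h0 y)).ofSubsingleton.differentiableAt (by simp)
    have h1 := extDeriv_pullback hd (hL.contDiffAt (x := y)) minSmoothness_two_le_infty
    have h2 : α = fun x => (ContinuousAlternatingMap.ofSubsingleton ℝ
        (EuclideanSpace ℂ (Fin m)) ℝ (0 : Fin 1) (angularForm (L x))).compContinuousLinearMap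
        (fderiv ℝ L x) := by
      funext x
      ext v
      rfl
    rw [h2, h1]
    ext v
    rw [hη, ContinuousAlternatingMap.compContinuousLinearMap_apply, extDeriv_angularForm (h0 y)]
    rfl
  refine ⟨?_, fun y => ?_⟩
  · rw [hηα]
    exact (ContinuousAlternatingMap.alternatizeUncurryFinCLM ℝ E ℝ).contDiff.comp
      (hα.fderiv_right (m := ∞) (by simp))
  · rw [hηα, extDeriv_extDeriv hα minSmoothness_two_le_infty]
    rfl

/-- The lifted form is positive on complex lines transverse to `z`. -/
theorem mem_span_of_liftedForm_I_smul_eq_zero {z u : EuclideanSpace ℂ (Fin m)} (hz : z ≠ 0)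
    (h : liftedForm z u (Complex.I • u) = 0) : ∃ c : ℂ, u = c • z := by
  have h1 : horizontal z (Complex.I • u) = Complex.I • horizontal z u := by
    simpa using horizontal_smul_add_smul z u Complex.I 0
  have h0 : (‖z‖ ^ 2)⁻¹ ≠ 0 := by simpa using hz
  -- The value on u and iu is the squared norm of the horizontal part of u, divided by ‖z‖². Its
  -- vanishing puts u in the complex line of z.
  rw [liftedForm, h1, inner_smul_right, mul_eq_zero, or_iff_right h0,
    inner_self_eq_norm_sq_to_K] at h
  have h2 : horizontal z u = 0 := by
    simpa [← Complex.ofReal_pow] using h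
  have h3 : (ℂ ∙ z)ᗮ.starProjection u = 0 := h2
  rw [Submodule.starProjection_apply_eq_zero_iff, Submodule.orthogonal_orthogonal,
    Submodule.mem_span_singleton] at h3
  obtain ⟨c, hc⟩ := h3
  exact ⟨c, hc.symm⟩

end CP

/-! ### Affine parametrizations of the quadric -/

namespace CP

section Parametrization

variable {n : ℕ} (j : Fin (n + 1 + 1)) (k : Fin (n + 1))

/-- The linear form `z_j + i z_l`, where `l = j.succAbove k`. -/
def quadricDenom : EuclideanSpace ℂ (Fin (n + 1 + 1)) →L[ℂ] ℂ :=
  EuclideanSpace.proj j + Complex.I • EuclideanSpace.proj (j.succAbove k)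

/-- The coordinates other than `z_j` and `z_l`, where `l = j.succAbove k`. -/
def quadricRest : EuclideanSpace ℂ (Fin (n + 1 + 1)) →L[ℂ] EuclideanSpace ℂ (Fin n) :=
  LinearMap.toContinuousLinearMap
    { toFun := fun z => WithLp.toLp 2 fun m => z (j.succAbove (k.succAbove m))
      map_add' := fun _ _ => rfl
      map_smul' := fun _ _ => rfl }

/-- The affine coordinates `z_m / (z_j + i z_l)` on the quadric. -/
def quadricCoord (z : EuclideanSpace ℂ (Fin (n + 1 + 1))) : EuclideanSpace ℂ (Fin n) :=
  (quadricDenom j k z)⁻¹ • quadricRest j k z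

/-- The parametrization of the part of the quadric with `z_j + i z_l = 1`. -/
def quadricLift (w : EuclideanSpace ℂ (Fin n)) : EuclideanSpace ℂ (Fin (n + 1 + 1)) :=
  WithLp.toLp 2 (j.insertNth ((1 - ∑ i, w i ^ 2) / 2)
    (k.insertNth (-(Complex.I * (1 + ∑ i, w i ^ 2) / 2)) (WithLp.ofLp w) : Fin (n + 1) → ℂ) :
      Fin (n + 1 + 1) → ℂ)

variable {j k}

theorem quadricDenom_apply (z : EuclideanSpace ℂ (Fin (n + 1 + 1))) :
    quadricDenom j k z = z j + Complex.I * z (j.succAbove k) := rfl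

theorem quadricRest_apply (z : EuclideanSpace ℂ (Fin (n + 1 + 1))) (m : Fin n) :
    quadricRest j k z m = z (j.succAbove (k.succAbove m)) := rfl

theorem quadricLift_fst (w : EuclideanSpace ℂ (Fin n)) :
    quadricLift j k w j = (1 - ∑ i, w i ^ 2) / 2 := by
  simp [quadricLift]

theorem quadricLift_snd (w : EuclideanSpace ℂ (Fin n)) :
    quadricLift j k w (j.succAbove k) = -(Complex.I * (1 + ∑ i, w i ^ 2) / 2) := by
  simp [quadricLift]

theorem quadricLift_rest (w : EuclideanSpace ℂ (Fin n)) (m : Fin n) :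
    quadricLift j k w (j.succAbove (k.succAbove m)) = w m := by
  simp [quadricLift]

theorem forall_index {p : Fin (n + 1 + 1) → Prop} (h1 : p j) (h2 : p (j.succAbove k))
    (h3 : ∀ m, p (j.succAbove (k.succAbove m))) : ∀ i, p i := fun i =>
  Fin.succAboveCases (α := fun i => p i) j h1
    (fun i => Fin.succAboveCases (α := fun i => p (j.succAbove i)) k h2 h3 i) i

theorem contDiff_quadricLift : ContDiff ℂ ∞ (quadricLift j k) := by
  refine contDiff_piLp' (p := 2) (forall_index (j := j) (k := k) ?_ ?_ fun m => ?_)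
  · simp only [quadricLift_fst]
    fun_prop
  · simp only [quadricLift_snd]
    fun_prop
  · simp only [quadricLift_rest]
    fun_prop

theorem quadricDenom_quadricLift (w : EuclideanSpace ℂ (Fin n)) :
    quadricDenom j k (quadricLift j k w) = 1 := by
  rw [quadricDenom_apply, quadricLift_fst, quadricLift_snd]
  ring_nf
  rw [Complex.I_sq]
  ring

theorem quadricLift_ne_zero (w : EuclideanSpace ℂ (Fin n)) : quadricLift j k w ≠ 0 := by
  intro h
  have := quadricDenom_quadricLift (j := j) (k := k) w
  rw [h, map_zero] at this
  exact zero_ne_one this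

theorem quadricRest_quadricLift (w : EuclideanSpace ℂ (Fin n)) :
    quadricRest j k (quadricLift j k w) = w := by
  ext m
  rw [quadricRest_apply, quadricLift_rest]

theorem quadricCoord_quadricLift (w : EuclideanSpace ℂ (Fin n)) :
    quadricCoord j k (quadricLift j k w) = w := by
  rw [quadricCoord, quadricDenom_quadricLift, quadricRest_quadricLift, inv_one, one_smul]

theorem sum_sq_eq (z : EuclideanSpace ℂ (Fin (n + 1 + 1))) (j : Fin (n + 1 + 1))
    (k : Fin (n + 1)) : ∑ i, z i ^ 2 =
      z j ^ 2 + (z (j.succAbove k) ^ 2 + ∑ m, quadricRest j k z m ^ 2) := by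
  rw [Fin.sum_univ_succAbove _ j, Fin.sum_univ_succAbove _ k]
  rfl

theorem sum_sq_quadricLift (w : EuclideanSpace ℂ (Fin n)) : ∑ i, quadricLift j k w i ^ 2 = 0 := by
  rw [sum_sq_eq _ j k, quadricLift_fst, quadricLift_snd, quadricRest_quadricLift]
  ring_nf
  rw [Complex.I_sq]
  ring

theorem quadricCoord_smul {c : ℂ} (hc : c ≠ 0) (z : EuclideanSpace ℂ (Fin (n + 1 + 1))) :
    quadricCoord j k (c • z) = quadricCoord j k z := by
  rw [quadricCoord, quadricCoord, map_smul, map_smul, smul_smul, smul_eq_mul, mul_inv, mul_right_comm,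
    inv_mul_cancel₀ hc, one_mul]

/-- The factorization z_j² + z_l² = (z_j + iz_l)(z_j - iz_l) solves the quadric equation for z_j -
iz_l once z_j + iz_l is normalized to 1. The other coordinates are therefore free parameters. -/
theorem quadricLift_quadricCoord {z : EuclideanSpace ℂ (Fin (n + 1 + 1))}
    (hz : ∑ i, z i ^ 2 = 0) (hD : quadricDenom j k z ≠ 0) :
    quadricLift j k (quadricCoord j k z) = (quadricDenom j k z)⁻¹ • z := by
  have h1 : ∑ m, quadricCoord j k z m ^ 2 =
      -((quadricDenom j k z)⁻¹ * (z j - Complex.I * z (j.succAbove k))) := by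
    have h2 : ∑ m, quadricCoord j k z m ^ 2 =
        ((quadricDenom j k z)⁻¹) ^ 2 * ∑ m, quadricRest j k z m ^ 2 := by
      rw [Finset.mul_sum]
      refine Finset.sum_congr rfl fun m _ => ?_
      rw [quadricCoord, PiLp.smul_apply, smul_eq_mul, mul_pow]
    have h3 : ∑ m, quadricRest j k z m ^ 2 =
        -(quadricDenom j k z * (z j - Complex.I * z (j.succAbove k))) := by
      rw [sum_sq_eq z j k] at hz
      rw [quadricDenom_apply]
      linear_combination hz - z (j.succAbove k) ^ 2 * Complex.I_sq
    rw [h2, h3]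
    field_simp
  ext i
  revert i
  refine forall_index (j := j) (k := k) ?_ ?_ fun m => ?_
  · rw [quadricLift_fst, h1, PiLp.smul_apply, smul_eq_mul]
    field_simp
    rw [quadricDenom_apply]
    ring
  · rw [quadricLift_snd, h1, PiLp.smul_apply, smul_eq_mul]
    field_simp
    rw [quadricDenom_apply]
    linear_combination -2 * z (j.succAbove k) * Complex.I_sq
  · rw [quadricLift_rest, quadricCoord, PiLp.smul_apply, PiLp.smul_apply, quadricRest_apply]

/-- If z_i + iz_l and z_l + iz_i both vanish for i ≠ l, then 2z_i = 0. There are at least two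
indices, so the charts cover the quadric. -/
theorem exists_quadricDenom_ne_zero {z : EuclideanSpace ℂ (Fin (n + 1 + 1))} (hz : z ≠ 0) :
    ∃ j k, quadricDenom j k z ≠ 0 := by
  by_contra! h
  have h1 : ∀ i l : Fin (n + 1 + 1), i ≠ l → z i + Complex.I * z l = 0 := by
    intro i l hil
    obtain ⟨k, rfl⟩ := Fin.exists_succAbove_eq hil.symm
    exact h i k
  have h2 : ∀ i, z i = 0 := by
    intro i
    obtain ⟨l, hl⟩ := exists_ne i
    have e1 := h1 i l hl.symm
    have e2 := h1 l i hl
    have : (2 : ℂ) * z i = 0 := by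
      linear_combination e1 - Complex.I * e2 + z i * Complex.I_sq
    simpa using this
  exact hz (by ext i; simpa using h2 i)

theorem contDiffAt_quadricCoord {z : EuclideanSpace ℂ (Fin (n + 1 + 1))}
    (hD : quadricDenom j k z ≠ 0) : ContDiffAt ℝ ∞ (quadricCoord j k) z := by
  have h1 : ContDiffAt ℂ ∞ (quadricCoord j k) z :=
    ((quadricDenom j k).contDiff.contDiffAt.inv hD).smul (quadricRest j k).contDiff.contDiffAt
  exact h1.restrict_scalars ℝ

end Parametrization

end CP

/-! ### The quadric as a symplectic manifold -/

/-- The quadric as a type. -/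
abbrev Quadric (n : ℕ) : Type := {x : CP (n + 1) // x ∈ CP.quadric n}

namespace Quadric

variable {n : ℕ}

/-- A real-linear identification of `ℂ^n` with `ℝ^{2n}`. -/
def realCoord (n : ℕ) : EuclideanSpace ℂ (Fin n) ≃L[ℝ] EuclideanSpace ℝ (Fin (2 * n)) :=
  ContinuousLinearEquiv.ofFinrankEq (by
    rw [finrank_real_of_complex (EuclideanSpace ℂ (Fin n))]
    simp)

/-- The lift to `ℂ^{n+2}` of the inverse of a chart of the quadric. -/
def chartLift (j : Fin (n + 1 + 1)) (k : Fin (n + 1)) (y : EuclideanSpace ℝ (Fin (2 * n))) :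
    EuclideanSpace ℂ (Fin (n + 1 + 1)) :=
  CP.quadricLift j k ((realCoord n).symm y)

theorem contDiff_chartLift (j : Fin (n + 1 + 1)) (k : Fin (n + 1)) :
    ContDiff ℝ ∞ (chartLift j k) :=
  (CP.contDiff_quadricLift.restrict_scalars ℝ).comp (realCoord n).symm.contDiff

theorem chartLift_ne_zero (j : Fin (n + 1 + 1)) (k : Fin (n + 1))
    (y : EuclideanSpace ℝ (Fin (2 * n))) : chartLift j k y ≠ 0 :=
  CP.quadricLift_ne_zero _

theorem contMDiffAt_quadricCoord {j : Fin (n + 1 + 1)} {k : Fin (n + 1)} {x : CP (n + 1)}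
    (hx : CP.quadricDenom j k x.rep ≠ 0) :
    ContMDiffAt 𝓘(ℝ, EuclideanSpace ℂ (Fin (n + 1))) 𝓘(ℝ, EuclideanSpace ℝ (Fin (2 * n))) ∞
      (fun x => realCoord n (CP.quadricCoord j k x.rep)) x :=
  (realCoord n).contDiff.contMDiff.contMDiffAt.comp x
    (CP.contMDiffAt_comp_rep (fun _ hc z => CP.quadricCoord_smul hc z)
      (CP.contDiffAt_quadricCoord hx))

theorem quadricDenom_rep_proj {j : Fin (n + 1 + 1)} {k : Fin (n + 1)}
    {z : EuclideanSpace ℂ (Fin (n + 1 + 1))} (hz : z ≠ 0) :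
    CP.quadricDenom j k (CP.proj z).rep ≠ 0 ↔ CP.quadricDenom j k z ≠ 0 := by
  obtain ⟨c, hc, h⟩ := CP.exists_rep_proj hz
  rw [h, map_smul, smul_eq_mul, mul_ne_zero_iff, and_iff_right hc]

theorem quadricCoord_rep_proj {j : Fin (n + 1 + 1)} {k : Fin (n + 1)}
    {z : EuclideanSpace ℂ (Fin (n + 1 + 1))} (hz : z ≠ 0) :
    CP.quadricCoord j k (CP.proj z).rep = CP.quadricCoord j k z := by
  obtain ⟨c, hc, h⟩ := CP.exists_rep_proj hz
  rw [h, CP.quadricCoord_smul hc]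

theorem isOpen_quadricDenom_ne_zero (j : Fin (n + 1 + 1)) (k : Fin (n + 1)) :
    IsOpen {x : CP (n + 1) | CP.quadricDenom j k x.rep ≠ 0} := by
  rw [← CP.isQuotientMap_mk.isOpen_preimage]
  have : (fun v : {v : EuclideanSpace ℂ (Fin (n + 1 + 1)) // v ≠ 0} => CP.mk v.1 v.2) ⁻¹'
      {x : CP (n + 1) | CP.quadricDenom j k x.rep ≠ 0} =
        {v | CP.quadricDenom j k v.1 ≠ 0} := by
    ext v
    change CP.quadricDenom j k (CP.mk v.1 v.2).rep ≠ 0 ↔ _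
    rw [← CP.proj_of_ne_zero v.2]
    exact quadricDenom_rep_proj v.2
  rw [this]
  exact isOpen_ne_fun (by fun_prop) continuous_const

/-- The chart `[z] ↦ (z_m / (z_j + i z_l))_{m ≠ j, l}` of the quadric. -/
def chart (j : Fin (n + 1 + 1)) (k : Fin (n + 1)) :
    OpenPartialHomeomorph (Quadric n) (EuclideanSpace ℝ (Fin (2 * n))) where
  toFun x := realCoord n (CP.quadricCoord j k x.1.rep)
  invFun y := ⟨CP.proj (chartLift j k y),
    (CP.proj_mem_quadric_iff (chartLift_ne_zero j k y)).2 (CP.sum_sq_quadricLift _)⟩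
  source := {x | CP.quadricDenom j k x.1.rep ≠ 0}
  target := Set.univ
  map_source' _ _ := Set.mem_univ _
  map_target' y _ := by
    refine (quadricDenom_rep_proj (chartLift_ne_zero j k y)).2 ?_
    rw [chartLift, CP.quadricDenom_quadricLift]
    exact one_ne_zero
  left_inv' x hx := by
    refine Subtype.ext ?_
    change CP.proj (chartLift j k _) = x.1
    rw [chartLift, ContinuousLinearEquiv.symm_apply_apply, CP.quadricLift_quadricCoord x.2 hx,
      CP.proj_smul x.1.rep_ne_zero (inv_ne_zero hx), CP.proj_rep]
  right_inv' y _ := by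
    change realCoord n (CP.quadricCoord j k (CP.proj (chartLift j k y)).rep) = y
    rw [quadricCoord_rep_proj (chartLift_ne_zero j k y), chartLift, CP.quadricCoord_quadricLift,
      ContinuousLinearEquiv.apply_symm_apply]
  open_source := (isOpen_quadricDenom_ne_zero j k).preimage continuous_subtype_val
  open_target := isOpen_univ
  continuousOn_toFun x hx :=
    (ContinuousAt.comp (f := Subtype.val) (x := x) (contMDiffAt_quadricCoord hx).continuousAt
      continuousAt_subtype_val).continuousWithinAt
  continuousOn_invFun := by
    refine Continuous.continuousOn (Continuous.subtype_mk ?_ _)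
    exact continuous_iff_continuousAt.2 fun y =>
      (CP.contMDiffAt_proj (chartLift_ne_zero j k y)).continuousAt.comp
        (contDiff_chartLift j k).continuous.continuousAt

theorem exists_mem_chart_source (x : Quadric n) :
    ∃ i : Fin (n + 1 + 1) × Fin (n + 1), x ∈ (chart i.1 i.2).source := by
  obtain ⟨j, k, h⟩ := CP.exists_quadricDenom_ne_zero x.1.rep_ne_zero
  exact ⟨(j, k), h⟩

/-- The index of a chart at a point. -/
def chartIndex (x : Quadric n) : Fin (n + 1 + 1) × Fin (n + 1) := (exists_mem_chart_source x).choose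

instance : ChartedSpace (EuclideanSpace ℝ (Fin (2 * n))) (Quadric n) where
  atlas := Set.range fun i : Fin (n + 1 + 1) × Fin (n + 1) => chart i.1 i.2
  chartAt x := chart x.chartIndex.1 x.chartIndex.2
  mem_chart_source x := (exists_mem_chart_source x).choose_spec
  chart_mem_atlas x := ⟨x.chartIndex, rfl⟩

theorem contDiffOn_transition (i j : Fin (n + 1 + 1)) (l k : Fin (n + 1)) :
    ContDiffOn ℝ ∞ ((chart i l).symm ≫ₕ chart j k) ((chart i l).symm ≫ₕ chart j k).source := by
  intro y hy
  have hD : CP.quadricDenom j k (chartLift i l y) ≠ 0 :=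
    (quadricDenom_rep_proj (chartLift_ne_zero i l y)).1 hy.2
  have h1 : ContDiffAt ℝ ∞ (fun y => CP.quadricCoord j k (chartLift i l y)) y :=
    (CP.contDiffAt_quadricCoord hD).comp y (contDiff_chartLift i l).contDiffAt
  have h2 : ContDiffAt ℝ ∞ (fun y => realCoord n (CP.quadricCoord j k (chartLift i l y))) y :=
    (realCoord n).contDiff.contDiffAt.comp y h1
  refine (h2.congr_of_eventuallyEq (Filter.Eventually.of_forall fun y => ?_)).contDiffWithinAt
  exact congrArg (realCoord n) (quadricCoord_rep_proj (chartLift_ne_zero i l y))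

instance : IsManifold 𝓘(ℝ, EuclideanSpace ℝ (Fin (2 * n))) ∞ (Quadric n) := by
  refine isManifold_of_contDiffOn _ _ _ ?_
  rintro _ _ ⟨i, rfl⟩ ⟨j, rfl⟩
  simpa only [modelWithCornersSelf_coe, modelWithCornersSelf_coe_symm, Set.range_id,
    Set.inter_univ, Function.comp_id, Function.id_comp, Set.preimage_id_eq, id_eq]
    using contDiffOn_transition i.1 j.1 i.2 j.2

instance : IsManifold 𝓘(ℝ, EuclideanSpace ℝ (Fin (2 * n))) 1 (Quadric n) :=
  IsManifold.of_le (n := ∞) (by simp)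

theorem secondCountableTopology (n : ℕ) : SecondCountableTopology (Quadric n) := by
  have : ∀ i : Fin (n + 1 + 1) × Fin (n + 1), SecondCountableTopology (chart i.1 i.2).source :=
    fun i => (chart i.1 i.2).secondCountableTopology_source
  refine TopologicalSpace.secondCountableTopology_of_countable_cover
    (U := fun i : Fin (n + 1 + 1) × Fin (n + 1) => (chart i.1 i.2).source)
    (fun i => (chart i.1 i.2).open_source) ?_
  exact Set.iUnion_eq_univ_iff.2 exists_mem_chart_source

section Smooth

variable {E M : Type*} [NormedAddCommGroup E] [NormedSpace ℝ E] [TopologicalSpace M]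
  [ChartedSpace E M]

/-- A map to the quadric is smooth if it is smooth as a map to projective space. -/
theorem contMDiffWithinAt_of_val {f : M → Quadric n} {S : Set M} {x : M}
    (hf : ContMDiffWithinAt 𝓘(ℝ, E) 𝓘(ℝ, EuclideanSpace ℂ (Fin (n + 1))) ∞
      (fun y => (f y).1) S x) :
    ContMDiffWithinAt 𝓘(ℝ, E) 𝓘(ℝ, EuclideanSpace ℝ (Fin (2 * n))) ∞ f S x := by
  refine contMDiffWithinAt_iff_target.2 ⟨?_, ?_⟩
  · exact Topology.IsInducing.subtypeVal.continuousWithinAt_iff.2 hf.continuousWithinAt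
  · have h1 : CP.quadricDenom (f x).chartIndex.1 (f x).chartIndex.2 (f x).1.rep ≠ 0 :=
      mem_chart_source (EuclideanSpace ℝ (Fin (2 * n))) (f x)
    exact ContMDiffAt.comp_contMDiffWithinAt (f := fun y => (f y).1) x
      (contMDiffAt_quadricCoord h1) hf

theorem contMDiff_val : ContMDiff 𝓘(ℝ, EuclideanSpace ℝ (Fin (2 * n)))
    𝓘(ℝ, EuclideanSpace ℂ (Fin (n + 1))) ∞ (Subtype.val : Quadric n → CP (n + 1)) := by
  intro x
  obtain ⟨⟨j, k⟩, hx⟩ := exists_mem_chart_source x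
  have h1 : ContMDiffAt 𝓘(ℝ, EuclideanSpace ℝ (Fin (2 * n)))
      𝓘(ℝ, EuclideanSpace ℝ (Fin (2 * n))) ∞ (chart j k) x :=
    contMDiffAt_of_mem_maximalAtlas (IsManifold.subset_maximalAtlas ⟨(j, k), rfl⟩) hx
  have h2 : ContMDiffAt 𝓘(ℝ, EuclideanSpace ℝ (Fin (2 * n)))
      𝓘(ℝ, EuclideanSpace ℂ (Fin (n + 1))) ∞ (fun y => CP.proj (chartLift j k y)) (chart j k x) :=
    (CP.contMDiffAt_proj (chartLift_ne_zero j k _)).comp _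
      (contDiff_chartLift j k).contDiffAt.contMDiffAt
  refine (h2.comp x h1).congr_of_eventuallyEq ?_
  filter_upwards [(chart j k).open_source.mem_nhds hx] with z hz
  exact (congrArg Subtype.val ((chart j k).left_inv hz)).symm

end Smooth

/-- The restriction of `2 ω_FS` to the quadric. -/
def form (n : ℕ) : TwoForm (EuclideanSpace ℝ (Fin (2 * n))) (Quadric n) := fun x =>
  ((2 : ℝ) • CP.fubiniStudy (n + 1) x.1).compContinuousLinearMap
    (mfderiv 𝓘(ℝ, EuclideanSpace ℝ (Fin (2 * n))) 𝓘(ℝ, EuclideanSpace ℂ (Fin (n + 1)))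
      (Subtype.val : Quadric n → CP (n + 1)) x)

theorem form_apply (x : Quadric n)
    (a b : TangentSpace 𝓘(ℝ, EuclideanSpace ℝ (Fin (2 * n))) x) :
    form n x ![a, b] = ((2 : ℝ) • CP.fubiniStudy (n + 1) x.1)
      ![mfderiv 𝓘(ℝ, EuclideanSpace ℝ (Fin (2 * n))) 𝓘(ℝ, EuclideanSpace ℂ (Fin (n + 1)))
          (Subtype.val : Quadric n → CP (n + 1)) x a,
        mfderiv 𝓘(ℝ, EuclideanSpace ℝ (Fin (2 * n))) 𝓘(ℝ, EuclideanSpace ℂ (Fin (n + 1)))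
          (Subtype.val : Quadric n → CP (n + 1)) x b] := by
  rw [form, ContinuousAlternatingMap.compContinuousLinearMap_apply]
  congr 1
  funext i
  fin_cases i <;> rfl

/-- The inverse chart has the global lift `chartLift`, so the coordinate expression is a pullback of
the lifted form. This is the input needed for smoothness and closedness. -/
theorem inChart_form (j : Fin (n + 1 + 1)) (k : Fin (n + 1))
    (y : EuclideanSpace ℝ (Fin (2 * n))) (v : Fin 2 → EuclideanSpace ℝ (Fin (2 * n))) :
    (form n).inChart (chart j k) y v =
      2 * CP.liftedForm (chartLift j k y) (fderiv ℝ (chartLift j k) y (v 0))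
        (fderiv ℝ (chartLift j k) y (v 1)) := by
  have hd : MDifferentiableAt 𝓘(ℝ, EuclideanSpace ℝ (Fin (2 * n)))
      𝓘(ℝ, EuclideanSpace ℝ (Fin (2 * n))) (chart j k).symm y :=
    (mdifferentiable_of_mem_atlas (I := 𝓘(ℝ, EuclideanSpace ℝ (Fin (2 * n))))
      (⟨(j, k), rfl⟩ : chart j k ∈ atlas (EuclideanSpace ℝ (Fin (2 * n)))
        (Quadric n))).symm.1.mdifferentiableAt Filter.univ_mem
  have hv : MDifferentiableAt 𝓘(ℝ, EuclideanSpace ℝ (Fin (2 * n)))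
      𝓘(ℝ, EuclideanSpace ℂ (Fin (n + 1))) (Subtype.val : Quadric n → CP (n + 1))
      ((chart j k).symm y) := contMDiff_val.mdifferentiable (by simp) _
  have hc : ∀ a : EuclideanSpace ℝ (Fin (2 * n)),
      mfderivWithin 𝓘(ℝ, EuclideanSpace ℝ (Fin (2 * n))) 𝓘(ℝ, EuclideanSpace ℂ (Fin (n + 1)))
        (fun y => ((chart j k).symm y).1) Set.univ y a =
      mfderiv 𝓘(ℝ, EuclideanSpace ℝ (Fin (2 * n))) 𝓘(ℝ, EuclideanSpace ℂ (Fin (n + 1)))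
        (Subtype.val : Quadric n → CP (n + 1)) ((chart j k).symm y)
        (mfderiv 𝓘(ℝ, EuclideanSpace ℝ (Fin (2 * n))) 𝓘(ℝ, EuclideanSpace ℝ (Fin (2 * n)))
          (chart j k).symm y a) := by
    intro a
    rw [mfderivWithin_univ]
    exact congrArg (fun T => T a) (mfderiv_comp y hv hd)
  have h := CP.fubiniStudy_mfderivWithin (L := chartLift j k) (S := Set.univ)
    (((contDiff_chartLift j k).differentiable (by simp) y).hasFDerivAt.hasFDerivWithinAt)
    (chartLift_ne_zero j k y) (G := fun y => ((chart j k).symm y).1) trivial (fun _ _ => rfl)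
    (a := v 0) (b := v 1) (by simp) (by simp)
  rw [hc, hc] at h
  rw [← h]
  have e : (form n).inChart (chart j k) y v = form n ((chart j k).symm y)
      ![mfderiv 𝓘(ℝ, EuclideanSpace ℝ (Fin (2 * n))) 𝓘(ℝ, EuclideanSpace ℝ (Fin (2 * n)))
          (chart j k).symm y (v 0),
        mfderiv 𝓘(ℝ, EuclideanSpace ℝ (Fin (2 * n))) 𝓘(ℝ, EuclideanSpace ℝ (Fin (2 * n)))
          (chart j k).symm y (v 1)] := by
    change form n ((chart j k).symm y) (fun i => mfderiv 𝓘(ℝ, EuclideanSpace ℝ (Fin (2 * n)))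
      𝓘(ℝ, EuclideanSpace ℝ (Fin (2 * n))) (chart j k).symm y (v i)) = _
    congr 1
    funext i
    fin_cases i <;> rfl
  rw [e, form_apply]
  rfl

end Quadric

/-! ### Nondegeneracy of the restricted form, and maps into the quadric -/

namespace Quadric

variable {n : ℕ}

/-- The parametrization is holomorphic, so testing against ia and positivity show that its
derivative along a is a multiple c of the lift. The linear form `quadricDenom` is constantly 1 on
the lift, hence c = 0, and `quadricRest` is a left inverse of the derivative, hence a = 0. -/
theorem eq_zero_of_liftedForm_eq_zero {j : Fin (n + 1 + 1)} {k : Fin (n + 1)}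
    {y a : EuclideanSpace ℝ (Fin (2 * n))}
    (h : ∀ b, CP.liftedForm (chartLift j k y) (fderiv ℝ (chartLift j k) y a)
      (fderiv ℝ (chartLift j k) y b) = 0) : a = 0 := by
  set w := (realCoord n).symm y with hw
  set T := fderiv ℂ (CP.quadricLift j k) w with hT
  have hTd : HasFDerivAt (CP.quadricLift j k) T w :=
    (CP.contDiff_quadricLift.differentiable (by simp) w).hasFDerivAt
  have hL : ∀ b, fderiv ℝ (chartLift j k) y b = T ((realCoord n).symm b) := by
    intro b
    have h1 : HasFDerivAt (chartLift j k)
        ((T.restrictScalars ℝ) ∘L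
          ((realCoord n).symm : EuclideanSpace ℝ (Fin (2 * n)) →L[ℝ] EuclideanSpace ℂ (Fin n))) y :=
      (hTd.restrictScalars ℝ).comp y (realCoord n).symm.hasFDerivAt
    rw [h1.fderiv]
    rfl
  have hD : ∀ c, CP.quadricDenom j k (T c) = 0 := by
    intro c
    have h1 := ((CP.quadricDenom j k).hasFDerivAt.comp w hTd)
    have h2 : (CP.quadricDenom j k) ∘ CP.quadricLift j k = fun _ => 1 :=
      funext CP.quadricDenom_quadricLift
    rw [h2] at h1
    exact congrArg (fun A => A c) (h1.unique (hasFDerivAt_const 1 w))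
  have hR : ∀ c, CP.quadricRest j k (T c) = c := by
    intro c
    have h1 := ((CP.quadricRest j k).hasFDerivAt.comp w hTd)
    have h2 : (CP.quadricRest j k) ∘ CP.quadricLift j k = id :=
      funext CP.quadricRest_quadricLift
    rw [h2] at h1
    exact congrArg (fun A => A c) (h1.unique (hasFDerivAt_id w))
  have h3 := h (realCoord n (Complex.I • (realCoord n).symm a))
  rw [hL, hL, ContinuousLinearEquiv.symm_apply_apply, map_smul] at h3
  obtain ⟨c, hc⟩ := CP.mem_span_of_liftedForm_I_smul_eq_zero (chartLift_ne_zero j k y) h3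
  have hc0 : c = 0 := by
    have h4 := congrArg (CP.quadricDenom j k) hc
    rw [hD, map_smul, chartLift, CP.quadricDenom_quadricLift, smul_eq_mul, mul_one] at h4
    exact h4.symm
  rw [hc0, zero_smul] at hc
  have h5 := hR ((realCoord n).symm a)
  rw [hc, map_zero] at h5
  exact (realCoord n).symm.map_eq_zero_iff.1 h5.symm

theorem isSymplecticForm_form (n : ℕ) : IsSymplecticForm (form n) where
  smooth := by
    rintro _ ⟨⟨j, k⟩, rfl⟩
    exact (CP.contDiff_and_closed_of_eq_liftedForm (contDiff_chartLift j k) (chartLift_ne_zero j k)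
      (inChart_form j k)).1.contDiffOn
  closed := by
    rintro _ ⟨⟨j, k⟩, rfl⟩ y -
    exact (CP.contDiff_and_closed_of_eq_liftedForm (contDiff_chartLift j k) (chartLift_ne_zero j k)
      (inChart_form j k)).2 y
  nondegenerate := by
    intro x a ha
    obtain ⟨⟨j, k⟩, hx⟩ := exists_mem_chart_source x
    obtain ⟨y, rfl⟩ : ∃ y, (chart j k).symm y = x := ⟨_, (chart j k).left_inv hx⟩
    have hmem : chart j k ∈ atlas (EuclideanSpace ℝ (Fin (2 * n))) (Quadric n) := ⟨(j, k), rfl⟩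
    have he := mdifferentiable_of_mem_atlas (I := 𝓘(ℝ, EuclideanSpace ℝ (Fin (2 * n)))) hmem
    let D : EuclideanSpace ℝ (Fin (2 * n)) →ₗ[ℝ] EuclideanSpace ℝ (Fin (2 * n)) :=
      (mfderiv 𝓘(ℝ, EuclideanSpace ℝ (Fin (2 * n))) 𝓘(ℝ, EuclideanSpace ℝ (Fin (2 * n)))
        (chart j k).symm y).toLinearMap
    have hD : Function.Injective D := by
      refine Function.LeftInverse.injective (g := mfderiv 𝓘(ℝ, EuclideanSpace ℝ (Fin (2 * n)))
        𝓘(ℝ, EuclideanSpace ℝ (Fin (2 * n))) (chart j k) ((chart j k).symm y)) fun a => ?_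
      exact congrArg (fun A => A a) (he.comp_symm_deriv (x := y) trivial)
    -- An injective endomorphism of a finite-dimensional space is surjective, so every tangent
    -- vector at the point comes from chart coordinates.
    obtain ⟨a, rfl⟩ := (LinearMap.injective_iff_surjective.1 hD) a
    have ha0 : a = 0 := by
      refine eq_zero_of_liftedForm_eq_zero (j := j) (k := k) (y := y) fun b => ?_
      have h1 : (form n).inChart (chart j k) y ![a, b] = 0 := by
        rw [← ha (D b)]
        change form n ((chart j k).symm y) (fun i => D (![a, b] i)) = _
        congr 1
        funext i
        fin_cases i <;> rfl
      rw [inChart_form] at h1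
      simpa using h1
    rw [ha0]
    exact map_zero D

theorem form_mfderivWithin {V : Type*} [NormedAddCommGroup V] [NormedSpace ℝ V] {f : V → Quadric n}
    {S : Set V} {L : V → EuclideanSpace ℂ (Fin (n + 1 + 1))}
    {L' : V →L[ℝ] EuclideanSpace ℂ (Fin (n + 1 + 1))} {x : V} (hx : x ∈ S)
    (hf : MDifferentiableWithinAt 𝓘(ℝ, V) 𝓘(ℝ, EuclideanSpace ℝ (Fin (2 * n))) f S x)
    (hfL : ∀ y ∈ S, (f y).1 = CP.proj (L y)) (hL : HasFDerivWithinAt L L' S x)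
    (hnorm : ∀ y ∈ S, ‖L y‖ ^ 2 = 2) {a b : V} (ha : a ∈ tangentConeAt ℝ S x)
    (hb : b ∈ tangentConeAt ℝ S x) :
    form n (f x) ![mfderivWithin 𝓘(ℝ, V) 𝓘(ℝ, EuclideanSpace ℝ (Fin (2 * n))) f S x a,
      mfderivWithin 𝓘(ℝ, V) 𝓘(ℝ, EuclideanSpace ℝ (Fin (2 * n))) f S x b] =
      (⟪L' a, L' b⟫_ℂ).im := by
  have h := CP.two_fubiniStudy_mfderivWithin hL hnorm (G := fun y => (f y).1) hx hfL ha hb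
  have hv : MDifferentiableAt 𝓘(ℝ, EuclideanSpace ℝ (Fin (2 * n)))
      𝓘(ℝ, EuclideanSpace ℂ (Fin (n + 1))) (Subtype.val : Quadric n → CP (n + 1)) (f x) :=
    contMDiff_val.mdifferentiable (by simp) _
  rw [mfderivWithin_comp_of_mem_tangentConeAt hf hv hx (fun _ _ => rfl) ha,
    mfderivWithin_comp_of_mem_tangentConeAt hf hv hx (fun _ _ => rfl) hb] at h
  rw [form_apply]
  exact h

open Classical in
/-- The point of the quadric that is given by a point of projective space, with a junk value if
this is not in the quadric. -/
def ofCP (q : CP (n + 1)) : Quadric n :=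
  if h : q ∈ CP.quadric n then ⟨q, h⟩ else (chart 0 0).symm 0

theorem val_ofCP {q : CP (n + 1)} (hq : q ∈ CP.quadric n) : (ofCP q).1 = q := by
  rw [ofCP, dif_pos hq]

theorem ofCP_val (x : Quadric n) : ofCP x.1 = x := Subtype.ext (val_ofCP x.2)

theorem image_ofCP {V : Type*} {g : V → CP (n + 1)} {S : Set V} {R : Set (CP (n + 1))}
    (h : g '' S = R) (hR : R ⊆ CP.quadric n) :
    (fun x => ofCP (g x)) '' S = Subtype.val ⁻¹' R := by
  ext x
  constructor
  · rintro ⟨y, hy, rfl⟩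
    have hg : g y ∈ R := h ▸ ⟨y, hy, rfl⟩
    change (ofCP (g y)).1 ∈ R
    rwa [val_ofCP (hR hg)]
  · intro hx
    obtain ⟨y, hy, he⟩ : x.1 ∈ g '' S := h ▸ hx
    exact ⟨y, hy, by simp only [he, ofCP_val]⟩

theorem contMDiffOn_ofCP_proj {V : Type*} [NormedAddCommGroup V] [NormedSpace ℝ V]
    {L : V → EuclideanSpace ℂ (Fin (n + 1 + 1))} {S : Set V}
    (hL : ContDiffOn ℝ ∞ L S) (h0 : ∀ x ∈ S, L x ≠ 0)
    (hq : ∀ x ∈ S, CP.proj (L x) ∈ CP.quadric n) :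
    ContMDiffOn 𝓘(ℝ, V) 𝓘(ℝ, EuclideanSpace ℝ (Fin (2 * n))) ∞ (fun x => ofCP (CP.proj (L x))) S :=
  fun x hx => contMDiffWithinAt_of_val <|
    (CP.contMDiffOn_proj_comp hL h0 x hx).congr (fun y hy => val_ofCP (hq y hy))
      (val_ofCP (hq x hx))

end Quadric

/-! ### The quadric as a cut -/

namespace Quadric

variable {n : ℕ}

theorem isOpen_val_preimage_regularQuadric (n : ℕ) :
    IsOpen ((Subtype.val : Quadric n → CP (n + 1)) ⁻¹' CP.regularQuadric n) := by
  have h1 : IsOpen {x : CP (n + 1) | 2 * ‖x.rep (Fin.last (n + 1))‖ ^ 2 < ‖x.rep‖ ^ 2} := by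
    rw [← CP.isQuotientMap_mk.isOpen_preimage]
    have : (fun v : {v : EuclideanSpace ℂ (Fin (n + 1 + 1)) // v ≠ 0} => CP.mk v.1 v.2) ⁻¹'
        {x : CP (n + 1) | 2 * ‖x.rep (Fin.last (n + 1))‖ ^ 2 < ‖x.rep‖ ^ 2} =
          {v | 2 * ‖v.1 (Fin.last (n + 1))‖ ^ 2 < ‖v.1‖ ^ 2} := by
      ext v
      obtain ⟨c, hc, h⟩ := CP.exists_rep_mk v.1 v.2
      change 2 * ‖(CP.mk v.1 v.2).rep (Fin.last (n + 1))‖ ^ 2 < ‖(CP.mk v.1 v.2).rep‖ ^ 2 ↔ _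
      rw [h, PiLp.smul_apply, smul_eq_mul, norm_mul, norm_smul, mul_pow, mul_pow, mul_left_comm]
      exact mul_lt_mul_iff_right₀ (by positivity)
    rw [this]
    exact isOpen_lt (by fun_prop) (by fun_prop)
  have h2 : (Subtype.val : Quadric n → CP (n + 1)) ⁻¹' CP.regularQuadric n =
      Subtype.val ⁻¹' {x : CP (n + 1) | 2 * ‖x.rep (Fin.last (n + 1))‖ ^ 2 < ‖x.rep‖ ^ 2} :=
    Set.ext fun x => and_iff_right x.2
  rw [h2]
  exact h1.preimage continuous_subtype_val

/-- The map from the closed disc bundle onto the quadric. -/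
def ofDisc (n : ℕ) (x : Doubled n) : Quadric n := ofCP (CP.proj (discLift n x))

/-- The map from the level set of the Hamiltonian of the cut to the quadric. -/
def ofLevel (n : ℕ) (x : Doubled n × ℂ) : Quadric n := ofCP (CP.proj (reductionLift n x))

theorem val_ofDisc {x : Doubled n} (hx : x ∈ cotangentSphere n) (h1 : ‖x.2‖ ≤ 1) :
    (ofDisc n x).1 = CP.proj (discLift n x) :=
  val_ofCP (proj_discLift_mem_quadric hx h1)

theorem val_ofLevel {x : Doubled n × ℂ} (hx : x ∈ cutLevel n) :
    (ofLevel n x).1 = CP.proj (reductionLift n x) := by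
  refine val_ofCP ?_
  have h : CP.proj (reductionLift n x) ∈ CP.regularQuadric n := by
    rw [← image_reductionLift]
    exact ⟨x, hx, rfl⟩
  exact h.1

theorem image_ofDisc_interior : ofDisc n '' {x ∈ cotangentSphere n | ‖x.2‖ < 1} =
    Subtype.val ⁻¹' {q ∈ CP.quadric n | q.rep (Fin.last (n + 1)) ≠ 0} :=
  image_ofCP image_discLift_interior fun _ h => h.1

theorem image_ofDisc_boundary : ofDisc n '' {x ∈ punctured n | ‖x.2‖ = 1} =
    Subtype.val ⁻¹' CP.hyperplaneQuadric n :=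
  image_ofCP image_discLift_boundary fun _ h => h.1

theorem image_ofDisc_regular : ofDisc n '' {x ∈ punctured n | ‖x.2‖ ≤ 1} =
    Subtype.val ⁻¹' CP.regularQuadric n :=
  image_ofCP image_discLift_regular fun _ h => h.1

theorem isSymplecticOpenEmbeddingOn_ofDisc (n : ℕ) :
    IsSymplecticOpenEmbeddingOn (stdForm (n + 1)) {x ∈ cotangentSphere n | ‖x.2‖ < 1}
      (ofDisc n) (form n) where
  smooth := contMDiffOn_ofCP_proj (contDiffOn_discLift.mono fun _ h => h.2)
    (fun _ hx => discLift_ne_zero hx.1 hx.2.le)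
    (fun _ hx => proj_discLift_mem_quadric hx.1 hx.2.le)
  isOpen_image := by
    have h : (Subtype.val : Quadric n → CP (n + 1)) ⁻¹'
        {q ∈ CP.quadric n | q.rep (Fin.last (n + 1)) ≠ 0} =
        Subtype.val ⁻¹' {q : CP (n + 1) | q.rep (Fin.last (n + 1)) ≠ 0} :=
      Set.ext fun x => and_iff_right x.2
    rw [image_ofDisc_interior, h]
    exact (CP.isOpen_affine _).preimage continuous_subtype_val
  inverse := by
    refine ⟨fun q => discInverse q.1.rep, ?_, fun x hx => ?_⟩
    · rw [image_ofDisc_interior]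
      intro q hq
      exact ((contMDiffAt_discInverse hq.2).comp q contMDiff_val.contMDiffAt).contMDiffWithinAt
    · simp only [val_ofDisc hx.1 hx.2.le]
      exact discInverse_rep_proj hx.1 hx.2
  pullsBack := by
    intro x hx a ha b hb
    obtain ⟨L', hL, hL'⟩ := exists_hasFDerivAt_discLift hx.2
    rw [← hL']
    refine form_mfderivWithin hx ?_ (fun y hy => val_ofDisc hy.1 hy.2.le) hL.hasFDerivWithinAt
      (fun y hy => discLift_norm_sq hy.1 hy.2.le) ha hb
    exact (contMDiffOn_ofCP_proj (contDiffOn_discLift.mono fun _ h => h.2)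
      (fun _ hx => discLift_ne_zero hx.1 hx.2.le)
      (fun _ hx => proj_discLift_mem_quadric hx.1 hx.2.le) x hx).mdifferentiableWithinAt (by simp)

theorem contMDiffOn_ofLevel (n : ℕ) : ContMDiffOn 𝓘(ℝ, Doubled n × ℂ)
    𝓘(ℝ, EuclideanSpace ℝ (Fin (2 * n))) ∞ (ofLevel n) (cutLevel n) := by
  refine contMDiffOn_ofCP_proj (contDiffOn_reductionLift.mono fun _ h => h.1.1.2)
    (fun _ hx => reductionLift_ne_zero hx) fun x hx => ?_
  rw [← val_ofLevel hx]
  exact (ofLevel n x).2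

theorem isSymplecticReduction_ofLevel (n : ℕ) :
    IsSymplecticReduction (formProdComplex (stdForm (n + 1))) (punctured n ×ˢ Set.univ)
      (cutHamiltonian fun x => ‖x.2‖) 1 (ofLevel n) (Subtype.val ⁻¹' CP.regularQuadric n)
      (form n) where
  smooth := contMDiffOn_ofLevel n
  image_eq := image_ofCP image_reductionLift fun _ h => h.1
  fibres := by
    intro x hx h1 y hy h2
    have hxc : x ∈ cutLevel n := ⟨hx, h1⟩
    have hyc : y ∈ cutLevel n := ⟨hy, h2⟩
    rw [Subtype.ext_iff, val_ofLevel hxc, val_ofLevel hyc, sameOrbit_cut_iff hx.1]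
    exact proj_reductionLift_eq_iff hxc hyc
  sections := by
    intro x hx h1
    have hxc : x ∈ cutLevel n := ⟨hx, h1⟩
    obtain ⟨O, hO, σ, hσ1, hσ2, hσ3⟩ := exists_section_reductionLift hxc
    rw [← val_ofLevel hxc] at hO hσ2
    refine ⟨Subtype.val ⁻¹' O, continuous_subtype_val.continuousAt hO, fun q => σ q.1, ?_, hσ2, ?_⟩
    · intro q hq
      exact ((hσ1 q.1 hq).comp q contMDiff_val.contMDiffAt).contMDiffWithinAt
    · intro q hq
      obtain ⟨h3, h4⟩ := hσ3 q.1 hq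
      refine ⟨h3.1, h3.2, Subtype.ext ?_⟩
      rw [val_ofLevel h3, h4]
  pullsBack := by
    intro x hx a ha b hb
    obtain ⟨L', hL, hL'⟩ := exists_hasFDerivAt_reductionLift hx
    rw [← hL' a ha b hb]
    exact form_mfderivWithin hx
      ((contMDiffOn_ofLevel n x hx).mdifferentiableWithinAt (by simp))
      (fun y hy => val_ofLevel hy) hL.hasFDerivWithinAt
      (fun y hy => reductionLift_norm_sq hy) ha hb

/-- The quadric is the symplectic cut of the cotangent bundle of the sphere. -/
theorem isUnitCut (n : ℕ) : IsUnitCut n (form n) (ofDisc n) where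
  isOpen_domain := isOpen_ne_fun continuous_snd continuous_const
  smooth_hamiltonian := fun x hx =>
    (contDiff_snd.contDiffAt.norm ℝ hx.2).contDiffWithinAt
  level_subset := by
    intro x _ h1 h0
    simp [h0] at h1
  circleAction := fun x hx => ⟨fun t => normFlow t x, isHamiltonianTrajectory_normFlow hx,
    normFlow_zero x, normFlow_periodic x⟩
  isSymplecticForm := isSymplecticForm_form n
  surjective := by
    refine Set.eq_univ_of_forall fun q => ?_
    obtain ⟨x, hx, h1, h2⟩ := exists_proj_discLift_eq q.2
    exact ⟨x, ⟨hx, h1⟩, Subtype.ext ((val_ofDisc hx h1).trans h2)⟩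
  disjoint := by
    rw [Set.disjoint_left]
    rintro _ ⟨x, hx, rfl⟩ ⟨y, hy, h⟩
    have h1 : ofDisc n x ∈ ofDisc n '' {x ∈ cotangentSphere n | ‖x.2‖ < 1} := ⟨x, hx, rfl⟩
    have hy0 : y.2 ≠ 0 := fun h0 => by simpa [h0] using hy.2
    have h2 : ofDisc n x ∈ ofDisc n '' {x ∈ punctured n | ‖x.2‖ = 1} :=
      ⟨y, ⟨⟨hy.1, hy0⟩, hy.2⟩, h⟩
    rw [image_ofDisc_interior] at h1
    rw [image_ofDisc_boundary] at h2
    exact h1.2 h2.2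
  interior := isSymplecticOpenEmbeddingOn_ofDisc n
  isOpen_boundary := by
    rw [image_ofDisc_regular]
    exact isOpen_val_preimage_regularQuadric n
  boundary := by
    refine ⟨ofLevel n, ?_, fun x hx h1 => ?_⟩
    · rw [image_ofDisc_regular]
      exact isSymplecticReduction_ofLevel n
    · rw [ofLevel, reductionLift_sqrt h1, ofDisc]

end Quadric

end

theorem mainTheorem9 (n : ℕ) :
    (∃ (X : Type) (_ : TopologicalSpace X)
        (_ : ChartedSpace (EuclideanSpace ℝ (Fin (2 * n))) X)
        (ωX : TwoForm (EuclideanSpace ℝ (Fin (2 * n))) X)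
        (ψ : EuclideanSpace ℝ (Fin (n + 1)) × EuclideanSpace ℝ (Fin (n + 1)) → X),
        T2Space X ∧ SecondCountableTopology X ∧
          IsManifold 𝓘(ℝ, EuclideanSpace ℝ (Fin (2 * n))) ∞ X ∧ IsUnitCut n ωX ψ) ∧
    ∀ (X : Type*) [TopologicalSpace X] [T2Space X] [SecondCountableTopology X]
      [ChartedSpace (EuclideanSpace ℝ (Fin (2 * n))) X]
      [IsManifold 𝓘(ℝ, EuclideanSpace ℝ (Fin (2 * n))) ∞ X]
      (ωX : TwoForm (EuclideanSpace ℝ (Fin (2 * n))) X)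
      (ψ : EuclideanSpace ℝ (Fin (n + 1)) × EuclideanSpace ℝ (Fin (n + 1)) → X),
      IsUnitCut n ωX ψ →
      ∃ F : X → CP (n + 1),
        IsSymplectomorphismOnto ωX F (CP.quadric n) (fun x => (2 : ℝ) • CP.fubiniStudy (n + 1) x) ∧
        IsSymplecticReduction (stdForm (n + 1)) (cotangentSphere n ∩ {x | x.2 ≠ 0})
          (fun x => ‖x.2‖) 1 (F ∘ ψ) (CP.hyperplaneQuadric n)
          (fun x => (2 : ℝ) • CP.fubiniStudy (n + 1) x) := by
  exact ⟨⟨Quadric n, inferInstance, inferInstance, Quadric.form n, Quadric.ofDisc n, inferInstance,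
    Quadric.secondCountableTopology n, inferInstance, Quadric.isUnitCut n⟩,
    fun X _ _ _ _ _ ωX ψ h => h.exists_symplectomorphism⟩
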